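/- **Theorem 4.3 (The General Similitude).** *Classical data.* A compact oriented surface $S\subset\mathbb R^3$ is a compact smooth embedded surface, with possibly empty boundary (corners allowed), together with its positive unit normal field $n_S$; its boundary $C=\partial S$ carries the induced orientation ($S$ lies on the left). For $h\in\mathbb R$, the dipole sheet of unit density and thickness $h$ on $S$ is obtained by sliding every surface element $dA(p)$ of $S$, carrying the charge $dA(p)$, to $p+\frac h2n_S(p)$, and, carrying the charge $-dA(p)$, to $p-\frac h2n_S(p)$. Omitting physical constants, its electric field and the Biot–Savart field of $C$ are $$\mathbf E^{\mathrm{dp}}_{(S,1,h)}(r)=\int_S\left(\frac{r-p-\frac h2n_S(p)}{\|r-p-\frac h2n_S(p)\|^3}-\frac{r-p+\frac h2n_S(p)}{\|r-p+\frac h2n_S(p)\|^3}\right)dA(p),\qquad \mathbf B_C(r)=\int_C\frac{d\mathbf p\times(r-p)}{\|r-p\|^3}.$$ Let $P\subset\mathbb R^k$ be open and let $(S_t)_{t\in P}$ be a smooth family of compact oriented surfaces, with total space proper over $P$ and covered by smooth fibrewise charts ($k=0$ is the case of a single surface $S$). Put $C_t=\partial S_t$, $V=\{(t,r): t\in P,\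 r\notin S_t\}$ and $U=\{(t,h,r): t\in P,\ r\ne p\pm\frac h2n_{S_t}(p)\text{ for all }p\in S_t\}$. Then $U$ and $V$ are open, and the maps $\mathbf E^{\mathrm{dp}}:U\to\mathbb R^3$, $(t,h,r)\mapsto\mathbf E^{\mathrm{dp}}_{(S_t,1,h)}(r)$, and $\mathbf B:V\to\mathbb R^3$, $(t,r)\mapsto\mathbf B_{C_t}(r)$, are smooth. *Internal statement.* Let $\iota:\mathrm{Mfd}\to\mathcal E$ be any well-adapted model of synthetic differential geometry: $\mathcal E$ is the topos of sheaves on a small site, and $\iota$ is a full and faithful functor which preserves the terminal object, transversal pullbacks and open coverings, and for which $R=\iota(\mathbb R)$ satisfies the Kock–Lawvere axiom for all Weil algebras. At every stage (object of the site) let $h\in D=\{d\in R: d^2=0\}$ and let $(t,r)\in\iota(V)$, that is, $r$ is a point of $R^3$ not on the surface $S_t$. Then $(t,h,r)$ belongs to $\iota(U)$, by a unique lift, and $$\mathbf E^{\mathrm{dp}}_{(S_t,1,h)}(r)=h\,\mathbf B_{C_t}(r)$$ in $R^3$, where both sides are obtained by applying $\iota$ to the smooth maps $\mathbf E^{\mathrm{dp}}$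 and $\mathbf B$. *External statement.* For every $t\in P$ and every $r\in\mathbb R^3\setminus S_t$, with $S=S_t$ and $C=C_t$, $$\int_S\left(\frac{3\,\big((r-p)\cdot n_S(p)\big)\,(r-p)}{\|r-p\|^5}-\frac{n_S(p)}{\|r-p\|^3}\right)dA(p)=\mathbf B_C(r).$$ -/

import Mathlib

open CategoryTheory MeasureTheory Opposite TopologicalSpace
open scoped Manifold ContDiff Topology

universe w

/-! ## Oriented surfaces in Euclidean three-space -/

/-- Euclidean space of dimension three. -/
abbrev E3 : Type := EuclideanSpace ℝ (Fin 3)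

/-- The cross product on Euclidean three-space. -/
noncomputable def cross (a b : E3) : E3 :=
  WithLp.toLp 2 (crossProduct (WithLp.ofLp a) (WithLp.ofLp b))

/-- The closed quadrant, the local model of a surface whose boundary may have corners. -/
def quadrant : Set (ℝ × ℝ) := {x | 0 ≤ x.1 ∧ 0 ≤ x.2}

/-- First partial derivative of a local parametrization. -/
noncomputable def dFst (φ : ℝ × ℝ → E3) (x : ℝ × ℝ) : E3 := fderiv ℝ φ x (1, 0)

/-- Second partial derivative of a local parametrization. -/
noncomputable def dSnd (φ : ℝ × ℝ → E3) (x : ℝ × ℝ) : E3 := fderiv ℝ φ x (0, 1)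

/-- `φ`, restricted to `W ∩ quadrant`, is a smooth local parametrization of the set `S`: an
injective immersion, homeomorphic onto a relatively open subset of `S`, and positively oriented
with respect to the unit normal field `n`.  Here `W` is open in the plane, so that `φ` is smooth up
to the edges of the quadrant; `W` may lie in the interior of the quadrant (charts without boundary
points), meet one edge only, or contain the corner. -/
structure IsChart (S : Set E3) (n : E3 → E3) (W : Set (ℝ × ℝ)) (φ : ℝ × ℝ → E3) : Prop where
  isOpen : IsOpen W
  smooth : ContDiffOn ℝ ∞ φ W
  injOn : Set.InjOn φ (W ∩ quadrant)
  relOpen : ∀ O : Set (ℝ × ℝ), IsOpen O → O ⊆ W →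
    ∃ G : Set E3, IsOpen G ∧ φ '' (O ∩ quadrant) = S ∩ G
  immersion : ∀ x ∈ W ∩ quadrant, cross (dFst φ x) (dSnd φ x) ≠ 0
  oriented : ∀ x ∈ W ∩ quadrant,
    cross (dFst φ x) (dSnd φ x) = ‖cross (dFst φ x) (dSnd φ x)‖ • n (φ x)

/-- A compact oriented smooth surface in Euclidean three-space, with (possibly empty, possibly
cornered) boundary.  The orientation is given by the unit normal in the positive direction. -/
structure OrientedSurface where
  carrier : Set E3
  isCompact : IsCompact carrier
  normal : E3 → E3
  exists_chart : ∀ p ∈ carrier, ∃ (W : Set (ℝ × ℝ)) (φ : ℝ × ℝ → E3),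
    IsChart carrier normal W φ ∧ ∃ x ∈ W ∩ quadrant, φ x = p

namespace OrientedSurface

variable (S : OrientedSurface)

/-- Surface area on `S`: the measure which in every local parametrization `φ` is
`‖∂₁φ × ∂₂φ‖ du dv` (the least measure dominating all these local expressions; they agree on
overlaps). -/
noncomputable def areaMeasure : Measure E3 :=
  ⨆ (W : Set (ℝ × ℝ)) (φ : ℝ × ℝ → E3) (_ : IsChart S.carrier S.normal W φ),
    Measure.map φ ((volume.restrict (W ∩ quadrant)).withDensity
      fun x => ENNReal.ofReal ‖cross (dFst φ x) (dSnd φ x)‖)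

/-- Arc length on the boundary `C` of `S`: the measure which along the lower edge `v = 0` of every
positively oriented local parametrization is `‖∂₁φ‖ du`.  (An oriented rotation of the parameters
turns the edge `u = 0`, away from the corner, into a lower edge.) -/
noncomputable def boundaryMeasure : Measure E3 :=
  ⨆ (W : Set (ℝ × ℝ)) (φ : ℝ × ℝ → E3) (_ : IsChart S.carrier S.normal W φ),
    Measure.map (fun u : ℝ => φ (u, 0))
      ((volume.restrict {u : ℝ | (u, (0 : ℝ)) ∈ W ∩ quadrant}).withDensity
        fun u => ENNReal.ofReal ‖dFst φ (u, 0)‖)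

/-- The unit tangent of the boundary of `S` in the induced orientation (the surface lies on the
left): the direction of `∂₁φ` on the lower edge of positively oriented local parametrizations. -/
noncomputable def boundaryTangent (p : E3) : E3 :=
  Classical.epsilon fun τ => ∃ (W : Set (ℝ × ℝ)) (φ : ℝ × ℝ → E3) (u : ℝ),
    IsChart S.carrier S.normal W φ ∧ (u, (0 : ℝ)) ∈ W ∩ quadrant ∧ φ (u, 0) = p ∧
      τ = ‖dFst φ (u, 0)‖⁻¹ • dFst φ (u, 0)

/-- The Coulomb field at `x` of a unit charge at the origin. -/
noncomputable def coulomb (x : E3) : E3 := (‖x‖ ^ 3)⁻¹ • x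

/-- The electric field at `r` of the positive sheet: every surface element `dA` at `p ∈ S` carries
the charge `σ dA` and is slid to `p + (h / 2) n(p)`. -/
noncomputable def fieldPlus (σ h : ℝ) (r : E3) : E3 :=
  ∫ p, σ • coulomb (r - (p + (h / 2) • S.normal p)) ∂S.areaMeasure

/-- The electric field at `r` of the negative sheet: every surface element `dA` at `p ∈ S` carries
the charge `-σ dA` and is slid to `p - (h / 2) n(p)`. -/
noncomputable def fieldMinus (σ h : ℝ) (r : E3) : E3 :=
  ∫ p, (-σ) • coulomb (r - (p - (h / 2) • S.normal p)) ∂S.areaMeasure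

/-- The electric field of the dipole sheet of density `σ` and thickness `h` on `S`. -/
noncomputable def dipoleField (σ h : ℝ) (r : E3) : E3 :=
  S.fieldPlus σ h r + S.fieldMinus σ h r

/-- The field of the double layer of unit density on `S`, that is, of a continuous distribution of
point dipoles with moment `n dA`. -/
noncomputable def doubleLayerField (r : E3) : E3 :=
  ∫ p, ((3 * inner ℝ (r - p) (S.normal p) / ‖r - p‖ ^ 5) • (r - p)
    - (‖r - p‖ ^ 3)⁻¹ • S.normal p) ∂S.areaMeasure

/-- The Biot-Savart field `∫_C dp × (r - p) / ‖r - p‖³` of a unit current along the induced oriented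
boundary `C` of `S`. -/
noncomputable def biotSavart (r : E3) : E3 :=
  ∫ p, (‖r - p‖ ^ 3)⁻¹ • cross (S.boundaryTangent p) (r - p) ∂S.boundaryMeasure

end OrientedSurface

/-! ## Smooth families of oriented surfaces -/

/-- The total space of a family of surfaces over a parameter set. -/
def totalSpace {k : ℕ} (P : Set (EuclideanSpace ℝ (Fin k)))
    (S : EuclideanSpace ℝ (Fin k) → OrientedSurface) : Set (EuclideanSpace ℝ (Fin k) × E3) :=
  {y | y.1 ∈ P ∧ y.2 ∈ (S y.1).carrier}

/-- `Φ` is a smooth fibrewise local parametrization of the family `S` over `P`. -/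
structure IsFamilyChart {k : ℕ} (P : Set (EuclideanSpace ℝ (Fin k)))
    (S : EuclideanSpace ℝ (Fin k) → OrientedSurface)
    (W : Set (EuclideanSpace ℝ (Fin k) × (ℝ × ℝ)))
    (Φ : EuclideanSpace ℝ (Fin k) × (ℝ × ℝ) → E3) : Prop where
  isOpen : IsOpen W
  base : ∀ y ∈ W, y.1 ∈ P
  smooth : ContDiffOn ℝ ∞ Φ W
  fibre : ∀ t ∈ P, IsChart (S t).carrier (S t).normal {x | (t, x) ∈ W} fun x => Φ (t, x)
  relOpen : ∀ O : Set (EuclideanSpace ℝ (Fin k) × (ℝ × ℝ)), IsOpen O → O ⊆ W →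
    ∃ G : Set (EuclideanSpace ℝ (Fin k) × E3), IsOpen G ∧
      (fun y => (y.1, Φ y)) '' {y | y ∈ O ∧ y.2 ∈ quadrant} = totalSpace P S ∩ G

/-- A smooth family of compact oriented surfaces `S t`, `t ∈ P`: the total space is proper over `P`
and is covered by smooth fibrewise local parametrizations. -/
structure IsSmoothFamily {k : ℕ} (P : Set (EuclideanSpace ℝ (Fin k)))
    (S : EuclideanSpace ℝ (Fin k) → OrientedSurface) : Prop where
  proper : ∀ t₀ ∈ P, ∀ G : Set E3, IsOpen G → (S t₀).carrier ⊆ G →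
    ∀ᶠ t in 𝓝[P] t₀, (S t).carrier ⊆ G
  exists_chart : ∀ y ∈ totalSpace P S, ∃ W Φ, IsFamilyChart P S W Φ ∧
    ∃ x ∈ quadrant, (y.1, x) ∈ W ∧ Φ (y.1, x) = y.2

/-- The pairs `(t, r)` with `r` not on the surface `S t`. -/
def offSurface {k : ℕ} (P : Set (EuclideanSpace ℝ (Fin k)))
    (S : EuclideanSpace ℝ (Fin k) → OrientedSurface) : Set (EuclideanSpace ℝ (Fin k) × E3) :=
  {y | y.1 ∈ P ∧ y.2 ∉ (S y.1).carrier}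

/-- The triples `(t, h, r)` with `r` on neither of the two slid copies of the surface `S t`. -/
def offSheets {k : ℕ} (P : Set (EuclideanSpace ℝ (Fin k)))
    (S : EuclideanSpace ℝ (Fin k) → OrientedSurface) :
    Set (EuclideanSpace ℝ (Fin k) × ℝ × E3) :=
  {y | y.1 ∈ P ∧ ∀ p ∈ (S y.1).carrier,
    y.2.2 ≠ p + (y.2.1 / 2) • (S y.1).normal p ∧ y.2.2 ≠ p - (y.2.1 / 2) • (S y.1).normal p}

/-! ## The category of smooth manifolds -/

/-- A finite-dimensional smooth manifold without boundary, Hausdorff and second countable. -/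
structure Mfd : Type 1 where
  model : Type
  carrier : Type
  [group : NormedAddCommGroup model]
  [space : NormedSpace ℝ model]
  [finDim : FiniteDimensional ℝ model]
  [top : TopologicalSpace carrier]
  [charted : ChartedSpace model carrier]
  [manifold : IsManifold 𝓘(ℝ, model) ∞ carrier]
  [t2 : T2Space carrier]
  [secondCountable : SecondCountableTopology carrier]

namespace Mfd

attribute [instance] group space finDim top charted manifold t2 secondCountable

/-- Morphisms are the smooth maps. -/
noncomputable instance : Category Mfd where
  Hom M N := C^∞⟮𝓘(ℝ, M.model), M.carrier; 𝓘(ℝ, N.model), N.carrier⟯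
  id _ := ContMDiffMap.id
  comp f g := ContMDiffMap.comp g f

/-- The underlying function of a morphism. -/
def fn {M N : Mfd} (f : M ⟶ N) : M.carrier → N.carrier := f.1

/-- A finite-dimensional normed space as a manifold. -/
noncomputable def ofSpace (F : Type) [NormedAddCommGroup F] [NormedSpace ℝ F] [FiniteDimensional ℝ F] : Mfd :=
  haveI : SecondCountableTopology F :=
    haveI := FiniteDimensional.proper ℝ F
    inferInstance
  { model := F, carrier := F }

/-- An open subset of a manifold as a manifold. -/
noncomputable def ofOpens (N : Mfd) (U : Opens N.carrier) : Mfd where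
  model := N.model
  carrier := U

/-- The inclusion of an open submanifold. -/
noncomputable def incl (N : Mfd) (U : Opens N.carrier) : N.ofOpens U ⟶ N :=
  (⟨Subtype.val, contMDiff_subtype_val⟩ :
    C^∞⟮𝓘(ℝ, N.model), U; 𝓘(ℝ, N.model), N.carrier⟯)

/-- A smooth map between finite-dimensional normed spaces as a morphism. -/
noncomputable def ofContDiff {F G : Type} [NormedAddCommGroup F] [NormedSpace ℝ F] [FiniteDimensional ℝ F]
    [NormedAddCommGroup G] [NormedSpace ℝ G] [FiniteDimensional ℝ G] (f : F → G)
    (hf : ContDiff ℝ ∞ f) : ofSpace F ⟶ ofSpace G :=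
  (⟨f, hf.contMDiff⟩ : C^∞⟮𝓘(ℝ, F), F; 𝓘(ℝ, G), G⟯)

/-- The derivative of a morphism at a point. -/
noncomputable def tangentMap {M N : Mfd} (f : M ⟶ N) (x : M.carrier) : M.model →L[ℝ] N.model :=
  mfderiv 𝓘(ℝ, M.model) 𝓘(ℝ, N.model) (fn f) x

/-- Two maps with common target are transversal. -/
def Transversal {M M' N : Mfd} (f : M ⟶ N) (g : M' ⟶ N) : Prop :=
  ∀ x y, fn f x = fn g y → (tangentMap f x).range ⊔ (tangentMap g y).range = ⊤

end Mfd

/-! ## Well-adapted models -/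


theorem contDiff_mvPolynomial_eval {n : ℕ} (p : MvPolynomial (Fin n) ℝ) :
    ContDiff ℝ ∞ fun x : Fin n → ℝ => MvPolynomial.eval x p := by
  induction p using MvPolynomial.induction_on with
  | C a => simpa using contDiff_const
  | add p q hp hq => simpa using hp.add hq
  | mul_X p i hp => simpa using hp.mul (contDiff_apply ℝ ℝ i)

/-- The polynomial map `ℝⁿ → ℝ` given by `p`. -/
noncomputable def polyMap {n : ℕ} (p : MvPolynomial (Fin n) ℝ) :
    Mfd.ofSpace (Fin n → ℝ) ⟶ Mfd.ofSpace ℝ :=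
  Mfd.ofContDiff _ (contDiff_mvPolynomial_eval p)

theorem contDiff_combination {n m : ℕ} (e : Fin m → MvPolynomial (Fin n) ℝ) :
    ContDiff ℝ ∞ fun y : (Fin m → ℝ) × (Fin n → ℝ) =>
      ∑ j, y.1 j * MvPolynomial.eval y.2 (e j) := by
  refine ContDiff.sum fun j _ => ContDiff.mul ?_ ?_
  · exact (contDiff_apply ℝ ℝ j).comp contDiff_fst
  · exact (contDiff_mvPolynomial_eval (e j)).comp contDiff_snd

/-- The map `(a, x) ↦ ∑ⱼ aⱼ eⱼ(x)`. -/
noncomputable def combination {n m : ℕ} (e : Fin m → MvPolynomial (Fin n) ℝ) :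
    Mfd.ofSpace ((Fin m → ℝ) × (Fin n → ℝ)) ⟶ Mfd.ofSpace ℝ :=
  Mfd.ofContDiff _ (contDiff_combination e)

/-- First projection. -/
noncomputable def projFst (F G : Type) [NormedAddCommGroup F] [NormedSpace ℝ F]
    [FiniteDimensional ℝ F] [NormedAddCommGroup G] [NormedSpace ℝ G] [FiniteDimensional ℝ G] :
    Mfd.ofSpace (F × G) ⟶ Mfd.ofSpace F :=
  Mfd.ofContDiff Prod.fst contDiff_fst

/-- Second projection. -/
noncomputable def projSnd (F G : Type) [NormedAddCommGroup F] [NormedSpace ℝ F]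
    [FiniteDimensional ℝ F] [NormedAddCommGroup G] [NormedSpace ℝ G] [FiniteDimensional ℝ G] :
    Mfd.ofSpace (F × G) ⟶ Mfd.ofSpace G :=
  Mfd.ofContDiff Prod.snd contDiff_snd

/-- The constant map to `0`. -/
noncomputable def zeroMap (F : Type) [NormedAddCommGroup F] [NormedSpace ℝ F]
    [FiniteDimensional ℝ F] : Mfd.ofSpace F ⟶ Mfd.ofSpace ℝ :=
  Mfd.ofContDiff (fun _ => 0) contDiff_const

/-- The squaring map of the real line. -/
noncomputable def squareMap : Mfd.ofSpace ℝ ⟶ Mfd.ofSpace ℝ :=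
  Mfd.ofContDiff (fun x => x ^ 2) (contDiff_id.pow 2)

/-- Multiplication of vectors by scalars. -/
noncomputable def smulMap : Mfd.ofSpace (ℝ × E3) ⟶ Mfd.ofSpace E3 :=
  Mfd.ofContDiff (fun y => y.1 • y.2) (contDiff_fst.smul contDiff_snd)

section Elements

variable {C : Type w} [SmallCategory C] {J : GrothendieckTopology C}

/-- The elements of (the internalization of) the manifold `N` at stage `c`. -/
abbrev Elt (ι : Mfd ⥤ Sheaf J (Type w)) (N : Mfd) (c : C) : Type w :=
  (ι.obj N).obj.obj (op c)

/-- (The internalization of) a smooth map applied to an element at stage `c`. -/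
def appl (ι : Mfd ⥤ Sheaf J (Type w)) {N N' : Mfd} (f : N ⟶ N') {c : C} (x : Elt ι N c) :
    Elt ι N' c :=
  (ι.map f).hom.app (op c) x

/-- Change of stage. -/
def restr (ι : Mfd ⥤ Sheaf J (Type w)) {N : Mfd} {c d : C} (f : d ⟶ c) (x : Elt ι N c) :
    Elt ι N d :=
  (ι.obj N).obj.map f.op x

/-- The infinitesimal object cut out of `Rⁿ` by an ideal of polynomials, at stage `c`. -/
def WeilElt (ι : Mfd ⥤ Sheaf J (Type w)) {n : ℕ} (I : Ideal (MvPolynomial (Fin n) ℝ)) (c : C) :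
    Set (Elt ι (Mfd.ofSpace (Fin n → ℝ)) c) :=
  {x | ∀ p ∈ I, appl ι (polyMap p) x = appl ι (zeroMap (Fin n → ℝ)) x}

/-- The Kock-Lawvere axiom for the algebra `ℝ[x₁, …, xₙ] / I`, with respect to polynomials `e`
whose classes form a basis of it: every map `F`, given at stage `c`, from the infinitesimal object
of `I` to the line is `x ↦ ∑ⱼ aⱼ eⱼ(x)` for a unique coefficient vector `a`. -/
def KockLawvere (ι : Mfd ⥤ Sheaf J (Type w)) {n m : ℕ} (I : Ideal (MvPolynomial (Fin n) ℝ))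
    (e : Fin m → MvPolynomial (Fin n) ℝ) : Prop :=
  ∀ (c : C) (F : ∀ d : C, (d ⟶ c) → Elt ι (Mfd.ofSpace (Fin n → ℝ)) d → Elt ι (Mfd.ofSpace ℝ) d),
    (∀ (d d' : C) (f : d ⟶ c) (g : d' ⟶ d), ∀ x ∈ WeilElt ι I d,
      F d' (g ≫ f) (restr ι g x) = restr ι g (F d f x)) →
    ∃! a : Elt ι (Mfd.ofSpace (Fin m → ℝ)) c,
      ∀ (d : C) (f : d ⟶ c), ∀ x ∈ WeilElt ι I d,
      ∀ y : Elt ι (Mfd.ofSpace ((Fin m → ℝ) × (Fin n → ℝ))) d,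
        appl ι (projFst _ _) y = restr ι f a → appl ι (projSnd _ _) y = x →
        F d f x = appl ι (combination e) y

/-- The first-order infinitesimals `D = {d ∈ R | d² = 0}` at stage `c`. -/
def FirstOrder (ι : Mfd ⥤ Sheaf J (Type w)) (c : C) : Set (Elt ι (Mfd.ofSpace ℝ) c) :=
  {d | appl ι squareMap d = appl ι (zeroMap ℝ) d}

/-- `y = a • b` for elements `a` of `R` and `b`, `y` of `R³` at stage `c`. -/
def IsSmul (ι : Mfd ⥤ Sheaf J (Type w)) {c : C} (a : Elt ι (Mfd.ofSpace ℝ) c)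
    (b y : Elt ι (Mfd.ofSpace E3) c) : Prop :=
  ∃ z : Elt ι (Mfd.ofSpace (ℝ × E3)) c,
    appl ι (projFst _ _) z = a ∧ appl ι (projSnd _ _) z = b ∧ appl ι smulMap z = y

/-- The element `z` of an open part `U` of `Rᵏ × R × R³` is the triple `(t, h, r)`. -/
def HasCoords (ι : Mfd ⥤ Sheaf J (Type w)) {k : ℕ}
    (U : Opens (EuclideanSpace ℝ (Fin k) × ℝ × E3)) {c : C}
    (t : Elt ι (Mfd.ofSpace (EuclideanSpace ℝ (Fin k))) c) (h : Elt ι (Mfd.ofSpace ℝ) c)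
    (r : Elt ι (Mfd.ofSpace E3) c)
    (z : Elt ι ((Mfd.ofSpace (EuclideanSpace ℝ (Fin k) × ℝ × E3)).ofOpens U) c) : Prop :=
  appl ι (Mfd.incl _ U ≫ projFst _ _) z = t ∧
    appl ι (Mfd.incl _ U ≫ projSnd _ _ ≫ projFst _ _) z = h ∧
    appl ι (Mfd.incl _ U ≫ projSnd _ _ ≫ projSnd _ _) z = r

end Elements

/-- A well-adapted model of synthetic differential geometry: a Grothendieck topos (sheaves on a
small site) with a full and faithful functor `ι` from manifolds which preserves the terminal object,
transversal pullbacks and open coverings, and for which the line `ι ℝ` satisfies the Kock-Lawvere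
axiom for every Weil algebra (every `ℝ[x₁, …, xₙ] / I` with `I` proper and containing a power of
`(x₁, …, xₙ)`). -/
structure WellAdaptedModel {C : Type w} [SmallCategory C] (J : GrothendieckTopology C) where
  ι : Mfd ⥤ Sheaf J (Type w)
  full : ι.Full
  faithful : ι.Faithful
  terminal : ∀ N : Mfd, Nonempty (Limits.IsTerminal N) → Nonempty (Limits.IsTerminal (ι.obj N))
  transversal : ∀ {N₁ N₂ N₃ N₄ : Mfd} (a : N₁ ⟶ N₂) (b : N₁ ⟶ N₃) (f : N₂ ⟶ N₄) (g : N₃ ⟶ N₄),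
    Mfd.Transversal f g → IsPullback a b f g →
      IsPullback (ι.map a) (ι.map b) (ι.map f) (ι.map g)
  /-- `ι N` is the union of the subobjects `ι (U i)` for an open covering `U` of `N`: every element
  of `ι N` comes locally from one of them. -/
  covering : ∀ (N : Mfd) (κ : Type) (U : κ → Opens N.carrier), (∀ x, ∃ i, x ∈ U i) →
    ∀ (c : C) (x : Elt ι N c), ∃ R ∈ J c, ∀ (d : C) (f : d ⟶ c), R f →
      ∃ (i : κ) (y : Elt ι (N.ofOpens (U i)) d), appl ι (N.incl (U i)) y = restr ι f x
  kockLawvere : ∀ (n m : ℕ) (I : Ideal (MvPolynomial (Fin n) ℝ)) (l : ℕ), I ≠ ⊤ →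
    Ideal.span (Set.range MvPolynomial.X) ^ l ≤ I →
    ∀ e : Fin m → MvPolynomial (Fin n) ℝ,
      LinearIndependent ℝ (fun j => Ideal.Quotient.mk I (e j)) →
      Submodule.span ℝ (Set.range fun j => Ideal.Quotient.mk I (e j)) = ⊤ →
      KockLawvere ι I e

/-! ### The cross product -/

/-! Exchanging the two sheets reverses the sign of the thickness, so the dipole field is an odd
function of `h` (`dipoleField_eq`). It vanishes at `h = 0`, and differentiating under the integral
shows that its `h`-derivative there is the double layer field (`hasDerivAt_fieldPlus`,
`hasDerivAt_dipoleField`).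

The double layer field is the Biot-Savart field by Stokes' theorem. For a constant vector `e`, take
the vector field `p ↦ coulomb (r - p) × e`. The Coulomb field is divergence free with symmetric
derivative, so the flux density of the curl is the inner product of `e` with the dipole integrand
(`inner_curlVec_coulomb`). The tangential component along the boundary is the inner product of `e`
with the Biot-Savart integrand. As `e` is arbitrary, the two vector integrals agree
(`doubleLayerField_eq_biotSavart`).

Area and arc length are suprema over all charts. To compute with them, a single chart must already
give the whole measure on its image: transition maps have positive determinant, and change of
variables bounds every other chart's contribution (`paramMeasure_restrict_le`,
`restrict_eq_of_forall_le`). A chart image meets the boundary in its lower edge and its left edge,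
and a quarter turn reduces the second to the first. Stokes then follows from Green's theorem on the
quadrant and a partition of unity.

For smoothness in `(t, h, r)`, a partition of unity that works for all `t` near `t₀`
(`IsSmoothFamily.nonempty_partition`) writes the field as a finite sum of integrals over fixed
compact parameter sets, handled by `contDiffAt_integral_compact`. The Biot-Savart field is smooth
because it is an `h`-derivative of a smooth field. Hadamard's lemma, used twice, gives `E = h B + h²
R` with `R` smooth on the part of the domain that is star-shaped in `h`
(`exists_dipoleField_expansion`).

The model transports this identity of smooth maps to elements, where `h² = 0` removes the remainder
(`isSmul_of_expansion`). It remains to see that `(t, h, r)` lies in the domain of the expansion.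
That domain contains all points over `V` with `h = 0`, so together with `{h ≠ 0}` it covers. On the
second piece `h²` is both zero and nonvanishing, which forces an empty stage
(`inOpen_of_nilpotent`). -/

theorem cross_zero_coord (a b : E3) : cross a b 0 = a 1 * b 2 - a 2 * b 1 := by
  simp [cross, crossProduct]

theorem cross_one_coord (a b : E3) : cross a b 1 = a 2 * b 0 - a 0 * b 2 := by
  simp [cross, crossProduct]

theorem cross_two_coord (a b : E3) : cross a b 2 = a 0 * b 1 - a 1 * b 0 := by
  simp [cross, crossProduct]

theorem E3.ext_coord {a b : E3} (h0 : a 0 = b 0) (h1 : a 1 = b 1) (h2 : a 2 = b 2) : a = b := by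
  ext i
  fin_cases i <;> assumption

theorem E3.inner_eq (a b : E3) : inner ℝ a b = a 0 * b 0 + a 1 * b 1 + a 2 * b 2 := by
  simp [PiLp.inner_apply, Fin.sum_univ_three, mul_comm]

theorem cross_combination (a b : E3) (c d e f : ℝ) :
    cross (c • a + d • b) (e • a + f • b) = (c * f - d * e) • cross a b := by
  apply E3.ext_coord <;> simp [cross_zero_coord, cross_one_coord, cross_two_coord] <;> ring

theorem contDiff_cross : ContDiff ℝ ∞ fun y : E3 × E3 => cross y.1 y.2 := by
  rw [contDiff_piLp]
  have h (i : Fin 3) : ContDiff ℝ ∞ fun y : E3 × E3 => y.1 i :=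
    (contDiff_piLp_apply (p := 2) (i := i)).comp contDiff_fst
  have h' (i : Fin 3) : ContDiff ℝ ∞ fun y : E3 × E3 => y.2 i :=
    (contDiff_piLp_apply (p := 2) (i := i)).comp contDiff_snd
  intro i
  fin_cases i
  · simpa [cross_zero_coord] using ((h 1).mul (h' 2)).sub ((h 2).mul (h' 1))
  · simpa [cross_one_coord] using ((h 2).mul (h' 0)).sub ((h 0).mul (h' 2))
  · simpa [cross_two_coord] using ((h 0).mul (h' 1)).sub ((h 1).mul (h' 0))

theorem clm_prod_apply {F : Type*} [NormedAddCommGroup F] [NormedSpace ℝ F]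
    (L : ℝ × ℝ →L[ℝ] F) (a b : ℝ) : L (a, b) = a • L (1, 0) + b • L (0, 1) := by
  rw [← L.map_smul, ← L.map_smul, ← L.map_add]
  simp

/-! ### The quadrant -/

theorem isClosed_quadrant : IsClosed quadrant :=
  (isClosed_le continuous_const continuous_fst).inter (isClosed_le continuous_const continuous_snd)

theorem convex_quadrant : Convex ℝ quadrant := by
  rintro x ⟨hx, hx'⟩ y ⟨hy, hy'⟩ a b ha hb -
  constructor <;> simp <;> positivity

theorem quadrant_mem_nhds {x : ℝ × ℝ} (h1 : 0 < x.1) (h2 : 0 < x.2) : quadrant ∈ 𝓝 x := by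
  have : IsOpen {x : ℝ × ℝ | 0 < x.1 ∧ 0 < x.2} :=
    (isOpen_lt continuous_const continuous_fst).inter (isOpen_lt continuous_const continuous_snd)
  exact Filter.mem_of_superset (this.mem_nhds ⟨h1, h2⟩) fun y hy => ⟨hy.1.le, hy.2.le⟩

theorem uniqueDiffOn_quadrant : UniqueDiffOn ℝ quadrant := by
  refine uniqueDiffOn_convex convex_quadrant ⟨(1, 1), ?_⟩
  rw [mem_interior_iff_mem_nhds]
  exact quadrant_mem_nhds one_pos one_pos

/-! ### Charts: the normal, left inverses and transition maps. -/

namespace IsChart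

variable {S : Set E3} {n : E3 → E3} {W V : Set (ℝ × ℝ)} {φ ψ : ℝ × ℝ → E3}

theorem mono (h : IsChart S n W φ) (hV : IsOpen V) (hVW : V ⊆ W) : IsChart S n V φ where
  isOpen := hV
  smooth := h.smooth.mono hVW
  injOn := h.injOn.mono (Set.inter_subset_inter_left _ hVW)
  relOpen O hO hOV := h.relOpen O hO (hOV.trans hVW)
  immersion x hx := h.immersion x ⟨hVW hx.1, hx.2⟩
  oriented x hx := h.oriented x ⟨hVW hx.1, hx.2⟩

theorem contDiffAt (h : IsChart S n W φ) {x : ℝ × ℝ} (hx : x ∈ W) : ContDiffAt ℝ ∞ φ x :=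
  h.smooth.contDiffAt (h.isOpen.mem_nhds hx)

theorem hasFDerivAt (h : IsChart S n W φ) {x : ℝ × ℝ} (hx : x ∈ W) :
    HasFDerivAt φ (fderiv ℝ φ x) x :=
  ((h.contDiffAt hx).differentiableAt (by simp)).hasFDerivAt

theorem continuousOn (h : IsChart S n W φ) : ContinuousOn φ W := h.smooth.continuousOn

theorem mem_carrier (h : IsChart S n W φ) {x : ℝ × ℝ} (hx : x ∈ W ∩ quadrant) : φ x ∈ S := by
  obtain ⟨G, -, hG⟩ := h.relOpen W h.isOpen subset_rfl
  exact (hG ▸ Set.mem_image_of_mem φ hx : φ x ∈ S ∩ G).1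

theorem image_mem_nhdsWithin (h : IsChart S n W φ) {x : ℝ × ℝ} (hx : x ∈ W ∩ quadrant)
    {O : Set (ℝ × ℝ)} (hO : O ∈ 𝓝 x) : φ '' (O ∩ W ∩ quadrant) ∈ 𝓝[S] (φ x) := by
  obtain ⟨O', hO', hO'o, hxO'⟩ := mem_nhds_iff.1 (Filter.inter_mem hO (h.isOpen.mem_nhds hx.1))
  obtain ⟨G, hGo, hG⟩ := h.relOpen O' hO'o (hO'.trans Set.inter_subset_right)
  have hxG : φ x ∈ S ∩ G := hG ▸ Set.mem_image_of_mem φ ⟨hxO', hx.2⟩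
  refine Filter.mem_of_superset (Filter.inter_mem self_mem_nhdsWithin
    (mem_nhdsWithin_of_mem_nhds (hGo.mem_nhds hxG.2))) ?_
  rw [← hG]
  exact Set.image_mono (Set.inter_subset_inter_left _ hO')

/-- The chart axioms do not say outright that `n` has length one. Taking norms in `oriented` forces
it, since the cross product does not vanish. -/
theorem normal_eq (h : IsChart S n W φ) {x : ℝ × ℝ} (hx : x ∈ W ∩ quadrant) :
    n (φ x) = ‖cross (dFst φ x) (dSnd φ x)‖⁻¹ • cross (dFst φ x) (dSnd φ x) := by
  conv_rhs => rw [h.oriented x hx]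
  rw [norm_smul, norm_norm, smul_smul]
  have h0 : ‖cross (dFst φ x) (dSnd φ x)‖ ≠ 0 := norm_ne_zero_iff.2 (h.immersion x hx)
  have h1 : ‖n (φ x)‖ = 1 := by
    have := congrArg norm (h.oriented x hx)
    rw [norm_smul, norm_norm] at this
    exact mul_left_cancel₀ h0 (by rw [← this, mul_one])
  rw [h1, mul_one, inv_mul_cancel₀ h0, one_smul]

theorem norm_normal (h : IsChart S n W φ) {x : ℝ × ℝ} (hx : x ∈ W ∩ quadrant) :
    ‖n (φ x)‖ = 1 := by
  rw [h.normal_eq hx, norm_smul, norm_inv, norm_norm]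
  exact inv_mul_cancel₀ (norm_ne_zero_iff.2 (h.immersion x hx))

/-- A chart has a left inverse which is differentiable in the ambient space. -/
theorem exists_leftInverse (h : IsChart S n W φ) {x₀ : ℝ × ℝ} (hx₀ : x₀ ∈ W ∩ quadrant) :
    ∃ g : E3 → ℝ × ℝ, DifferentiableAt ℝ g (φ x₀) ∧
      ∀ᶠ q in 𝓝[S] (φ x₀), g q ∈ W ∩ quadrant ∧ φ (g q) = q := by
  set A := fderiv ℝ φ x₀ with hA
  -- If `(a, b)` is in the kernel, crossing `a ∂₁φ + b ∂₂φ = 0` with each partial derivative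
  -- isolates one coefficient times the nonzero vector `∂₁φ × ∂₂φ`.
  have hinj : LinearMap.ker (A : ℝ × ℝ →ₗ[ℝ] E3) = ⊥ := by
    rw [LinearMap.ker_eq_bot']
    rintro ⟨a, b⟩ hab
    have hab : a • dFst φ x₀ + b • dSnd φ x₀ = 0 := by
      rw [dFst, dSnd, ← clm_prod_apply]; exact hab
    have h1 := cross_combination (dFst φ x₀) (dSnd φ x₀) a b 0 1
    have h2 := cross_combination (dFst φ x₀) (dSnd φ x₀) 1 0 a b
    have h3 (y : E3) : cross 0 y = 0 := by
      apply E3.ext_coord <;> simp [cross_zero_coord, cross_one_coord, cross_two_coord]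
    have h4 (y : E3) : cross y 0 = 0 := by
      apply E3.ext_coord <;> simp [cross_zero_coord, cross_one_coord, cross_two_coord]
    rw [hab, h3] at h1
    rw [hab, h4] at h2
    have := h.immersion x₀ hx₀
    have h1 := (smul_eq_zero.1 h1.symm).resolve_right this
    have h2 := (smul_eq_zero.1 h2.symm).resolve_right this
    ext <;> simp <;> linarith
  obtain ⟨l, hl⟩ := LinearMap.exists_leftInverse_of_injective (A : ℝ × ℝ →ₗ[ℝ] E3) hinj
  set l' : E3 →L[ℝ] ℝ × ℝ := LinearMap.toContinuousLinearMap l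
  have hl' : l'.comp A = ((ContinuousLinearEquiv.refl ℝ (ℝ × ℝ) : (ℝ × ℝ) ≃L[ℝ] ℝ × ℝ) :
      ℝ × ℝ →L[ℝ] ℝ × ℝ) := by
    exact ContinuousLinearMap.ext fun y => LinearMap.congr_fun hl y
  -- Composed with a linear left inverse of its derivative, `φ` becomes a map of the plane with
  -- identity derivative, so the inverse function theorem applies.
  have hstrict : HasStrictFDerivAt (fun x => l' (φ x))
      ((ContinuousLinearEquiv.refl ℝ (ℝ × ℝ) : (ℝ × ℝ) ≃L[ℝ] ℝ × ℝ) : ℝ × ℝ →L[ℝ] ℝ × ℝ) x₀ := by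
    rw [← hl']
    exact l'.hasStrictFDerivAt.comp x₀ ((h.contDiffAt hx₀.1).hasStrictFDerivAt (by simp))
  have hleft := hstrict.eventually_left_inverse
  refine ⟨fun q => hstrict.localInverse _ _ _ (l' q),
    (hstrict.to_localInverse.hasFDerivAt.differentiableAt).comp _ l'.differentiableAt, ?_⟩
  filter_upwards [h.image_mem_nhdsWithin hx₀ hleft]
  rintro _ ⟨x, ⟨⟨hx1, hx2⟩, hx3⟩, rfl⟩
  have hx1 : hstrict.localInverse _ _ _ (l' (φ x)) = x := hx1
  rw [hx1]
  exact ⟨⟨hx2, hx3⟩, rfl⟩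

/-- The coordinates of a point of the surface with respect to a chart. -/
noncomputable def coord (W : Set (ℝ × ℝ)) (φ : ℝ × ℝ → E3) : E3 → ℝ × ℝ :=
  Function.invFunOn φ (W ∩ quadrant)

theorem coord_apply (h : IsChart S n W φ) {x : ℝ × ℝ} (hx : x ∈ W ∩ quadrant) :
    coord W φ (φ x) = x :=
  h.injOn.leftInvOn_invFunOn hx

/-- The transition map between two charts is differentiable, and its determinant is positive. -/
theorem exists_transition (hφ : IsChart S n W φ) (hψ : IsChart S n V ψ) {x y : ℝ × ℝ}
    (hx : x ∈ W ∩ quadrant) (hy : y ∈ V ∩ quadrant) (hxy : ψ y = φ x) :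
    ∃ L : ℝ × ℝ →L[ℝ] ℝ × ℝ, HasFDerivWithinAt (fun z => coord W φ (ψ z)) L quadrant y ∧
      (fderiv ℝ φ x).comp L = fderiv ℝ ψ y ∧
      (∀ᶠ z in 𝓝[quadrant] y, coord W φ (ψ z) ∈ W ∩ quadrant ∧ φ (coord W φ (ψ z)) = ψ z) ∧
      0 < (L (1, 0)).1 * (L (0, 1)).2 - (L (1, 0)).2 * (L (0, 1)).1 ∧
      ‖cross (dFst ψ y) (dSnd ψ y)‖ = ((L (1, 0)).1 * (L (0, 1)).2 - (L (1, 0)).2 * (L (0, 1)).1) *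
        ‖cross (dFst φ x) (dSnd φ x)‖ := by
  obtain ⟨g, hg, hgS⟩ := hφ.exists_leftInverse hx
  have htend : Filter.Tendsto ψ (𝓝[quadrant] y) (𝓝[S] (φ x)) := by
    rw [← hxy]
    refine tendsto_nhdsWithin_iff.2 ⟨((hψ.contDiffAt hy.1).continuousAt.tendsto).mono_left
      nhdsWithin_le_nhds, ?_⟩
    filter_upwards [self_mem_nhdsWithin, mem_nhdsWithin_of_mem_nhds (hψ.isOpen.mem_nhds hy.1)]
      with z hz hz'
    exact hψ.mem_carrier ⟨hz', hz⟩
  have hev := htend.eventually hgS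
  -- `coord` is a choice function without evident regularity; near `y` in the quadrant it agrees
  -- with the differentiable map `g ∘ ψ`.
  have hcoord : ∀ᶠ z in 𝓝[quadrant] y, coord W φ (ψ z) = g (ψ z) := by
    filter_upwards [hev] with z hz
    conv_lhs => rw [← hz.2]
    exact hφ.coord_apply hz.1
  have hcy : coord W φ (ψ y) = x := by rw [hxy, hφ.coord_apply hx]
  have hD : HasFDerivWithinAt (fun z => coord W φ (ψ z))
      ((fderiv ℝ g (φ x)).comp (fderiv ℝ ψ y)) quadrant y := by
    refine HasFDerivWithinAt.congr_of_eventuallyEq (f := fun z => g (ψ z)) ?_ hcoord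
      (hcoord.self_of_nhdsWithin hy.2)
    rw [← hxy] at hg ⊢
    exact (hg.hasFDerivAt.comp y (hψ.hasFDerivAt hy.1)).hasFDerivWithinAt
  set L := (fderiv ℝ g (φ x)).comp (fderiv ℝ ψ y)
  have hmem : ∀ᶠ z in 𝓝[quadrant] y,
      coord W φ (ψ z) ∈ W ∩ quadrant ∧ φ (coord W φ (ψ z)) = ψ z := by
    filter_upwards [hcoord, hev] with z h1 h2
    rw [h1]; exact h2
  -- The identity `φ ∘ coord ∘ ψ = ψ` is only known within the quadrant, which still determines
  -- derivatives because it is a set of unique differentiability.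
  have hcomp : (fderiv ℝ φ x).comp L = fderiv ℝ ψ y := by
    refine (uniqueDiffOn_quadrant y hy.2).eq (f := ψ) ?_ (hψ.hasFDerivAt hy.1).hasFDerivWithinAt
    have h1 : HasFDerivAt φ (fderiv ℝ φ x) (coord W φ (ψ y)) := by
      rw [hcy]; exact hφ.hasFDerivAt hx.1
    refine (h1.comp_hasFDerivWithinAt y hD).congr_of_eventuallyEq ?_ ?_
    · filter_upwards [hmem] with z hz using hz.2.symm
    · change ψ y = φ (coord W φ (ψ y))
      rw [hcy, hxy]
  have hcross : cross (dFst ψ y) (dSnd ψ y) =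
      ((L (1, 0)).1 * (L (0, 1)).2 - (L (1, 0)).2 * (L (0, 1)).1) •
        cross (dFst φ x) (dSnd φ x) := by
    rw [dFst, dSnd, ← hcomp, ← cross_combination, dFst, dSnd, ← clm_prod_apply, ← clm_prod_apply]
    rfl
  -- Both cross products are positive multiples of the same normal vector, so the factor relating
  -- them is positive.
  have hpos : 0 < (L (1, 0)).1 * (L (0, 1)).2 - (L (1, 0)).2 * (L (0, 1)).1 := by
    have h1 := hcross
    rw [hψ.oriented y hy, hφ.oriented x hx, hxy, smul_smul] at h1
    have h2 : n (φ x) ≠ 0 := norm_ne_zero_iff.1 (by rw [hφ.norm_normal hx]; exact one_ne_zero)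
    have h3 := smul_left_injective ℝ h2 h1
    have h4 : 0 < ‖cross (dFst ψ y) (dSnd ψ y)‖ := norm_pos_iff.2 (hψ.immersion y hy)
    rw [h3] at h4
    exact pos_of_mul_pos_left h4 (norm_nonneg _)
  refine ⟨L, hD, hcomp, hmem, hpos, ?_⟩
  rw [hcross, norm_smul, Real.norm_of_nonneg hpos.le]

end IsChart

/-! ### Measures given by a parametrization and a density -/

/-- The image under `g`, restricted to `s`, of the measure with density `d`. -/
noncomputable def paramMeasure {X : Type*} [MeasureSpace X] (s : Set X) (g : X → E3) (d : X → ℝ) :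
    Measure E3 :=
  Measure.map g ((volume.restrict s).withDensity fun x => ENNReal.ofReal (d x))

section ParamMeasure

set_option linter.unusedSectionVars false

variable {X : Type*} [TopologicalSpace X] [PolishSpace X] [MeasureSpace X] [BorelSpace X]
  {s : Set X} {g : X → E3} {d : X → ℝ}

/-- `g` is controlled only on `s`. Passing to the subtype makes it an honest measurable map, and a
measurable embedding when it is injective on `s`, so integrals can be transported for arbitrary
integrands. -/
theorem map_restrict_eq_map_comap (hs : MeasurableSet s) (hg : ContinuousOn g s)
    {m : Measure X} (hm : m sᶜ = 0) :
    Measure.map g m = Measure.map (s.domRestrict g) (m.comap Subtype.val) := by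
  have hg' : Measurable fun x : s => g x := hg.domRestrict.measurable
  have h1 : m.restrict s = m := Measure.restrict_eq_self_of_ae_mem hm
  conv_lhs => rw [← h1]
  rw [← map_comap_subtype_coe hs, AEMeasurable.map_map_of_aemeasurable _
    measurable_subtype_coe.aemeasurable]
  · rfl
  · rw [map_comap_subtype_coe hs]
    exact hg.aemeasurable hs

theorem withDensity_compl_eq_zero (hs : MeasurableSet s) (f : X → ENNReal) :
    ((volume.restrict s).withDensity f) sᶜ = 0 := by
  apply withDensity_absolutelyContinuous
  rw [Measure.restrict_apply hs.compl]
  simp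

theorem paramMeasure_apply (hs : MeasurableSet s) (hg : ContinuousOn g s) {B : Set E3}
    (hB : MeasurableSet B) :
    paramMeasure s g d B =
      ∫⁻ x in s, B.indicator (fun _ => ENNReal.ofReal (d x)) (g x) := by
  have hgm : AEMeasurable g (volume.restrict s) := hg.aemeasurable hs
  have hgm' : AEMeasurable g ((volume.restrict s).withDensity fun x => ENNReal.ofReal (d x)) :=
    hgm.mono_ac (withDensity_absolutelyContinuous _ _)
  obtain ⟨g', hg', hgg'⟩ := hgm
  rw [paramMeasure, Measure.map_congr ((withDensity_absolutelyContinuous _ _).ae_le hgg'),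
    Measure.map_apply hg' hB, withDensity_apply _ (hg' hB),
    ← lintegral_indicator (hg' hB)]
  refine lintegral_congr_ae ?_
  filter_upwards [hgg'] with x hx
  by_cases h : g x ∈ B
  · rw [Set.indicator_of_mem h, Set.indicator_of_mem]
    rw [hx] at h; exact h
  · rw [Set.indicator_of_notMem h, Set.indicator_of_notMem]
    rw [hx] at h; exact h

theorem paramMeasure_congr_set {s' : Set X} (h : s =ᵐ[volume] s') :
    paramMeasure s g d = paramMeasure s' g d := by
  rw [paramMeasure, paramMeasure, Measure.restrict_congr_set h]

theorem measurableSet_image_param (hs : MeasurableSet s) (hg : ContinuousOn g s)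
    (hi : Set.InjOn g s) : MeasurableSet (g '' s) :=
  hs.image_of_continuousOn_injOn hg hi

theorem paramMeasure_compl_image (hs : MeasurableSet s) (hg : ContinuousOn g s)
    (hi : Set.InjOn g s) : paramMeasure s g d (g '' s)ᶜ = 0 := by
  rw [paramMeasure_apply hs hg (measurableSet_image_param hs hg hi).compl]
  rw [setLIntegral_congr_fun (g := fun _ => 0) hs]
  · simp
  · intro x hx
    simp [Set.mem_image_of_mem g hx]

theorem withDensity_restrict_eq (hd : ContinuousOn d s) (hs : MeasurableSet s) :
    AEMeasurable (fun x => ENNReal.ofReal (d x)) (volume.restrict s) :=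
  ENNReal.measurable_ofReal.comp_aemeasurable (hd.aemeasurable hs)

theorem integral_paramMeasure {F : Type*} [NormedAddCommGroup F] [NormedSpace ℝ F]
    (hs : MeasurableSet s) (hg : ContinuousOn g s) (hi : Set.InjOn g s) (hd : ContinuousOn d s)
    (hd0 : ∀ x ∈ s, 0 ≤ d x) (f : E3 → F) :
    ∫ p, f p ∂paramMeasure s g d = ∫ x in s, d x • f (g x) := by
  have hz := withDensity_compl_eq_zero hs fun x => ENNReal.ofReal (d x)
  rw [paramMeasure, map_restrict_eq_map_comap hs hg hz,
    (hg.measurableEmbedding hs hi).integral_map (μ := Measure.comap Subtype.val _) f]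
  simp only [Set.domRestrict_apply]
  rw [← (MeasurableEmbedding.subtype_coe hs).integral_map (fun x => f (g x)),
    map_comap_subtype_coe hs, Measure.restrict_eq_self_of_ae_mem hz,
    integral_withDensity_eq_integral_toReal_smul₀ (withDensity_restrict_eq hd hs)
      (Filter.Eventually.of_forall fun _ => ENNReal.ofReal_lt_top)]
  refine setIntegral_congr_fun hs fun x hx => ?_
  simp [ENNReal.toReal_ofReal (hd0 x hx)]

theorem integrable_paramMeasure {F : Type*} [NormedAddCommGroup F] [NormedSpace ℝ F]
    (hs : MeasurableSet s) (hg : ContinuousOn g s) (hi : Set.InjOn g s) (hd : ContinuousOn d s)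
    (hd0 : ∀ x ∈ s, 0 ≤ d x) (f : E3 → F) :
    Integrable f (paramMeasure s g d) ↔ IntegrableOn (fun x => d x • f (g x)) s := by
  have hz := withDensity_compl_eq_zero hs fun x => ENNReal.ofReal (d x)
  rw [paramMeasure, map_restrict_eq_map_comap hs hg hz,
    (hg.measurableEmbedding hs hi).integrable_map_iff (μ := Measure.comap Subtype.val _)]
  have h1 : f ∘ s.domRestrict g = (fun x => f (g x)) ∘ (Subtype.val : s → X) := rfl
  rw [h1, ← (MeasurableEmbedding.subtype_coe hs).integrable_map_iff,
    map_comap_subtype_coe hs, Measure.restrict_eq_self_of_ae_mem hz,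
    integrable_withDensity_iff_integrable_smul₀' (withDensity_restrict_eq hd hs)
      (Filter.Eventually.of_forall fun _ => ENNReal.ofReal_lt_top)]
  refine integrable_congr ?_
  filter_upwards [ae_restrict_mem hs] with x hx
  simp [ENNReal.toReal_ofReal (hd0 x hx)]

end ParamMeasure

/-- Change of variables: a parametrization which factors through another one gives a smaller
measure. -/
theorem paramMeasure_restrict_le {X : Type*} [NormedAddCommGroup X] [NormedSpace ℝ X]
    [FiniteDimensional ℝ X] [MeasureSpace X] [BorelSpace X]
    [(volume : Measure X).IsAddHaarMeasure]
    {s₁ s₂ : Set X} {g₁ g₂ : X → E3} {d₁ d₂ : X → ℝ}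
    (hs₁ : MeasurableSet s₁) (hs₂ : MeasurableSet s₂) (hg₁ : ContinuousOn g₁ s₁)
    (hg₂ : ContinuousOn g₂ s₂) (hi₁ : Set.InjOn g₁ s₁)
    {A : Set E3} (hA : MeasurableSet A)
    (T : X → X) (hT : ∀ x ∈ s₁, g₁ x ∈ A → T x ∈ s₂ ∧ g₂ (T x) = g₁ x ∧
      ∃ L : X →L[ℝ] X, HasFDerivWithinAt T L s₁ x ∧ d₁ x = |L.det| * d₂ (T x)) :
    (paramMeasure s₁ g₁ d₁).restrict A ≤ paramMeasure s₂ g₂ d₂ := by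
  have : ProperSpace X := FiniteDimensional.proper ℝ X
  set s : Set X := s₁ ∩ g₁ ⁻¹' A with hs
  have hsm : MeasurableSet s := by
    have := hg₁.domRestrict.measurable hA
    have := (MeasurableEmbedding.subtype_coe hs₁).measurableSet_image.2 this
    convert this using 1
    ext x
    simp [hs, and_comm]
  choose! hT1 hT2 L hL hd using hT
  have hinj : Set.InjOn T s := fun x hx y hy hxy =>
    hi₁ hx.1 hy.1 (by rw [← hT2 x hx.1 hx.2, hxy, hT2 y hy.1 hy.2])
  refine Measure.le_iff.2 fun B hB => ?_
  rw [Measure.restrict_apply hB, paramMeasure_apply hs₁ hg₁ (hB.inter hA),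
    paramMeasure_apply hs₂ hg₂ hB]
  calc
    _ = ∫⁻ x in s, B.indicator (fun _ => ENNReal.ofReal (d₁ x)) (g₁ x) := by
      rw [← lintegral_indicator hs₁, ← lintegral_indicator hsm]
      refine lintegral_congr fun x => ?_
      by_cases h1 : x ∈ s₁ <;> by_cases h2 : g₁ x ∈ A <;> by_cases h3 : g₁ x ∈ B <;>
        simp [hs, Set.indicator, h1, h2, h3]
    _ = ∫⁻ x in s, ENNReal.ofReal |(L x).det| *
        B.indicator (fun _ => ENNReal.ofReal (d₂ (T x))) (g₂ (T x)) := by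
      refine setLIntegral_congr_fun hsm fun x hx => ?_
      rw [hT2 x hx.1 hx.2, hd x hx.1 hx.2, ENNReal.ofReal_mul (abs_nonneg _)]
      by_cases h : g₁ x ∈ B <;> simp [h]
    _ = ∫⁻ x in T '' s, B.indicator (fun _ => ENNReal.ofReal (d₂ x)) (g₂ x) :=
      (lintegral_image_eq_lintegral_abs_det_fderiv_mul volume hsm
        (fun x hx => (hL x hx.1 hx.2).mono Set.inter_subset_left) hinj
        fun x => B.indicator (fun _ => ENNReal.ofReal (d₂ x)) (g₂ x)).symm
    _ ≤ _ := lintegral_mono_set (by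
        rintro _ ⟨x, hx, rfl⟩
        exact hT1 x hx.1 hx.2)

/-- A measure in a family is the restriction of the supremum of the family if it dominates the
restrictions of all members. -/
theorem restrict_eq_of_forall_le {α : Type*} [MeasurableSpace α] {ν μ : Measure α} {A : Set α}
    (hA : MeasurableSet A) (hμA : μ Aᶜ = 0) (hμ : μ ≤ ν)
    (hν : ∀ ν' : Measure α, μ + ν.restrict Aᶜ ≤ ν' → ν ≤ ν') : ν.restrict A = μ := by
  apply le_antisymm
  · calc
      ν.restrict A ≤ (μ + ν.restrict Aᶜ).restrict A := Measure.restrict_mono_measure (hν _ le_rfl) A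
      _ = μ.restrict A := by
        rw [Measure.restrict_add, Measure.restrict_restrict hA]
        simp
      _ ≤ μ := Measure.restrict_le_self
  · calc
      μ = μ.restrict A := (Measure.restrict_eq_self_of_ae_mem hμA).symm
      _ ≤ ν.restrict A := Measure.restrict_mono_measure hμ A

theorem clm_prod_det (L : ℝ × ℝ →L[ℝ] ℝ × ℝ) :
    L.det = (L (1, 0)).1 * (L (0, 1)).2 - (L (1, 0)).2 * (L (0, 1)).1 := by
  rw [ContinuousLinearMap.det, ← LinearMap.det_toMatrix (Module.Basis.finTwoProd ℝ),
    Matrix.det_fin_two]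
  simp [LinearMap.toMatrix_apply]
  ring

/-! ### Rotation of a chart -/

/-- The rotated parametrization, in which the left edge becomes a lower edge. -/
def rotParam (c : ℝ) (φ : ℝ × ℝ → E3) : ℝ × ℝ → E3 := fun x => φ (x.2, c - x.1)

/-- The domain of the rotated parametrization. -/
def rotDomain (c : ℝ) (W : Set (ℝ × ℝ)) : Set (ℝ × ℝ) :=
  {x | (x.2, c - x.1) ∈ W ∧ 0 < x.1 ∧ x.1 < c}

/-- The lower edge of a chart, without the corner. -/
def edgeSet (W : Set (ℝ × ℝ)) : Set ℝ := {u | 0 < u ∧ (u, (0 : ℝ)) ∈ W}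

/-- Arc length along the lower edge of a chart. -/
noncomputable def edgeMeasure (W : Set (ℝ × ℝ)) (φ : ℝ × ℝ → E3) : Measure E3 :=
  paramMeasure (edgeSet W) (fun u => φ (u, 0)) fun u => ‖dFst φ (u, 0)‖

/-- Area on the image of a chart. -/
noncomputable def chartMeasure (W : Set (ℝ × ℝ)) (φ : ℝ × ℝ → E3) : Measure E3 :=
  paramMeasure (W ∩ quadrant) φ fun x => ‖cross (dFst φ x) (dSnd φ x)‖

namespace IsChart

variable {S : Set E3} {n : E3 → E3} {W V : Set (ℝ × ℝ)} {φ ψ : ℝ × ℝ → E3}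

theorem continuousOn_dFst (h : IsChart S n W φ) : ContinuousOn (dFst φ) W :=
  ((h.smooth.continuousOn_fderiv_of_isOpen h.isOpen (by simp))).clm_apply continuousOn_const

theorem continuousOn_dSnd (h : IsChart S n W φ) : ContinuousOn (dSnd φ) W :=
  ((h.smooth.continuousOn_fderiv_of_isOpen h.isOpen (by simp))).clm_apply continuousOn_const

theorem continuousOn_cross (h : IsChart S n W φ) :
    ContinuousOn (fun x => cross (dFst φ x) (dSnd φ x)) W :=
  contDiff_cross.continuous.comp_continuousOn (h.continuousOn_dFst.prodMk h.continuousOn_dSnd)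

theorem measurableSet_domain (h : IsChart S n W φ) : MeasurableSet (W ∩ quadrant) :=
  h.isOpen.measurableSet.inter isClosed_quadrant.measurableSet

theorem measurableSet_image (h : IsChart S n W φ) : MeasurableSet (φ '' (W ∩ quadrant)) :=
  measurableSet_image_param h.measurableSet_domain (h.continuousOn.mono Set.inter_subset_left)
    h.injOn

theorem hasFDerivAt_rotParam (h : IsChart S n W φ) {c : ℝ} {x : ℝ × ℝ}
    (hx : (x.2, c - x.1) ∈ W) :
    HasFDerivAt (rotParam c φ) ((fderiv ℝ φ (x.2, c - x.1)).comp
      ((ContinuousLinearMap.snd ℝ ℝ ℝ).prod (-ContinuousLinearMap.fst ℝ ℝ ℝ))) x := by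
  have h1 : HasFDerivAt (fun x : ℝ × ℝ => (x.2, c - x.1))
      ((ContinuousLinearMap.snd ℝ ℝ ℝ).prod (-ContinuousLinearMap.fst ℝ ℝ ℝ)) x :=
    hasFDerivAt_snd.prodMk (hasFDerivAt_fst.const_sub c)
  exact HasFDerivAt.comp x (g := φ) (h.hasFDerivAt hx) h1

theorem dFst_rotParam (h : IsChart S n W φ) {c : ℝ} {x : ℝ × ℝ}
    (hx : (x.2, c - x.1) ∈ W) : dFst (rotParam c φ) x = -dSnd φ (x.2, c - x.1) := by
  rw [dFst, (h.hasFDerivAt_rotParam hx).fderiv, dSnd, ← map_neg]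
  simp

theorem dSnd_rotParam (h : IsChart S n W φ) {c : ℝ} {x : ℝ × ℝ}
    (hx : (x.2, c - x.1) ∈ W) : dSnd (rotParam c φ) x = dFst φ (x.2, c - x.1) := by
  rw [dSnd, (h.hasFDerivAt_rotParam hx).fderiv, dFst]
  simp

theorem cross_rotParam (h : IsChart S n W φ) {c : ℝ} {x : ℝ × ℝ} (hx : (x.2, c - x.1) ∈ W) :
    cross (dFst (rotParam c φ) x) (dSnd (rotParam c φ) x) =
      cross (dFst φ (x.2, c - x.1)) (dSnd φ (x.2, c - x.1)) := by
  rw [h.dFst_rotParam hx, h.dSnd_rotParam hx]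
  apply E3.ext_coord <;> simp [cross_zero_coord, cross_one_coord, cross_two_coord] <;> ring

/-- The substitution is a quarter turn of determinant one, so the cross product of the partial
derivatives, and with it the orientation, is unchanged. The bound `x.1 < c` keeps the old second
coordinate positive, and `0 < x.1` brings points of the old quadrant back into the new one. -/
theorem rot (h : IsChart S n W φ) (c : ℝ) :
    IsChart S n (rotDomain c W) (rotParam c φ) := by
  have hc : Continuous fun x : ℝ × ℝ => (x.2, c - x.1) := by fun_prop
  have hc' : Continuous fun y : ℝ × ℝ => (c - y.2, y.1) := by fun_prop
  have hq (x : ℝ × ℝ) (hx : x ∈ rotDomain c W ∩ quadrant) : (x.2, c - x.1) ∈ W ∩ quadrant :=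
    ⟨hx.1.1, hx.2.2, sub_nonneg.2 hx.1.2.2.le⟩
  refine ⟨?_, ?_, ?_, ?_, ?_, ?_⟩
  · exact (h.isOpen.preimage hc).inter ((isOpen_lt continuous_const continuous_fst).inter
      (isOpen_lt continuous_fst continuous_const))
  · refine h.smooth.comp (f := fun x : ℝ × ℝ => (x.2, c - x.1)) ?_ fun x hx => hx.1
    exact (contDiff_snd.prodMk (contDiff_const.sub contDiff_fst)).contDiffOn
  · intro x hx y hy hxy
    have := h.injOn (hq x hx) (hq y hy) hxy
    simp only [Prod.mk.injEq, sub_right_inj] at this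
    exact Prod.ext this.2 this.1
  · intro O hO hOW
    obtain ⟨G, hG, hGS⟩ := h.relOpen ((fun y : ℝ × ℝ => (c - y.2, y.1)) ⁻¹' O) (hO.preimage hc')
      fun y hy => by simpa using (hOW hy).1
    refine ⟨G, hG, ?_⟩
    rw [← hGS]
    ext p
    constructor
    · rintro ⟨x, hx, rfl⟩
      exact ⟨(x.2, c - x.1), ⟨by simpa using hx.1, (hq x ⟨hOW hx.1, hx.2⟩).2⟩, rfl⟩
    · rintro ⟨y, hy, rfl⟩
      refine ⟨(c - y.2, y.1), ⟨hy.1, ?_⟩, by simp [rotParam]⟩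
      exact ⟨(hOW hy.1).2.1.le, hy.2.1⟩
  · intro x hx
    rw [h.cross_rotParam hx.1.1]
    exact h.immersion _ (hq x hx)
  · intro x hx
    rw [h.cross_rotParam hx.1.1]
    exact h.oriented _ (hq x hx)

/-! ### Area -/

/-- The Jacobian determinant of the transition map is exactly the ratio of the two area densities,
and it is positive. -/
theorem chartMeasure_restrict_le (hφ : IsChart S n W φ) (hψ : IsChart S n V ψ) :
    (chartMeasure V ψ).restrict (φ '' (W ∩ quadrant)) ≤ chartMeasure W φ := by
  refine paramMeasure_restrict_le hψ.measurableSet_domain hφ.measurableSet_domain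
    (hψ.continuousOn.mono Set.inter_subset_left) (hφ.continuousOn.mono Set.inter_subset_left)
    hψ.injOn hφ.measurableSet_image (fun z => coord W φ (ψ z)) ?_
  rintro y hy ⟨x, hx, hxy⟩
  obtain ⟨L, hL, -, -, hpos, hnorm⟩ := hφ.exists_transition hψ hx hy hxy.symm
  have hcx : coord W φ (ψ y) = x := by rw [← hxy, hφ.coord_apply hx]
  rw [hcx]
  refine ⟨hx, hxy, L, hL.mono Set.inter_subset_right, ?_⟩
  rw [clm_prod_det, abs_of_pos hpos, hnorm]

/-! ### Edges -/

theorem edge_mem {u : ℝ} (hu : u ∈ edgeSet V) : (u, (0 : ℝ)) ∈ V ∩ quadrant :=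
  ⟨hu.2, hu.1.le, le_rfl⟩

/-- First-order condition at a constrained minimum: the quadrant is convex, so `d` is an admissible
direction. It is applied to coordinates of transition maps, which are minimal where they vanish. -/
theorem nonneg_of_isLocalMinOn_quadrant {f : ℝ × ℝ → ℝ} {f' : ℝ × ℝ →L[ℝ] ℝ} {y d : ℝ × ℝ}
    (hf : IsLocalMinOn f quadrant y) (hf' : HasFDerivWithinAt f f' quadrant y)
    (hy : y ∈ quadrant) (hyd : y + d ∈ quadrant) : 0 ≤ f' d :=
  hf.hasFDerivWithinAt_nonneg hf' (mem_posTangentConeAt_of_segment_subset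
    (convex_quadrant.segment_subset hy hyd))

/-- The lower edge of a chart can only meet the edges of another chart, away from the corner. -/
theorem edge_point (hφ : IsChart S n W φ) (hψ : IsChart S n V ψ) {u : ℝ} (hu : u ∈ edgeSet V)
    {x : ℝ × ℝ} (hx : x ∈ W ∩ quadrant) (h : ψ (u, 0) = φ x) :
    (x.1 = 0 ∧ 0 < x.2) ∨ (0 < x.1 ∧ x.2 = 0) := by
  have hy := edge_mem hu
  rcases hx.2.1.eq_or_lt with h1 | h1 <;> rcases hx.2.2.eq_or_lt with h2 | h2
  -- `x` is the corner of `φ`, so both transition coordinates are minimal at `(u, 0)`. Since `u >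
  -- 0`, both directions along the edge are admissible; hence `L (1, 0) = 0`, against the positive
  -- determinant.
  · exfalso
    obtain ⟨L, hL, -, hmem, hpos, -⟩ := hφ.exists_transition hψ hx hy h
    have hcx : coord W φ (ψ (u, 0)) = x := by rw [h, hφ.coord_apply hx]
    have m1 : IsLocalMinOn (fun z => (coord W φ (ψ z)).1) quadrant (u, 0) := by
      filter_upwards [hmem] with z hz
      rw [hcx, ← h1]
      exact hz.1.2.1
    have m2 : IsLocalMinOn (fun z => (coord W φ (ψ z)).2) quadrant (u, 0) := by
      filter_upwards [hmem] with z hz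
      rw [hcx, ← h2]
      exact hz.1.2.2
    have e (d : ℝ × ℝ) (hd : (u, (0 : ℝ)) + d ∈ quadrant) : 0 ≤ (L d).1 ∧ 0 ≤ (L d).2 :=
      ⟨nonneg_of_isLocalMinOn_quadrant m1 hL.fst hy.2 hd,
        nonneg_of_isLocalMinOn_quadrant m2 hL.snd hy.2 hd⟩
    have e1 := e (1, 0) ⟨by simp; linarith [hu.1], by simp⟩
    have e2 := e (-u, 0) ⟨by simp, by simp⟩
    rw [show ((-u, 0) : ℝ × ℝ) = (-u) • (1, 0) by simp, L.map_smul] at e2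
    simp only [Prod.smul_fst, Prod.smul_snd, smul_eq_mul] at e2
    have f1 : (L (1, 0)).1 = 0 := le_antisymm (by nlinarith [hu.1]) e1.1
    have f2 : (L (1, 0)).2 = 0 := le_antisymm (by nlinarith [hu.1]) e1.2
    rw [f1, f2] at hpos
    simp at hpos
  · exact .inl ⟨h1.symm, h2⟩
  · exact .inr ⟨h1, h2.symm⟩
  -- `x` is interior to the quadrant, so all four directions are admissible while the second
  -- `ψ`-coordinate is minimal. The second row of `L` vanishes, again contradicting the determinant.
  · exfalso
    obtain ⟨L, hL, -, hmem, hpos, -⟩ := hψ.exists_transition hφ hy hx h.symm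
    have hcx : coord V ψ (φ x) = (u, 0) := by rw [← h, hψ.coord_apply hy]
    have m2 : IsLocalMinOn (fun z => (coord V ψ (φ z)).2) quadrant x := by
      filter_upwards [hmem] with z hz
      rw [hcx]
      exact hz.1.2.2
    have e (d : ℝ × ℝ) (hd : x + d ∈ quadrant) : 0 ≤ (L d).2 :=
      nonneg_of_isLocalMinOn_quadrant m2 hL.snd hx.2 hd
    have e1 := e (1, 0) ⟨by simp; linarith, by simp; linarith⟩
    have e2 := e (-x.1, 0) ⟨by simp, by simp; linarith⟩
    have e3 := e (0, 1) ⟨by simp; linarith, by simp; linarith⟩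
    have e4 := e (0, -x.2) ⟨by simp; linarith, by simp⟩
    rw [show ((-x.1, 0) : ℝ × ℝ) = (-x.1) • (1, 0) by simp, L.map_smul] at e2
    rw [show ((0, -x.2) : ℝ × ℝ) = (-x.2) • (0, 1) by simp, L.map_smul] at e4
    simp only [Prod.smul_snd, smul_eq_mul] at e2 e4
    have f1 : (L (1, 0)).2 = 0 := le_antisymm (by nlinarith) e1
    have f2 : (L (0, 1)).2 = 0 := le_antisymm (by nlinarith) e3
    rw [f1, f2] at hpos
    simp at hpos

/-- The transition between the lower edges of two charts. -/
theorem edge_transition (hφ : IsChart S n W φ) (hψ : IsChart S n V ψ) {u u' : ℝ}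
    (hu : u ∈ edgeSet V) (hu' : (u', (0 : ℝ)) ∈ W ∩ quadrant) (h : ψ (u, 0) = φ (u', 0)) :
    ∃ c : ℝ, 0 < c ∧ HasDerivAt (fun s => (coord W φ (ψ (s, 0))).1) c u ∧
      dFst ψ (u, 0) = c • dFst φ (u', 0) := by
  have hy := edge_mem hu
  obtain ⟨L, hL, hcomp, hmem, hpos, -⟩ := hφ.exists_transition hψ hu' hy h
  have hcx : coord W φ (ψ (u, 0)) = (u', 0) := by rw [h, hφ.coord_apply hu']
  have m2 : IsLocalMinOn (fun z => (coord W φ (ψ z)).2) quadrant (u, 0) := by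
    filter_upwards [hmem] with z hz
    rw [hcx]
    exact hz.1.2.2
  have e (d : ℝ × ℝ) (hd : (u, (0 : ℝ)) + d ∈ quadrant) : 0 ≤ (L d).2 :=
    nonneg_of_isLocalMinOn_quadrant m2 hL.snd hy.2 hd
  have e1 := e (1, 0) ⟨by simp; linarith [hu.1], by simp⟩
  have e2 := e (-u, 0) ⟨by simp, by simp⟩
  have e3 := e (0, 1) ⟨by simp; linarith [hu.1], by simp⟩
  rw [show ((-u, 0) : ℝ × ℝ) = (-u) • (1, 0) by simp, L.map_smul] at e2
  simp only [Prod.smul_snd, smul_eq_mul] at e2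
  -- Moving along the edge in either direction cannot decrease the second coordinate. The
  -- determinant thus reduces to a product whose second factor is nonnegative by `e3`, which makes
  -- `(L (1, 0)).1` positive.
  have f2 : (L (1, 0)).2 = 0 := le_antisymm (by nlinarith [hu.1]) e1
  refine ⟨(L (1, 0)).1, ?_, ?_, ?_⟩
  · rw [f2, zero_mul, sub_zero] at hpos
    exact pos_of_mul_pos_left hpos e3
  · have hline : HasDerivWithinAt (fun s : ℝ => (s, (0 : ℝ))) (1, 0) (Set.Ici 0) u :=
      ((hasDerivAt_id u).prodMk (hasDerivAt_const u (0 : ℝ))).hasDerivWithinAt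
    have hmaps : Set.MapsTo (fun s : ℝ => (s, (0 : ℝ))) (Set.Ici 0) quadrant :=
      fun s hs => ⟨hs, le_rfl⟩
    have := hL.fst.comp_hasDerivWithinAt u hline hmaps
    exact this.hasDerivAt (Ici_mem_nhds hu.1)
  · rw [dFst, ← hcomp, ContinuousLinearMap.comp_apply,
      show L (1, 0) = ((L (1, 0)).1, 0) from Prod.ext rfl f2, clm_prod_apply]
    simp [dFst]

theorem isOpen_edgeSet (h : IsChart S n W φ) : IsOpen (edgeSet W) :=
  (isOpen_lt continuous_const continuous_id).inter
    (h.isOpen.preimage (by fun_prop : Continuous fun u : ℝ => (u, (0 : ℝ))))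

theorem continuousOn_edge (h : IsChart S n W φ) :
    ContinuousOn (fun u : ℝ => φ (u, 0)) (edgeSet W) :=
  h.continuousOn.comp (by fun_prop) fun _ hu => hu.2

theorem continuousOn_norm_dFst_edge (h : IsChart S n W φ) :
    ContinuousOn (fun u : ℝ => ‖dFst φ (u, 0)‖) (edgeSet W) :=
  (h.continuousOn_dFst.comp (by fun_prop) fun _ hu => hu.2).norm

theorem injOn_edge (h : IsChart S n W φ) : Set.InjOn (fun u : ℝ => φ (u, 0)) (edgeSet W) :=
  fun _ hu _ hv huv => (Prod.ext_iff.1 (h.injOn (edge_mem hu) (edge_mem hv) huv)).1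

theorem measurableSet_edge_image (h : IsChart S n W φ) :
    MeasurableSet ((fun u : ℝ => φ (u, 0)) '' edgeSet W) :=
  measurableSet_image_param h.isOpen_edgeSet.measurableSet h.continuousOn_edge h.injOn_edge

/-- One-dimensional change of variables: the number `c` of `edge_transition` is both the derivative
of the transition and the ratio of the two speeds. -/
theorem edgeMeasure_restrict_le (hφ : IsChart S n W φ) (hψ : IsChart S n V ψ) :
    (edgeMeasure V ψ).restrict ((fun u : ℝ => φ (u, 0)) '' edgeSet W) ≤ edgeMeasure W φ := by
  refine paramMeasure_restrict_le hψ.isOpen_edgeSet.measurableSet hφ.isOpen_edgeSet.measurableSet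
    hψ.continuousOn_edge hφ.continuousOn_edge hψ.injOn_edge hφ.measurableSet_edge_image
    (fun s => (coord W φ (ψ (s, 0))).1) ?_
  rintro u hu ⟨u', hu', h⟩
  obtain ⟨c, hc, hT, hd⟩ := hφ.edge_transition hψ hu (edge_mem hu') h.symm
  have hcx : (coord W φ (ψ (u, 0))).1 = u' := by rw [← h, hφ.coord_apply (edge_mem hu')]
  rw [hcx]
  refine ⟨hu', h, _, hT.hasFDerivAt.hasFDerivWithinAt, ?_⟩
  rw [hd, norm_smul, Real.norm_eq_abs]
  simp

end IsChart

/-! ### Area, arc length and unit tangent computed in a single chart. -/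

namespace OrientedSurface

variable (S : OrientedSurface) {W : Set (ℝ × ℝ)} {φ : ℝ × ℝ → E3}

/-- Split any other chart measure into its parts on and off the image of `φ`: the first is bounded
by the measure of `φ`, the second by the area measure off the image. The supremum is therefore not
larger on the image than the measure of `φ`. -/
theorem areaMeasure_restrict (hφ : IsChart S.carrier S.normal W φ) :
    S.areaMeasure.restrict (φ '' (W ∩ quadrant)) = chartMeasure W φ := by
  refine restrict_eq_of_forall_le hφ.measurableSet_image ?_ ?_ fun ν' hν' => ?_
  · exact paramMeasure_compl_image hφ.measurableSet_domain
      (hφ.continuousOn.mono Set.inter_subset_left) hφ.injOn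
  · exact le_iSup_of_le W (le_iSup_of_le φ (le_iSup_of_le hφ le_rfl))
  · refine iSup_le fun V => iSup_le fun ψ => iSup_le fun hψ => ?_
    have hle : chartMeasure V ψ ≤ S.areaMeasure :=
      le_iSup_of_le V (le_iSup_of_le ψ (le_iSup_of_le hψ le_rfl))
    change chartMeasure V ψ ≤ ν'
    refine le_trans ?_ hν'
    rw [← Measure.restrict_add_restrict_compl hφ.measurableSet_image (μ := chartMeasure V ψ)]
    exact add_le_add (hφ.chartMeasure_restrict_le hψ) (Measure.restrict_mono_measure hle _)

theorem areaMeasure_restrict_carrier : S.areaMeasure.restrict S.carrier = S.areaMeasure := by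
  refine le_antisymm Measure.restrict_le_self ?_
  refine iSup_le fun V => iSup_le fun ψ => iSup_le fun hψ => ?_
  have hle : chartMeasure V ψ ≤ S.areaMeasure :=
    le_iSup_of_le V (le_iSup_of_le ψ (le_iSup_of_le hψ le_rfl))
  change chartMeasure V ψ ≤ _
  have h0 : chartMeasure V ψ S.carrierᶜ = 0 :=
    measure_mono_null (Set.compl_subset_compl.2 (by
      rintro _ ⟨x, hx, rfl⟩
      exact hψ.mem_carrier hx)) (paramMeasure_compl_image hψ.measurableSet_domain
      (hψ.continuousOn.mono Set.inter_subset_left) hψ.injOn)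
  rw [← Measure.restrict_eq_self_of_ae_mem h0]
  exact Measure.restrict_mono_measure hle _

/-- The two parameter sets differ at most in `u = 0`, a null set. Removing the corner makes the edge
domain open and both directions along it available. -/
theorem edgeMeasure_eq (W : Set (ℝ × ℝ)) (φ : ℝ × ℝ → E3) :
    Measure.map (fun u : ℝ => φ (u, 0))
      ((volume.restrict {u : ℝ | (u, (0 : ℝ)) ∈ W ∩ quadrant}).withDensity
        fun u => ENNReal.ofReal ‖dFst φ (u, 0)‖) = edgeMeasure W φ := by
  refine paramMeasure_congr_set (Filter.eventuallyEq_set.2 ?_)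
  have h0 : ∀ᵐ u : ℝ, u ≠ 0 := by simp [ae_iff]
  filter_upwards [h0] with u hu
  constructor
  · rintro ⟨h1, h2, -⟩
    exact ⟨lt_of_le_of_ne h2 hu.symm, h1⟩
  · rintro ⟨h1, h2⟩
    exact ⟨h2, h1.le, le_rfl⟩

theorem boundaryMeasure_eq :
    S.boundaryMeasure = ⨆ (W : Set (ℝ × ℝ)) (φ : ℝ × ℝ → E3)
      (_ : IsChart S.carrier S.normal W φ), edgeMeasure W φ := by
  simp only [boundaryMeasure, edgeMeasure_eq]

theorem edgeMeasure_le (hφ : IsChart S.carrier S.normal W φ) :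
    edgeMeasure W φ ≤ S.boundaryMeasure := by
  rw [boundaryMeasure_eq]
  exact le_iSup_of_le W (le_iSup_of_le φ (le_iSup_of_le hφ le_rfl))

theorem edgeMeasure_compl (hφ : IsChart S.carrier S.normal W φ) :
    edgeMeasure W φ ((fun u : ℝ => φ (u, 0)) '' edgeSet W)ᶜ = 0 :=
  paramMeasure_compl_image hφ.isOpen_edgeSet.measurableSet hφ.continuousOn_edge hφ.injOn_edge

theorem boundaryMeasure_restrict_carrier :
    S.boundaryMeasure.restrict S.carrier = S.boundaryMeasure := by
  refine le_antisymm Measure.restrict_le_self ?_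
  conv_lhs => rw [boundaryMeasure_eq]
  refine iSup_le fun V => iSup_le fun ψ => iSup_le fun hψ => ?_
  have h0 : edgeMeasure V ψ S.carrierᶜ = 0 :=
    measure_mono_null (Set.compl_subset_compl.2 (by
      rintro _ ⟨x, hx, rfl⟩
      exact hψ.mem_carrier (IsChart.edge_mem hx))) (S.edgeMeasure_compl hψ)
  rw [← Measure.restrict_eq_self_of_ae_mem h0]
  exact Measure.restrict_mono_measure (S.edgeMeasure_le hψ) _

/-- Over the image of a chart, the boundary consists of the lower edge and of the left edge, which
is the lower edge of the rotated chart. -/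
theorem boundaryMeasure_restrict (hφ : IsChart S.carrier S.normal W φ) {c : ℝ}
    (hc : ∀ x ∈ W, x.2 < c) :
    S.boundaryMeasure.restrict (φ '' (W ∩ quadrant)) =
      edgeMeasure W φ + edgeMeasure (rotDomain c W) (rotParam c φ) := by
  have hφ' := hφ.rot c
  set A := φ '' (W ∩ quadrant) with hA
  set E := (fun u : ℝ => φ (u, 0)) '' edgeSet W with hE
  set E' := (fun u : ℝ => rotParam c φ (u, 0)) '' edgeSet (rotDomain c W) with hE'
  have hmem' (u : ℝ) (hu : u ∈ edgeSet (rotDomain c W)) : (0, c - u) ∈ W ∩ quadrant :=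
    ⟨hu.2.1, le_rfl, sub_nonneg.2 hu.2.2.2.le⟩
  have hEA : E ⊆ A := by
    rintro _ ⟨u, hu, rfl⟩
    exact ⟨_, IsChart.edge_mem hu, rfl⟩
  have hEA' : E' ⊆ A := by
    rintro _ ⟨u, hu, rfl⟩
    exact ⟨_, hmem' u hu, rfl⟩
  have hdisj : Disjoint E E' := by
    rw [Set.disjoint_left]
    rintro _ ⟨u, hu, rfl⟩ ⟨u', hu', h⟩
    have := hφ.injOn (hmem' u' hu') (IsChart.edge_mem hu) h
    exact hu.1.ne (Prod.ext_iff.1 this).1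
  have hEm : MeasurableSet E := hφ.measurableSet_edge_image
  have hEm' : MeasurableSet E' := hφ'.measurableSet_edge_image
  have h0 := S.edgeMeasure_compl hφ
  have h0' := S.edgeMeasure_compl hφ'
  refine restrict_eq_of_forall_le hφ.measurableSet_image ?_ ?_ fun ν' hν' => ?_
  · rw [Measure.add_apply, measure_mono_null (Set.compl_subset_compl.2 hEA) h0,
      measure_mono_null (Set.compl_subset_compl.2 hEA') h0', add_zero]
  · calc
      _ = (edgeMeasure W φ).restrict E +
          (edgeMeasure (rotDomain c W) (rotParam c φ)).restrict E' := by
        have r : (edgeMeasure W φ).restrict E = edgeMeasure W φ :=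
          Measure.restrict_eq_self_of_ae_mem h0
        have r' : (edgeMeasure (rotDomain c W) (rotParam c φ)).restrict E' =
            edgeMeasure (rotDomain c W) (rotParam c φ) := Measure.restrict_eq_self_of_ae_mem h0'
        rw [r, r']
      _ ≤ S.boundaryMeasure.restrict E + S.boundaryMeasure.restrict E' :=
        add_le_add (Measure.restrict_mono_measure (S.edgeMeasure_le hφ) _)
          (Measure.restrict_mono_measure (S.edgeMeasure_le hφ') _)
      _ = S.boundaryMeasure.restrict (E ∪ E') := (Measure.restrict_union hdisj hEm').symm
      _ ≤ S.boundaryMeasure := Measure.restrict_le_self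
  · rw [boundaryMeasure_eq]
    refine iSup_le fun V => iSup_le fun ψ => iSup_le fun hψ => le_trans ?_ hν'
    rw [← Measure.restrict_add_restrict_compl hφ.measurableSet_image (μ := edgeMeasure V ψ)]
    refine add_le_add ?_ (Measure.restrict_mono_measure (S.edgeMeasure_le hψ) _)
    set B := (fun u : ℝ => ψ (u, 0)) '' edgeSet V with hB
    -- `edge_point` is what excludes boundary measure elsewhere: an edge point of another chart is
    -- never interior to this one, nor its corner.
    have hsub : A ∩ B ⊆ E ∪ E' := by
      rintro _ ⟨⟨x, hx, rfl⟩, ⟨u, hu, h⟩⟩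
      rcases hφ.edge_point hψ hu hx h with ⟨h1, h2⟩ | ⟨h1, h2⟩
      · refine .inr ⟨c - x.2, ⟨sub_pos.2 (hc x hx.1), ?_, sub_pos.2 (hc x hx.1), ?_⟩, ?_⟩
        · simpa [← h1] using hx.1
        · simpa using h2
        · simp [rotParam, ← h1]
      · have : x = (x.1, 0) := Prod.ext rfl h2
        exact .inl ⟨x.1, ⟨h1, this ▸ hx.1⟩, by rw [this]⟩
    calc
      (edgeMeasure V ψ).restrict A = ((edgeMeasure V ψ).restrict B).restrict A := by
        have r : (edgeMeasure V ψ).restrict B = edgeMeasure V ψ :=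
          Measure.restrict_eq_self_of_ae_mem (S.edgeMeasure_compl hψ)
        rw [r]
      _ = (edgeMeasure V ψ).restrict (A ∩ B) := Measure.restrict_restrict hφ.measurableSet_image
      _ ≤ (edgeMeasure V ψ).restrict (E ∪ E') := Measure.restrict_mono hsub le_rfl
      _ ≤ (edgeMeasure V ψ).restrict E + (edgeMeasure V ψ).restrict E' :=
        Measure.restrict_union_le _ _
      _ ≤ _ := add_le_add (hφ.edgeMeasure_restrict_le hψ) (hφ'.edgeMeasure_restrict_le hψ)

/-- Between positively oriented charts the edge velocity changes by a positive factor, so the choice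
made by `Classical.epsilon` does not affect the unit vector. -/
theorem boundaryTangent_eq (hφ : IsChart S.carrier S.normal W φ) {u : ℝ} (hu : u ∈ edgeSet W) :
    S.boundaryTangent (φ (u, 0)) = ‖dFst φ (u, 0)‖⁻¹ • dFst φ (u, 0) := by
  have hex : ∃ τ : E3, ∃ (V : Set (ℝ × ℝ)) (ψ : ℝ × ℝ → E3) (v : ℝ),
      IsChart S.carrier S.normal V ψ ∧ (v, (0 : ℝ)) ∈ V ∩ quadrant ∧ ψ (v, 0) = φ (u, 0) ∧
        τ = ‖dFst ψ (v, 0)‖⁻¹ • dFst ψ (v, 0) :=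
    ⟨_, W, φ, u, hφ, IsChart.edge_mem hu, rfl, rfl⟩
  obtain ⟨V, ψ, v, hψ, hv, h, hτ⟩ := Classical.epsilon_spec hex
  obtain ⟨c, hc, -, hd⟩ := hψ.edge_transition hφ hu hv h.symm
  rw [boundaryTangent, hτ, hd, norm_smul, Real.norm_of_nonneg hc.le, smul_smul, mul_inv,
    mul_comm c⁻¹, mul_assoc, inv_mul_cancel₀ hc.ne', mul_one]

/-! ### Integrals of functions supported in a chart -/

section Integrals

variable {F : Type*} [NormedAddCommGroup F] [NormedSpace ℝ F] {S}

theorem integral_area_of_chart (hφ : IsChart S.carrier S.normal W φ) {K : Set (ℝ × ℝ)}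
    (hKW : K ⊆ W ∩ quadrant) {f : E3 → F}
    (hf : ∀ p ∈ S.carrier, p ∉ φ '' K → f p = 0) :
    ∫ p, f p ∂S.areaMeasure = ∫ x in K, ‖cross (dFst φ x) (dSnd φ x)‖ • f (φ x) := by
  have hA : ∀ p ∈ S.carrier \ (φ '' (W ∩ quadrant)), f p = 0 := fun p hp =>
    hf p hp.1 fun h => hp.2 (Set.image_mono hKW h)
  rw [← S.areaMeasure_restrict_carrier, setIntegral_eq_of_subset_of_forall_sdiff_eq_zero
    S.isCompact.measurableSet (by rintro _ ⟨x, hx, rfl⟩; exact hφ.mem_carrier hx) hA,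
    S.areaMeasure_restrict hφ, chartMeasure, integral_paramMeasure hφ.measurableSet_domain
      (hφ.continuousOn.mono Set.inter_subset_left) hφ.injOn
      (hφ.continuousOn_cross.norm.mono Set.inter_subset_left) fun _ _ => norm_nonneg _]
  refine setIntegral_eq_of_subset_of_forall_sdiff_eq_zero hφ.measurableSet_domain hKW fun x hx => ?_
  rw [hf _ (hφ.mem_carrier hx.1), smul_zero]
  rintro ⟨y, hy, hyx⟩
  exact hx.2 (hφ.injOn (hKW hy) hx.1 hyx ▸ hy)

theorem integrable_area_of_chart (hφ : IsChart S.carrier S.normal W φ) {K : Set (ℝ × ℝ)}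
    (hK : IsCompact K) (hKW : K ⊆ W ∩ quadrant) {f : E3 → F}
    (hf : ∀ p ∈ S.carrier, p ∉ φ '' K → f p = 0) (hc : ContinuousOn (fun x => f (φ x)) K) :
    Integrable f S.areaMeasure := by
  have h1 : Integrable f (S.areaMeasure.restrict (φ '' (W ∩ quadrant))) := by
    rw [S.areaMeasure_restrict hφ, chartMeasure, integrable_paramMeasure hφ.measurableSet_domain
      (hφ.continuousOn.mono Set.inter_subset_left) hφ.injOn
      (hφ.continuousOn_cross.norm.mono Set.inter_subset_left) fun _ _ => norm_nonneg _]
    have h2 : IntegrableOn (fun x => ‖cross (dFst φ x) (dSnd φ x)‖ • f (φ x)) K :=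
      (((hφ.continuousOn_cross.norm.mono (hKW.trans Set.inter_subset_left)).smul
        hc).integrableOn_compact hK)
    refine h2.of_forall_sdiff_eq_zero hφ.measurableSet_domain fun x hx => ?_
    rw [hf _ (hφ.mem_carrier hx.1), smul_zero]
    rintro ⟨y, hy, hyx⟩
    exact hx.2 (hφ.injOn (hKW hy) hx.1 hyx ▸ hy)
  rw [← S.areaMeasure_restrict_carrier]
  refine IntegrableOn.of_forall_sdiff_eq_zero h1 S.isCompact.measurableSet fun p hp => ?_
  exact hf p hp.1 fun h => hp.2 (Set.image_mono hKW h)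

theorem integral_edgeMeasure (hφ : IsChart S.carrier S.normal W φ) (f : E3 → F) :
    ∫ p, f p ∂edgeMeasure W φ = ∫ u in edgeSet W, ‖dFst φ (u, 0)‖ • f (φ (u, 0)) :=
  integral_paramMeasure hφ.isOpen_edgeSet.measurableSet hφ.continuousOn_edge hφ.injOn_edge
    hφ.continuousOn_norm_dFst_edge (fun _ _ => norm_nonneg _) f

theorem integrable_edgeMeasure (hφ : IsChart S.carrier S.normal W φ) (f : E3 → F) :
    Integrable f (edgeMeasure W φ) ↔
      IntegrableOn (fun u : ℝ => ‖dFst φ (u, 0)‖ • f (φ (u, 0))) (edgeSet W) :=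
  integrable_paramMeasure hφ.isOpen_edgeSet.measurableSet hφ.continuousOn_edge hφ.injOn_edge
    hφ.continuousOn_norm_dFst_edge (fun _ _ => norm_nonneg _) f

end Integrals

end OrientedSurface

/-! ### Cutoff functions -/

theorem exists_cutoff {X : Type*} [NormedAddCommGroup X] [NormedSpace ℝ X]
    [FiniteDimensional ℝ X] {K Ω : Set X} (hK : IsCompact K) (hΩ : IsOpen Ω) (hKΩ : K ⊆ Ω) :
    ∃ (η : X → ℝ) (L : Set X), ContDiff ℝ ∞ η ∧ IsCompact L ∧ L ⊆ Ω ∧ (∀ x ∉ L, η x = 0) ∧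
      ∀ x ∈ K, ∀ᶠ z in 𝓝 x, η z = 1 := by
  have : ProperSpace X := FiniteDimensional.proper ℝ X
  obtain ⟨L, hL, hKL, hLΩ⟩ := exists_compact_between hK hΩ hKΩ
  obtain ⟨η, h1, h2, -⟩ := exists_contMDiffMap_one_nhds_of_subset_interior (n := ⊤) 𝓘(ℝ, X)
    hK.isClosed hKL
  exact ⟨η, L, η.contMDiff.contDiff, hL, hLΩ, h2, fun x hx =>
    h1.filter_mono (nhds_le_nhdsSet hx)⟩

/-- On `Ω` this is a product of smooth functions. A point off `Ω` has a neighbourhood missing the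
closed set `L`, where the product is zero. -/
theorem contDiff_cutoff_smul {X F : Type*} [NormedAddCommGroup X] [NormedSpace ℝ X]
    [NormedAddCommGroup F] [NormedSpace ℝ F] {Ω L : Set X} (hΩ : IsOpen Ω) (hL : IsClosed L)
    (hLΩ : L ⊆ Ω) {η : X → ℝ} (hη : ContDiff ℝ ∞ η) (hη0 : ∀ x ∉ L, η x = 0) {f : X → F}
    {n : ℕ∞} (hf : ContDiffOn ℝ n f Ω) : ContDiff ℝ n fun x => η x • f x := by
  rw [contDiff_iff_contDiffAt]
  intro x
  by_cases hx : x ∈ Ω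
  · exact (hη.contDiffAt.of_le (by exact_mod_cast le_top)).smul
      (hf.contDiffAt (hΩ.mem_nhds hx))
  · have : (fun x => η x • f x) =ᶠ[𝓝 x] fun _ => 0 := by
      filter_upwards [hL.isOpen_compl.mem_nhds fun h => hx (hLΩ h)] with z hz
      rw [hη0 z hz, zero_smul]
    exact contDiffAt_const.congr_of_eventuallyEq this

/-! ### Green's theorem on the quadrant -/

/-- The open quadrant. -/
def openQuadrant : Set (ℝ × ℝ) := Set.Ioi 0 ×ˢ Set.Ioi 0

theorem openQuadrant_subset : openQuadrant ⊆ quadrant := fun _ hx => ⟨hx.1.le, hx.2.le⟩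

theorem isOpen_openQuadrant : IsOpen openQuadrant := isOpen_Ioi.prod isOpen_Ioi

theorem hasCompactSupport_fst_slice {f : ℝ × ℝ → ℝ} (hf : HasCompactSupport f) (v : ℝ) :
    HasCompactSupport fun u => f (u, v) :=
  HasCompactSupport.intro (hf.isCompact.image continuous_fst) fun _ hu =>
    image_eq_zero_of_notMem_tsupport fun h => hu ⟨_, h, rfl⟩

theorem hasCompactSupport_snd_slice {f : ℝ × ℝ → ℝ} (hf : HasCompactSupport f) (u : ℝ) :
    HasCompactSupport fun v => f (u, v) :=
  HasCompactSupport.intro (hf.isCompact.image continuous_snd) fun _ hv =>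
    image_eq_zero_of_notMem_tsupport fun h => hv ⟨_, h, rfl⟩

theorem integrable_fderiv_apply {f : ℝ × ℝ → ℝ} (hf : ContDiff ℝ 1 f) (hf' : HasCompactSupport f)
    (e : ℝ × ℝ) : Integrable fun x => fderiv ℝ f x e :=
  ((hf.continuous_fderiv one_ne_zero).clm_apply
    continuous_const).integrable_of_hasCompactSupport (hf'.fderiv_apply ℝ e)

/-- Fubini reduces this to half-lines; on each, compact support leaves only the value at the
endpoint. -/
theorem integral_openQuadrant_fderiv_fst {f : ℝ × ℝ → ℝ} (hf : ContDiff ℝ 1 f)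
    (hf' : HasCompactSupport f) :
    ∫ x in openQuadrant, fderiv ℝ f x (1, 0) = -∫ v in Set.Ioi (0 : ℝ), f (0, v) := by
  have hint := (integrable_fderiv_apply hf hf' (1, 0)).integrableOn (s := openQuadrant)
  have h1 : ∫ x in openQuadrant, fderiv ℝ f x (1, 0) =
      ∫ v in Set.Ioi (0 : ℝ), ∫ u in Set.Ioi (0 : ℝ), fderiv ℝ f (u, v) (1, 0) := by
    rw [openQuadrant, Measure.volume_eq_prod, ← Measure.prod_restrict]
    refine integral_prod_symm _ ?_
    rwa [Measure.prod_restrict]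
  rw [h1, ← integral_neg]
  congr 1 with v
  have hd (u : ℝ) : HasDerivAt (fun s => f (s, v)) (fderiv ℝ f (u, v) (1, 0)) u :=
    ((hf.differentiable one_ne_zero).differentiableAt.hasFDerivAt (x := (u, v))).comp_hasDerivAt u
      ((hasDerivAt_id u).prodMk (hasDerivAt_const u v))
  rw [← (hasCompactSupport_fst_slice hf' v).integral_Ioi_deriv_eq (by fun_prop) 0]
  simp only [(hd _).deriv]

theorem integral_openQuadrant_fderiv_snd {f : ℝ × ℝ → ℝ} (hf : ContDiff ℝ 1 f)
    (hf' : HasCompactSupport f) :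
    ∫ x in openQuadrant, fderiv ℝ f x (0, 1) = -∫ u in Set.Ioi (0 : ℝ), f (u, 0) := by
  have hint := (integrable_fderiv_apply hf hf' (0, 1)).integrableOn (s := openQuadrant)
  rw [openQuadrant, Measure.volume_eq_prod, setIntegral_prod _ hint, ← integral_neg]
  congr 1 with u
  have hd (v : ℝ) : HasDerivAt (fun s => f (u, s)) (fderiv ℝ f (u, v) (0, 1)) v :=
    ((hf.differentiable one_ne_zero).differentiableAt.hasFDerivAt (x := (u, v))).comp_hasDerivAt v
      ((hasDerivAt_const v u).prodMk (hasDerivAt_id v))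
  rw [← (hasCompactSupport_snd_slice hf' u).integral_Ioi_deriv_eq (by fun_prop) 0]
  simp only [(hd _).deriv]

theorem green_quadrant {a b : ℝ × ℝ → ℝ} (ha : ContDiff ℝ 1 a) (hb : ContDiff ℝ 1 b)
    (ha' : HasCompactSupport a) (hb' : HasCompactSupport b) :
    ∫ x in openQuadrant, (fderiv ℝ b x (1, 0) - fderiv ℝ a x (0, 1)) =
      (∫ u in Set.Ioi (0 : ℝ), a (u, 0)) - ∫ v in Set.Ioi (0 : ℝ), b (0, v) := by
  rw [integral_sub (integrable_fderiv_apply hb hb' _).integrableOn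
    (integrable_fderiv_apply ha ha' _).integrableOn, integral_openQuadrant_fderiv_fst hb hb',
    integral_openQuadrant_fderiv_snd ha ha']
  ring

theorem ae_mem_openQuadrant : ∀ᵐ x : ℝ × ℝ, x ∈ quadrant → x ∈ openQuadrant := by
  have h0 : ∀ᵐ u : ℝ, u ≠ 0 := by simp [ae_iff]
  have h1 : ∀ᵐ x : ℝ × ℝ, x.1 ≠ 0 := Measure.quasiMeasurePreserving_fst.ae h0
  have h2 : ∀ᵐ x : ℝ × ℝ, x.2 ≠ 0 := Measure.quasiMeasurePreserving_snd.ae h0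
  filter_upwards [h1, h2] with x hx1 hx2 hx
  exact ⟨lt_of_le_of_ne hx.1 hx1.symm, lt_of_le_of_ne hx.2 hx2.symm⟩

/-! ### The curl -/

/-- The curl of a vector field with derivative `L`. -/
noncomputable def curlVec (L : E3 →L[ℝ] E3) : E3 :=
  !₂[L (EuclideanSpace.single 1 1) 2 - L (EuclideanSpace.single 2 1) 1,
    L (EuclideanSpace.single 2 1) 0 - L (EuclideanSpace.single 0 1) 2,
    L (EuclideanSpace.single 0 1) 1 - L (EuclideanSpace.single 1 1) 0]

theorem E3.clm_apply (L : E3 →L[ℝ] E3) (a : E3) (i : Fin 3) :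
    L a i = a 0 * L (EuclideanSpace.single 0 1) i + a 1 * L (EuclideanSpace.single 1 1) i +
      a 2 * L (EuclideanSpace.single 2 1) i := by
  have h : a = a 0 • EuclideanSpace.single 0 (1 : ℝ) + a 1 • EuclideanSpace.single 1 (1 : ℝ) +
      a 2 • EuclideanSpace.single 2 (1 : ℝ) := by
    apply E3.ext_coord <;> simp
  conv_lhs => rw [h]
  simp

/-- The curl records the antisymmetric part of `L`, so pairing it with a cross product evaluates the
exterior derivative of the corresponding one-form on `(a, b)`. -/
theorem inner_curlVec_cross (L : E3 →L[ℝ] E3) (a b : E3) :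
    inner ℝ (curlVec L) (cross a b) = inner ℝ (L a) b - inner ℝ (L b) a := by
  simp only [E3.inner_eq, E3.clm_apply L a, E3.clm_apply L b, cross_zero_coord, cross_one_coord,
    cross_two_coord, curlVec]
  simp
  ring

theorem curlVec_zero : curlVec 0 = 0 := by
  apply E3.ext_coord <;> simp [curlVec]

theorem curlVec_add (L L' : E3 →L[ℝ] E3) : curlVec (L + L') = curlVec L + curlVec L' := by
  apply E3.ext_coord <;> simp [curlVec] <;> ring

theorem curlVec_sum {κ : Type*} (s : Finset κ) (L : κ → E3 →L[ℝ] E3) :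
    curlVec (∑ j ∈ s, L j) = ∑ j ∈ s, curlVec (L j) := by
  classical
  induction s using Finset.induction_on with
  | empty => simp [curlVec_zero]
  | insert a s ha ih => rw [Finset.sum_insert ha, Finset.sum_insert ha, curlVec_add, ih]

theorem continuous_curlVec : Continuous curlVec := by
  have h (i j : Fin 3) : Continuous fun L : E3 →L[ℝ] E3 => L (EuclideanSpace.single i 1) j := by
    fun_prop
  unfold curlVec
  refine (PiLp.continuous_toLp 2 _).comp (continuous_pi fun i => ?_)
  fin_cases i
  · exact (h 1 2).sub (h 2 1)
  · exact (h 2 0).sub (h 0 2)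
  · exact (h 0 1).sub (h 1 0)

/-- The exterior derivative of the pullback of a one-form by a parametrization. -/
theorem fderiv_pullback {φ : ℝ × ℝ → E3} {G : E3 → E3} {x : ℝ × ℝ} (hφ : ContDiffAt ℝ ∞ φ x)
    (hG : DifferentiableAt ℝ G (φ x)) :
    fderiv ℝ (fun z => inner ℝ (G (φ z)) (dSnd φ z)) x (1, 0) -
      fderiv ℝ (fun z => inner ℝ (G (φ z)) (dFst φ z)) x (0, 1) =
      inner ℝ (curlVec (fderiv ℝ G (φ x))) (cross (dFst φ x) (dSnd φ x)) := by
  have hGφ : HasFDerivAt (fun z => G (φ z)) ((fderiv ℝ G (φ x)).comp (fderiv ℝ φ x)) x :=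
    hG.hasFDerivAt.comp x (hφ.differentiableAt (by simp)).hasFDerivAt
  have hφ' : HasFDerivAt (fderiv ℝ φ) (fderiv ℝ (fderiv ℝ φ) x) x :=
    ((hφ.fderiv_right (m := ∞) (by simp)).differentiableAt (by simp)).hasFDerivAt
  have hd (e : ℝ × ℝ) : HasFDerivAt (fun z => fderiv ℝ φ z e)
      ((ContinuousLinearMap.apply ℝ E3 e).comp (fderiv ℝ (fderiv ℝ φ) x)) x :=
    (ContinuousLinearMap.apply ℝ E3 e).hasFDerivAt.comp x hφ'
  have hin (e : ℝ × ℝ) := (hGφ.inner ℝ (hd e)).fderiv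
  -- The terms containing second derivatives of `φ` cancel by symmetry; only the antisymmetrized
  -- derivative of `G` survives.
  have hsymm := (hφ.isSymmSndFDerivAt (by
    rw [minSmoothness_of_isRCLikeNormedField]; exact ENat.LEInfty.out)).eq (1, 0) (0, 1)
  unfold dFst dSnd
  rw [hin, hin, inner_curlVec_cross]
  simp only [ContinuousLinearMap.comp_apply, fderivInnerCLM_apply,
    ContinuousLinearMap.prod_apply, ContinuousLinearMap.apply_apply]
  rw [hsymm]
  ring

/-- Used to pass between the half-lines of Green's theorem and the edge sets of charts: both
integrands are extended by zero and compared pointwise. -/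
theorem integrable_restrict_eq {α : Type*} [MeasurableSpace α] {μ : Measure α} {s t : Set α}
    (hs : MeasurableSet s) (ht : MeasurableSet t) {F : Type*} [NormedAddCommGroup F]
    {f g : α → F} (hf : IntegrableOn f s μ) (h : ∀ x, s.indicator f x = t.indicator g x) :
    IntegrableOn g t μ := by
  rw [← integrable_indicator_iff ht, ← funext h, integrable_indicator_iff hs]
  exact hf

theorem setIntegral_eq_of_indicator {α : Type*} [MeasurableSpace α] {μ : Measure α} {s t : Set α}
    (hs : MeasurableSet s) (ht : MeasurableSet t) {F : Type*} [NormedAddCommGroup F]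
    [NormedSpace ℝ F] {f g : α → F} (h : ∀ x, s.indicator f x = t.indicator g x) :
    ∫ x in s, f x ∂μ = ∫ x in t, g x ∂μ := by
  rw [← integral_indicator hs, ← integral_indicator ht, funext h]

/-! ### Stokes' theorem in one chart. -/

namespace OrientedSurface

variable {S : OrientedSurface} {W : Set (ℝ × ℝ)} {φ : ℝ × ℝ → E3}

theorem norm_smul_inner_boundaryTangent (hφ : IsChart S.carrier S.normal W φ) {u : ℝ}
    (hu : u ∈ edgeSet W) (g : E3) :
    ‖dFst φ (u, 0)‖ • (inner ℝ g (S.boundaryTangent (φ (u, 0))) : ℝ) =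
      inner ℝ g (dFst φ (u, 0)) := by
  rw [S.boundaryTangent_eq hφ hu, inner_smul_right, smul_eq_mul]
  by_cases h : dFst φ (u, 0) = 0
  · simp [h]
  · rw [mul_inv_cancel_left₀ (norm_ne_zero_iff.2 h)]

/-- Stokes' theorem for a vector field supported in a chart. -/
theorem stokes_of_bounded_chart (hφ : IsChart S.carrier S.normal W φ) {c : ℝ}
    (hc : ∀ x ∈ W, x.2 < c) {K : Set (ℝ × ℝ)} (hK : IsCompact K) (hKW : K ⊆ W ∩ quadrant)
    {D : Set E3} (hD : IsOpen D) (hSD : S.carrier ⊆ D) {G : E3 → E3} (hG : ContDiffOn ℝ ∞ G D)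
    (hGK : S.carrier ∩ tsupport G ⊆ φ '' K) :
    Integrable (fun p => (inner ℝ (curlVec (fderiv ℝ G p)) (S.normal p) : ℝ)) S.areaMeasure ∧
    Integrable (fun p => (inner ℝ (G p) (S.boundaryTangent p) : ℝ)) S.boundaryMeasure ∧
    ∫ p, inner ℝ (curlVec (fderiv ℝ G p)) (S.normal p) ∂S.areaMeasure =
      ∫ p, inner ℝ (G p) (S.boundaryTangent p) ∂S.boundaryMeasure := by
  have hφ' := hφ.rot c
  have hG0 (p : E3) (hp : p ∈ S.carrier) (hpK : p ∉ φ '' K) : G p = 0 :=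
    image_eq_zero_of_notMem_tsupport fun h => hpK (hGK ⟨hp, h⟩)
  have hG0' (x : ℝ × ℝ) (hx : x ∈ W ∩ quadrant) (hxK : x ∉ K) : G (φ x) = 0 :=
    hG0 _ (hφ.mem_carrier hx) (by
      rintro ⟨y, hy, hyx⟩
      exact hxK (hφ.injOn (hKW hy) hx hyx ▸ hy))
  -- `G` is smooth only on `D`, so the coefficients of the pulled-back form are smooth only here.
  set Ω := W ∩ φ ⁻¹' D with hΩ
  have hΩo : IsOpen Ω := hφ.continuousOn.isOpen_inter_preimage hφ.isOpen hD
  have hWΩ : W ∩ quadrant ⊆ Ω := fun x hx => ⟨hx.1, hSD (hφ.mem_carrier hx)⟩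
  -- Multiplying by `η` gives globally smooth, compactly supported coefficients, as Green's theorem
  -- needs. Nothing changes on `W ∩ quadrant`: there `η = 1` on `K`, and `G ∘ φ` vanishes off `K`.
  obtain ⟨η, L, hη, hL, hLΩ, hη0, hη1⟩ := exists_cutoff hK hΩo (hKW.trans hWΩ)
  have hGφ : ContDiffOn ℝ ∞ (fun x => G (φ x)) Ω :=
    hG.comp (hφ.smooth.mono Set.inter_subset_left) fun x hx => hx.2
  have hdφ (e : ℝ × ℝ) : ContDiffOn ℝ ∞ (fun x => fderiv ℝ φ x e) Ω :=
    ((hφ.smooth.fderiv_of_isOpen hφ.isOpen (m := ∞) (by simp)).mono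
      Set.inter_subset_left).clm_apply contDiffOn_const
  set α : ℝ × ℝ → ℝ := fun x => inner ℝ (G (φ x)) (dFst φ x) with hα
  set β : ℝ × ℝ → ℝ := fun x => inner ℝ (G (φ x)) (dSnd φ x) with hβ
  have hαs : ContDiffOn ℝ ∞ α Ω := hGφ.inner ℝ (hdφ (1, 0))
  have hβs : ContDiffOn ℝ ∞ β Ω := hGφ.inner ℝ (hdφ (0, 1))
  set a : ℝ × ℝ → ℝ := fun x => η x • α x with ha
  set b : ℝ × ℝ → ℝ := fun x => η x • β x with hb
  have has : ContDiff ℝ 1 a :=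
    (contDiff_cutoff_smul hΩo hL.isClosed hLΩ hη hη0 (n := ⊤) hαs).of_le (by simp)
  have hbs : ContDiff ℝ 1 b :=
    (contDiff_cutoff_smul hΩo hL.isClosed hLΩ hη hη0 (n := ⊤) hβs).of_le (by simp)
  have hac : HasCompactSupport a := HasCompactSupport.intro hL fun x hx => by simp [ha, hη0 x hx]
  have hbc : HasCompactSupport b := HasCompactSupport.intro hL fun x hx => by simp [hb, hη0 x hx]
  -- the values on the quadrant
  have haW (x : ℝ × ℝ) (hx : x ∈ W ∩ quadrant) : a x = α x := by
    by_cases h : x ∈ K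
    · simp [ha, (hη1 x h).self_of_nhds]
    · simp [ha, hα, hG0' x hx h]
  have hbW (x : ℝ × ℝ) (hx : x ∈ W ∩ quadrant) : b x = β x := by
    by_cases h : x ∈ K
    · simp [hb, (hη1 x h).self_of_nhds]
    · simp [hb, hβ, hG0' x hx h]
  have haW' (x : ℝ × ℝ) (hx : x ∉ W) : a x = 0 := by
    simp [ha, hη0 x fun h => hx (hLΩ h).1]
  have hbW' (x : ℝ × ℝ) (hx : x ∉ W) : b x = 0 := by
    simp [hb, hη0 x fun h => hx (hLΩ h).1]
  -- the divergence
  set γ : ℝ × ℝ → ℝ := fun x => inner ℝ (curlVec (fderiv ℝ G (φ x)))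
    (cross (dFst φ x) (dSnd φ x)) with hγ
  -- Derivatives need agreement on full neighbourhoods. At points of `K` this comes from `η = 1`
  -- nearby; off `K` the coefficients vanish nearby, but only inside the open quadrant, since `G ∘
  -- φ` is not controlled across its edges.
  have hdiv (x : ℝ × ℝ) : openQuadrant.indicator
      (fun x => fderiv ℝ b x (1, 0) - fderiv ℝ a x (0, 1)) x =
      (openQuadrant ∩ K).indicator γ x := by
    by_cases hxQ : x ∈ openQuadrant
    swap
    · rw [Set.indicator_of_notMem hxQ, Set.indicator_of_notMem fun h : x ∈ openQuadrant ∩ K => hxQ h.1]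
    rw [Set.indicator_of_mem hxQ]
    by_cases hxK : x ∈ K
    · rw [Set.indicator_of_mem (show x ∈ openQuadrant ∩ K from ⟨hxQ, hxK⟩)]
      have h1 : a =ᶠ[𝓝 x] α := by
        filter_upwards [hη1 x hxK] with z hz
        simp [ha, hz]
      have h2 : b =ᶠ[𝓝 x] β := by
        filter_upwards [hη1 x hxK] with z hz
        simp [hb, hz]
      rw [h1.fderiv_eq, h2.fderiv_eq]
      exact fderiv_pullback (hφ.contDiffAt (hKW hxK).1) ((hG.contDiffAt (hD.mem_nhds
        (hWΩ (hKW hxK)).2)).differentiableAt (by simp))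
    · rw [Set.indicator_of_notMem fun h : x ∈ openQuadrant ∩ K => hxK h.2]
      have hev : ∀ᶠ z in 𝓝 x, a z = 0 ∧ b z = 0 := by
        filter_upwards [isOpen_openQuadrant.mem_nhds hxQ,
          hK.isClosed.isOpen_compl.mem_nhds hxK] with z hz hzK
        by_cases hzW : z ∈ W
        · have hz' : z ∈ W ∩ quadrant := ⟨hzW, openQuadrant_subset hz⟩
          rw [haW z hz', hbW z hz']
          simp [hα, hβ, hG0' z hz' hzK]
        · exact ⟨haW' z hzW, hbW' z hzW⟩
      have h1 : a =ᶠ[𝓝 x] fun _ => 0 := hev.mono fun z hz => hz.1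
      have h2 : b =ᶠ[𝓝 x] fun _ => 0 := hev.mono fun z hz => hz.2
      rw [h1.fderiv_eq, h2.fderiv_eq]
      simp
  have hgreen := green_quadrant has hbs hac hbc
  rw [setIntegral_eq_of_indicator isOpen_openQuadrant.measurableSet
    (isOpen_openQuadrant.measurableSet.inter hK.measurableSet) hdiv] at hgreen
  -- the surface integral
  have hcurl0 (p : E3) (hp : p ∈ S.carrier) (hpK : p ∉ φ '' K) :
      (inner ℝ (curlVec (fderiv ℝ G p)) (S.normal p) : ℝ) = 0 := by
    have : fderiv ℝ G p = 0 := by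
      have h : p ∉ tsupport (fderiv ℝ G) := fun h =>
        hpK (hGK ⟨hp, tsupport_fderiv_subset ℝ h⟩)
      exact image_eq_zero_of_notMem_tsupport h
    rw [this, curlVec_zero, inner_zero_left]
  have hKS (x : ℝ × ℝ) (hx : x ∈ K) : φ x ∈ S.carrier := hφ.mem_carrier (hKW hx)
  have hcurlc : ContinuousOn (fun x => curlVec (fderiv ℝ G (φ x))) K := by
    have h1 : ContinuousOn (fderiv ℝ G) D := hG.continuousOn_fderiv_of_isOpen hD (by simp)
    exact continuous_curlVec.comp_continuousOn (h1.comp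
      (hφ.continuousOn.mono (hKW.trans Set.inter_subset_left)) fun x hx => hSD (hKS x hx))
  have hnc : ContinuousOn (fun x => S.normal (φ x)) K := by
    have h1 : ContinuousOn (fun x => ‖cross (dFst φ x) (dSnd φ x)‖⁻¹ •
        cross (dFst φ x) (dSnd φ x)) K := by
      have h2 := hφ.continuousOn_cross.mono (hKW.trans Set.inter_subset_left)
      exact (h2.norm.inv₀ fun x hx => norm_ne_zero_iff.2 (hφ.immersion x (hKW hx))).smul h2
    exact h1.congr fun x hx => hφ.normal_eq (hKW hx)
  have hint1 := integrable_area_of_chart hφ hK hKW hcurl0 (hcurlc.inner hnc)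
  have hsurf : ∫ p, inner ℝ (curlVec (fderiv ℝ G p)) (S.normal p) ∂S.areaMeasure =
      ∫ x in openQuadrant ∩ K, γ x := by
    rw [integral_area_of_chart hφ hKW hcurl0]
    have : K =ᵐ[volume] (openQuadrant ∩ K : Set (ℝ × ℝ)) := by
      refine Filter.eventuallyEq_set.2 ?_
      filter_upwards [ae_mem_openQuadrant] with x hx
      exact ⟨fun h => ⟨hx (hKW h).2, h⟩, fun h => h.2⟩
    rw [← setIntegral_congr_set this]
    refine setIntegral_congr_fun hK.measurableSet fun x hx => ?_
    simp only [hγ]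
    conv_rhs => rw [hφ.oriented x (hKW hx)]
    rw [inner_smul_right, smul_eq_mul]
  -- the boundary integral
  have hlow (u : ℝ) : (Set.Ioi (0 : ℝ)).indicator (fun u => a (u, 0)) u =
      (edgeSet W).indicator (fun u => ‖dFst φ (u, 0)‖ •
        (inner ℝ (G (φ (u, 0))) (S.boundaryTangent (φ (u, 0))) : ℝ)) u := by
    by_cases hu : u ∈ edgeSet W
    · rw [Set.indicator_of_mem hu, Set.indicator_of_mem (show u ∈ Set.Ioi 0 from hu.1),
        norm_smul_inner_boundaryTangent hφ hu, haW _ (IsChart.edge_mem hu)]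
    · rw [Set.indicator_of_notMem hu]
      by_cases hu0 : 0 < u
      · rw [Set.indicator_of_mem (show u ∈ Set.Ioi 0 from hu0), haW' _ fun h => hu ⟨hu0, h⟩]
      · rw [Set.indicator_of_notMem (show u ∉ Set.Ioi 0 from hu0)]
  -- The minus sign is the induced orientation: the left edge is traversed downwards, because the
  -- first partial derivative of the rotated chart is `-∂₂φ`.
  have hrotW (s : ℝ) (hs : s ∈ edgeSet (rotDomain c W)) :
      ‖dFst (rotParam c φ) (s, 0)‖ • (inner ℝ (G (rotParam c φ (s, 0)))
        (S.boundaryTangent (rotParam c φ (s, 0))) : ℝ) = -b (0, c - s) := by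
    have hs' : (0, c - s) ∈ W := hs.2.1
    rw [norm_smul_inner_boundaryTangent hφ' hs,
      hφ.dFst_rotParam (x := (s, 0)) hs', inner_neg_right,
      hbW (0, c - s) ⟨hs', le_rfl, sub_nonneg.2 hs.2.2.2.le⟩]
    rfl
  -- With `v = c - s`, the half-line `v > 0` becomes `s < c`. The further condition `s > 0` in
  -- `rotDomain` is automatic where `b` can be nonzero, because `hc` gives `v < c` on `W`.
  have hleft (s : ℝ) : (Set.Iio c).indicator (fun s => -b (0, c - s)) s =
      (edgeSet (rotDomain c W)).indicator (fun s => ‖dFst (rotParam c φ) (s, 0)‖ •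
        (inner ℝ (G (rotParam c φ (s, 0))) (S.boundaryTangent (rotParam c φ (s, 0))) : ℝ)) s := by
    by_cases hs : s ∈ edgeSet (rotDomain c W)
    · rw [Set.indicator_of_mem hs, Set.indicator_of_mem (show s ∈ Set.Iio c from hs.2.2.2),
        hrotW s hs]
    · rw [Set.indicator_of_notMem hs]
      by_cases hsc : s < c
      · rw [Set.indicator_of_mem (show s ∈ Set.Iio c from hsc), hbW', neg_zero]
        intro h
        have := hc _ h
        dsimp only at this
        exact hs ⟨by linarith, h, by dsimp only; linarith, hsc⟩
      · rw [Set.indicator_of_notMem (show s ∉ Set.Iio c from hsc)]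
  have hE : MeasurableSet (edgeSet W) := hφ.isOpen_edgeSet.measurableSet
  have hE' : MeasurableSet (edgeSet (rotDomain c W)) := hφ'.isOpen_edgeSet.measurableSet
  have hba : Integrable fun v => b (0, v) :=
    (hbs.continuous.comp (by fun_prop : Continuous fun v : ℝ =>
      ((0 : ℝ), v))).integrable_of_hasCompactSupport (hasCompactSupport_snd_slice hbc 0)
  have hintE : Integrable (fun p => (inner ℝ (G p) (S.boundaryTangent p) : ℝ))
      (edgeMeasure W φ) := by
    rw [integrable_edgeMeasure hφ]
    refine integrable_restrict_eq measurableSet_Ioi hE ?_ hlow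
    exact ((has.continuous.comp (by fun_prop : Continuous fun u : ℝ =>
      (u, (0 : ℝ)))).integrable_of_hasCompactSupport
        (hasCompactSupport_fst_slice hac 0)).integrableOn
  have hintE' : Integrable (fun p => (inner ℝ (G p) (S.boundaryTangent p) : ℝ))
      (edgeMeasure (rotDomain c W) (rotParam c φ)) := by
    rw [integrable_edgeMeasure hφ']
    exact integrable_restrict_eq measurableSet_Iio hE' (hba.comp_sub_left c).neg.integrableOn hleft
  have hbd0 : ∀ p ∈ S.carrier \ (φ '' (W ∩ quadrant)),
      (inner ℝ (G p) (S.boundaryTangent p) : ℝ) = 0 := fun p hp => by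
    rw [hG0 p hp.1 fun h => hp.2 (Set.image_mono hKW h), inner_zero_left]
  have hint2 : Integrable (fun p => (inner ℝ (G p) (S.boundaryTangent p) : ℝ))
      S.boundaryMeasure := by
    rw [← S.boundaryMeasure_restrict_carrier]
    refine IntegrableOn.of_forall_sdiff_eq_zero (s := φ '' (W ∩ quadrant)) ?_
      S.isCompact.measurableSet hbd0
    rw [IntegrableOn, S.boundaryMeasure_restrict hφ hc]
    exact hintE.add_measure hintE'
  refine ⟨hint1, hint2, ?_⟩
  have hbd : ∫ p, inner ℝ (G p) (S.boundaryTangent p) ∂S.boundaryMeasure =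
      (∫ u in Set.Ioi (0 : ℝ), a (u, 0)) - ∫ v in Set.Ioi (0 : ℝ), b (0, v) := by
    rw [← S.boundaryMeasure_restrict_carrier, setIntegral_eq_of_subset_of_forall_sdiff_eq_zero
      S.isCompact.measurableSet (by rintro _ ⟨x, hx, rfl⟩; exact hφ.mem_carrier hx) hbd0,
      S.boundaryMeasure_restrict hφ hc, integral_add_measure hintE hintE',
      integral_edgeMeasure hφ, integral_edgeMeasure hφ',
      ← setIntegral_eq_of_indicator measurableSet_Ioi hE hlow,
      ← setIntegral_eq_of_indicator measurableSet_Iio hE' hleft, integral_neg, sub_eq_add_neg]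
    -- The reflection `s ↦ c - s` preserves Lebesgue measure and turns the rotated edge back into
    -- the left edge.
    congr 2
    rw [← integral_indicator measurableSet_Iio, ← integral_indicator measurableSet_Ioi,
      ← integral_sub_left_eq_self _ volume c]
    congr 1 with s
    simp [Set.indicator]
  rw [hbd, hsurf, hgreen]

/-- Rotation needs a bound for the second coordinate on the chart domain. Shrinking to a relatively
compact neighbourhood of `K` provides one. -/
theorem stokes_of_chart (hφ : IsChart S.carrier S.normal W φ)
    {K : Set (ℝ × ℝ)} (hK : IsCompact K) (hKW : K ⊆ W ∩ quadrant)
    {D : Set E3} (hD : IsOpen D) (hSD : S.carrier ⊆ D) {G : E3 → E3} (hG : ContDiffOn ℝ ∞ G D)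
    (hGK : S.carrier ∩ tsupport G ⊆ φ '' K) :
    Integrable (fun p => (inner ℝ (curlVec (fderiv ℝ G p)) (S.normal p) : ℝ)) S.areaMeasure ∧
    Integrable (fun p => (inner ℝ (G p) (S.boundaryTangent p) : ℝ)) S.boundaryMeasure ∧
    ∫ p, inner ℝ (curlVec (fderiv ℝ G p)) (S.normal p) ∂S.areaMeasure =
      ∫ p, inner ℝ (G p) (S.boundaryTangent p) ∂S.boundaryMeasure := by
  obtain ⟨V, hV, hKV, hVW, hVc⟩ := exists_open_between_and_isCompact_closure hK hφ.isOpen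
    (hKW.trans Set.inter_subset_left)
  obtain ⟨c, hc⟩ := (hVc.image continuous_snd).bddAbove
  exact stokes_of_bounded_chart (hφ.mono hV (subset_closure.trans hVW)) (c := c + 1)
    (fun x hx => (hc ⟨x, subset_closure hx, rfl⟩).trans_lt (lt_add_one c)) hK
    (fun x hx => ⟨hKV hx, (hKW hx).2⟩) hD hSD hG hGK

end OrientedSurface

/-! ### Smooth dependence of integrals on parameters -/

/-- An integral over a compact set depends smoothly on parameters. -/
theorem contDiffAt_integral_compact {Y X F : Type*} [NormedAddCommGroup Y] [NormedSpace ℝ Y]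
    [NormedAddCommGroup X] [NormedSpace ℝ X] [FiniteDimensional ℝ X] [MeasurableSpace X]
    [BorelSpace X] {μ : Measure X} [IsFiniteMeasureOnCompacts μ]
    [NormedAddCommGroup F] [NormedSpace ℝ F] {f : Y × X → F} {K : Set X} (hK : IsCompact K) {y₀ : Y}
    (hf : ∀ x ∈ K, ContDiffAt ℝ ∞ f (y₀, x)) :
    ContDiffAt ℝ ∞ (fun y => ∫ x in K, f (y, x) ∂μ) y₀ := by
  have : ProperSpace X := FiniteDimensional.proper ℝ X
  rw [contDiffAt_infty]
  -- The argument is carried out at each finite order, where being `C^n` at a point is an open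
  -- condition. The tube lemma then yields a product neighbourhood of `{y₀} × K`.
  intro n
  obtain ⟨T, N, hT, hN, hTy, hKN, hTN⟩ : ∃ (T : Set Y) (N : Set X), IsOpen T ∧ IsOpen N ∧ y₀ ∈ T ∧
      K ⊆ N ∧ T ×ˢ N ⊆ {z | ContDiffAt ℝ n f z} := by
    have h1 : ({y₀} : Set Y) ×ˢ K ⊆ interior {z | ContDiffAt ℝ n f z} := by
      rintro ⟨y, x⟩ ⟨rfl, hx⟩
      rw [mem_interior_iff_mem_nhds]
      exact ((hf x hx).of_le (by exact_mod_cast le_top)).eventually (by simp)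
    obtain ⟨T, N, hT, hN, hyT, hKN, h⟩ :=
      generalized_tube_lemma isCompact_singleton hK isOpen_interior h1
    exact ⟨T, N, hT, hN, hyT rfl, hKN, h.trans interior_subset⟩
  obtain ⟨η, L, hη, hL, hLN, hη0, hη1⟩ := exists_cutoff hK hN hKN
  -- The integral is the convolution of the indicator of `K` with `g y`, evaluated at `0`. There the
  -- second factor is taken at `-x`, which accounts for the signs; the cutoff supplies the compact
  -- support required in the second variable.
  set g : Y → X → F := fun y x => η (-x) • f (y, -x) with hg
  have hgs : ContDiffOn ℝ n (fun z : Y × X => g z.1 z.2) (T ×ˢ Set.univ) := by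
    rintro ⟨y, x⟩ ⟨hy, -⟩
    apply ContDiffAt.contDiffWithinAt
    by_cases hx : -x ∈ N
    · have h1 : ContDiffAt ℝ n f (y, -x) := hTN ⟨hy, hx⟩
      have h2 : ContDiffAt ℝ n (fun z : Y × X => (z.1, -z.2)) (y, x) :=
        (contDiff_fst.prodMk contDiff_snd.neg).contDiffAt
      have h3 : ContDiffAt ℝ n (fun z : Y × X => η (-z.2)) (y, x) :=
        ((hη.of_le (by exact_mod_cast le_top)).comp contDiff_snd.neg).contDiffAt
      exact h3.smul (ContDiffAt.comp (y, x) (g := f) h1 h2)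
    · have h4 : (fun z : Y × X => g z.1 z.2) =ᶠ[𝓝 (y, x)] fun _ => 0 := by
        have hc : Continuous fun z : Y × X => -z.2 := by fun_prop
        filter_upwards [(hL.isClosed.isOpen_compl.preimage hc).mem_nhds
          fun h => hx (hLN h)] with z hz
        simp [hg, hη0 _ hz]
      exact contDiffAt_const.congr_of_eventuallyEq h4
  have hconv := contDiffOn_convolution_right_with_param (n := n) (μ := μ)
    (f := K.indicator fun _ => (1 : ℝ)) (k := -L)
    (ContinuousLinearMap.lsmul ℝ ℝ) (g := g) hT hL.neg
    (fun y x _ hx => by simp [hg, hη0 (-x) hx])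
    ((locallyIntegrable_const 1).indicator hK.measurableSet) hgs
  have h0 : ContDiffAt ℝ n (fun y => (MeasureTheory.convolution (K.indicator fun _ => (1 : ℝ)) (g y)
      (ContinuousLinearMap.lsmul ℝ ℝ) μ) 0) y₀ :=
    ((hconv.contDiffAt ((hT.prod isOpen_univ).mem_nhds ⟨hTy, trivial⟩)).comp (f := fun y => (y, (0 : X)))
      y₀ (contDiffAt_id.prodMk contDiffAt_const) :)
  refine h0.congr_of_eventuallyEq (Filter.Eventually.of_forall fun y => ?_)
  change ∫ x in K, f (y, x) ∂μ = ∫ x, _ ∂μ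
  rw [← integral_indicator hK.measurableSet]
  congr 1 with x
  by_cases hx : x ∈ K
  · simp [hg, hx, (hη1 x hx).self_of_nhds]
  · simp [hx]

/-! ### Local partitions of a family of surfaces -/

/-- Near `y` the fibrewise partial derivatives are values of the full derivative of `Φ` on vectors
`(0, e)`, and so depend smoothly on `t` as well. -/
theorem contDiffAt_dFst_family {k : ℕ} {Φ : EuclideanSpace ℝ (Fin k) × (ℝ × ℝ) → E3}
    {y : EuclideanSpace ℝ (Fin k) × (ℝ × ℝ)} (h : ContDiffAt ℝ ∞ Φ y) :
    ContDiffAt ℝ ∞ (fun y => dFst (fun x => Φ (y.1, x)) y.2) y ∧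
      ContDiffAt ℝ ∞ (fun y => dSnd (fun x => Φ (y.1, x)) y.2) y := by
  have h1 : ∀ᶠ z in 𝓝 y, DifferentiableAt ℝ Φ z :=
    ((h.of_le (m := (1 : ℕ)) (by exact_mod_cast le_top)).eventually (by simp)).mono
      fun z hz => hz.differentiableAt (by simp)
  have h2 (e : EuclideanSpace ℝ (Fin k) × (ℝ × ℝ)) : ContDiffAt ℝ ∞ (fun z => fderiv ℝ Φ z e) y :=
    (h.fderiv_right (m := ∞) (by simp)).clm_apply contDiffAt_const
  have h3 (e : ℝ × ℝ) : (fun y : EuclideanSpace ℝ (Fin k) × (ℝ × ℝ) =>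
      fderiv ℝ (fun x => Φ (y.1, x)) y.2 e) =ᶠ[𝓝 y] fun z => fderiv ℝ Φ z (0, e) := by
    filter_upwards [h1] with z hz
    have h4 : HasFDerivAt (fun x : ℝ × ℝ => (z.1, x))
        (ContinuousLinearMap.inr ℝ (EuclideanSpace ℝ (Fin k)) (ℝ × ℝ)) z.2 :=
      hasFDerivAt_prodMk_right z.1 z.2
    have h5 : HasFDerivAt Φ (fderiv ℝ Φ z) (z.1, z.2) := hz.hasFDerivAt
    have h6 : HasFDerivAt (fun x => Φ (z.1, x)) _ z.2 := h5.comp z.2 h4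
    rw [h6.fderiv]
    simp
  exact ⟨(h2 _).congr_of_eventuallyEq (h3 _), (h2 _).congr_of_eventuallyEq (h3 _)⟩

/-- A finite system of family charts near `t₀`, together with smooth functions which form a
partition of unity on the surfaces `S t`, `t` near `t₀`. -/
structure FamilyPartition {k : ℕ} (P : Set (EuclideanSpace ℝ (Fin k)))
    (S : EuclideanSpace ℝ (Fin k) → OrientedSurface) (t₀ : EuclideanSpace ℝ (Fin k)) where
  κ : Type
  [fintype : Fintype κ]
  W : κ → Set (EuclideanSpace ℝ (Fin k) × (ℝ × ℝ))
  Φ : κ → EuclideanSpace ℝ (Fin k) × (ℝ × ℝ) → E3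
  K : κ → Set (ℝ × ℝ)
  ρ : κ → E3 → ℝ
  chart : ∀ j, IsFamilyChart P S (W j) (Φ j)
  isCompact : ∀ j, IsCompact (K j)
  subset : ∀ j, K j ⊆ quadrant
  smooth : ∀ j, ContDiff ℝ ∞ (ρ j)
  eventually_mem : ∀ᶠ t in 𝓝 t₀, t ∈ P ∧ ∀ j, ∀ x ∈ K j, (t, x) ∈ W j
  eventually_supp : ∀ᶠ t in 𝓝 t₀, ∀ j,
    (S t).carrier ∩ tsupport (ρ j) ⊆ (fun x => Φ j (t, x)) '' K j
  eventually_sum : ∀ᶠ t in 𝓝 t₀, ∀ p ∈ (S t).carrier, ∀ᶠ q in 𝓝 p, ∑ j, ρ j q = 1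

attribute [instance] FamilyPartition.fintype

/-- Openness of the chart in the total space, not only in each fibre, lets one compact set `K` serve
all `t` near `t₀`: the image of a small box contains a neighbourhood of `(t₀, p)` in the total
space. -/
theorem IsSmoothFamily.exists_local {k : ℕ} {P : Set (EuclideanSpace ℝ (Fin k))}
    {S : EuclideanSpace ℝ (Fin k) → OrientedSurface}
    (hS : IsSmoothFamily P S) {t₀ : EuclideanSpace ℝ (Fin k)} (ht₀ : t₀ ∈ P) {p : E3}
    (hp : p ∈ (S t₀).carrier) :
    ∃ (W : Set (EuclideanSpace ℝ (Fin k) × (ℝ × ℝ)))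
      (Φ : EuclideanSpace ℝ (Fin k) × (ℝ × ℝ) → E3) (K : Set (ℝ × ℝ)) (N : Set E3),
      IsFamilyChart P S W Φ ∧ IsCompact K ∧ K ⊆ quadrant ∧ IsOpen N ∧ p ∈ N ∧
      (∀ᶠ t in 𝓝 t₀, ∀ x ∈ K, (t, x) ∈ W) ∧
      ∀ᶠ t in 𝓝 t₀, (S t).carrier ∩ N ⊆ (fun x => Φ (t, x)) '' K := by
  obtain ⟨W, Φ, hΦ, x, hxQ, hxW, hxp⟩ := hS.exists_chart (t₀, p) ⟨ht₀, hp⟩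
  dsimp only at hxW hxp
  obtain ⟨T, hT, X, hX, hTX⟩ := mem_nhds_prod_iff.1 (hΦ.isOpen.mem_nhds hxW)
  obtain ⟨T', hT'T, hT', htT'⟩ := mem_nhds_iff.1 hT
  obtain ⟨ε, hε, hεX⟩ := Metric.nhds_basis_closedBall.mem_iff.1 hX
  obtain ⟨G, hG, hGΦ⟩ := hΦ.relOpen (T' ×ˢ Metric.ball x ε) (hT'.prod Metric.isOpen_ball)
    (fun y hy => hTX ⟨hT'T hy.1, hεX (Metric.ball_subset_closedBall hy.2)⟩)
  have hpG : (t₀, p) ∈ G := by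
    have : (t₀, p) ∈ totalSpace P S ∩ G := by
      rw [← hGΦ]
      exact ⟨(t₀, x), ⟨⟨htT', Metric.mem_ball_self hε⟩, hxQ⟩, Prod.ext rfl hxp⟩
    exact this.2
  obtain ⟨A, hA, N, hN, hAN⟩ := mem_nhds_prod_iff.1 (hG.mem_nhds hpG)
  obtain ⟨N', hN'N, hN', hpN'⟩ := mem_nhds_iff.1 hN
  have hP : ∀ᶠ t in 𝓝 t₀, t ∈ P := by
    filter_upwards [hT] with t ht
    exact hΦ.base (t, x) (hTX ⟨ht, mem_of_mem_nhds hX⟩)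
  refine ⟨W, Φ, Metric.closedBall x ε ∩ quadrant, N', hΦ,
    (isCompact_closedBall x ε).inter_right isClosed_quadrant, Set.inter_subset_right, hN', hpN',
    ?_, ?_⟩
  · filter_upwards [hT] with t ht y hy
    exact hTX ⟨ht, hεX hy.1⟩
  · filter_upwards [hA, hP] with t ht htP
    rintro q ⟨hqS, hqN⟩
    have : (t, q) ∈ totalSpace P S ∩ G := ⟨⟨htP, hqS⟩, hAN ⟨ht, hN'N hqN⟩⟩
    rw [← hGΦ] at this
    obtain ⟨⟨t', y⟩, ⟨⟨-, hy⟩, hyQ⟩, hty⟩ := this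
    simp only [Prod.mk.injEq] at hty
    obtain ⟨rfl, rfl⟩ := hty
    exact ⟨y, ⟨Metric.ball_subset_closedBall hy, hyQ⟩, rfl⟩

/-- The partition lives in ambient space and does not depend on `t`. It sums to one on a closed
thickening of `S t₀`, and properness keeps the nearby `S t` inside the open thickening, so the sum
is one on a neighbourhood of each of their points. -/
theorem IsSmoothFamily.nonempty_partition {k : ℕ} {P : Set (EuclideanSpace ℝ (Fin k))}
    (hP : IsOpen P) {S : EuclideanSpace ℝ (Fin k) → OrientedSurface}
    (hS : IsSmoothFamily P S) {t₀ : EuclideanSpace ℝ (Fin k)} (ht₀ : t₀ ∈ P) :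
    Nonempty (FamilyPartition P S t₀) := by
  have hloc := fun p : (S t₀).carrier => hS.exists_local ht₀ p.2
  choose W Φ K N hΦ hK hKQ hN hpN hW hsupp using hloc
  obtain ⟨s, hs⟩ := (S t₀).isCompact.elim_finite_subcover N hN fun p hp =>
    Set.mem_iUnion.2 ⟨⟨p, hp⟩, hpN ⟨p, hp⟩⟩
  obtain ⟨δ, hδ, hδN⟩ := (S t₀).isCompact.exists_cthickening_subset_open
    (isOpen_biUnion fun i (_ : i ∈ s) => hN i) hs
  obtain ⟨f, hf⟩ := SmoothPartitionOfUnity.exists_isSubordinate 𝓘(ℝ, E3)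
    (Metric.isClosed_cthickening (δ := δ) (E := (S t₀).carrier)) (fun j : s => N j)
    (fun j => hN j) (hδN.trans (by
      intro q hq
      simp only [Set.mem_iUnion] at hq ⊢
      obtain ⟨i, hi, hqi⟩ := hq
      exact ⟨⟨i, hi⟩, hqi⟩))
  have hprop := hS.proper t₀ ht₀ (Metric.thickening δ (S t₀).carrier) Metric.isOpen_thickening
    (Metric.self_subset_thickening hδ _)
  rw [hP.nhdsWithin_eq ht₀] at hprop
  refine ⟨⟨s, fun j => W j, fun j => Φ j, fun j => K j, fun j => f j, fun j => hΦ j, fun j => hK j,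
    fun j => hKQ j, fun j => (f j).contMDiff.contDiff, ?_, ?_, ?_⟩⟩
  · exact Filter.Eventually.and (hP.mem_nhds ht₀) (Filter.eventually_all.2 fun j => hW j)
  · refine Filter.eventually_all.2 fun j => ?_
    filter_upwards [hsupp j] with t ht
    exact (Set.inter_subset_inter_right _ (hf j)).trans ht
  · filter_upwards [hprop] with t ht p hp
    filter_upwards [Metric.isOpen_thickening.mem_nhds (ht hp)] with q hq
    rw [← finsum_eq_sum_of_fintype]
    exact f.sum_eq_one (Metric.thickening_subset_cthickening _ _ hq)

theorem IsChart.continuousOn_normal {S : Set E3} {n : E3 → E3} {W : Set (ℝ × ℝ)}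
    {φ : ℝ × ℝ → E3} (h : IsChart S n W φ) :
    ContinuousOn (fun x => n (φ x)) (W ∩ quadrant) := by
  have h2 := h.continuousOn_cross.mono (Set.inter_subset_left (t := quadrant))
  have h1 : ContinuousOn (fun x => ‖cross (dFst φ x) (dSnd φ x)‖⁻¹ •
      cross (dFst φ x) (dSnd φ x)) (W ∩ quadrant) :=
    (h2.norm.inv₀ fun x hx => norm_ne_zero_iff.2 (h.immersion x hx)).smul h2
  exact h1.congr fun x hx => h.normal_eq hx

/-! ### Surface integrals and Stokes' theorem by partition of unity. -/

namespace FamilyPartition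

variable {k : ℕ} {P : Set (EuclideanSpace ℝ (Fin k))}
  {S : EuclideanSpace ℝ (Fin k) → OrientedSurface} {t₀ : EuclideanSpace ℝ (Fin k)}

/-- The parameters at which the partition is adapted to the surface. -/
structure Adapted (A : FamilyPartition P S t₀) (t : EuclideanSpace ℝ (Fin k)) : Prop where
  mem : t ∈ P
  mem_W : ∀ j, ∀ x ∈ A.K j, (t, x) ∈ A.W j
  supp : ∀ j, (S t).carrier ∩ tsupport (A.ρ j) ⊆ (fun x => A.Φ j (t, x)) '' A.K j
  sum : ∀ p ∈ (S t).carrier, ∀ᶠ q in 𝓝 p, ∑ j, A.ρ j q = 1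

theorem eventually_adapted (A : FamilyPartition P S t₀) : ∀ᶠ t in 𝓝 t₀, A.Adapted t := by
  filter_upwards [A.eventually_mem, A.eventually_supp, A.eventually_sum] with t h1 h2 h3
  exact ⟨h1.1, h1.2, h2, h3⟩

theorem adapted_self (A : FamilyPartition P S t₀) : A.Adapted t₀ := A.eventually_adapted.self_of_nhds

/-- The density of the part of the area measure belonging to a chart. -/
noncomputable def dens (A : FamilyPartition P S t₀) (j : A.κ)
    (y : EuclideanSpace ℝ (Fin k) × (ℝ × ℝ)) : ℝ :=
  ‖cross (dFst (fun x => A.Φ j (y.1, x)) y.2) (dSnd (fun x => A.Φ j (y.1, x)) y.2)‖ *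
    A.ρ j (A.Φ j y)

/-- The unit normal in a chart. -/
noncomputable def nrm (A : FamilyPartition P S t₀) (j : A.κ)
    (y : EuclideanSpace ℝ (Fin k) × (ℝ × ℝ)) : E3 :=
  ‖cross (dFst (fun x => A.Φ j (y.1, x)) y.2) (dSnd (fun x => A.Φ j (y.1, x)) y.2)‖⁻¹ •
    cross (dFst (fun x => A.Φ j (y.1, x)) y.2) (dSnd (fun x => A.Φ j (y.1, x)) y.2)

namespace Adapted

variable {A : FamilyPartition P S t₀} {t : EuclideanSpace ℝ (Fin k)}

theorem isChart (h : A.Adapted t) (j : A.κ) :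
    IsChart (S t).carrier (S t).normal {x | (t, x) ∈ A.W j} fun x => A.Φ j (t, x) :=
  (A.chart j).fibre t h.mem

theorem subset (h : A.Adapted t) (j : A.κ) : A.K j ⊆ {x | (t, x) ∈ A.W j} ∩ quadrant :=
  fun x hx => ⟨h.mem_W j x hx, A.subset j hx⟩

theorem contDiffAt_param (h : A.Adapted t) (j : A.κ) {x : ℝ × ℝ} (hx : x ∈ A.K j) :
    ContDiffAt ℝ ∞ (A.Φ j) (t, x) :=
  (A.chart j).smooth.contDiffAt ((A.chart j).isOpen.mem_nhds (h.mem_W j x hx))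

theorem contDiffAt_cross (h : A.Adapted t) (j : A.κ) {x : ℝ × ℝ} (hx : x ∈ A.K j) :
    ContDiffAt ℝ ∞ (fun y : EuclideanSpace ℝ (Fin k) × (ℝ × ℝ) =>
      cross (dFst (fun x => A.Φ j (y.1, x)) y.2) (dSnd (fun x => A.Φ j (y.1, x)) y.2)) (t, x) := by
  obtain ⟨h1, h2⟩ := contDiffAt_dFst_family (h.contDiffAt_param j hx)
  exact contDiff_cross.contDiffAt.comp (t, x) (h1.prodMk h2)

theorem contDiffAt_dens (h : A.Adapted t) (j : A.κ) {x : ℝ × ℝ} (hx : x ∈ A.K j) :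
    ContDiffAt ℝ ∞ (A.dens j) (t, x) :=
  ((h.contDiffAt_cross j hx).norm ℝ ((h.isChart j).immersion x (h.subset j hx))).mul
    ((A.smooth j).contDiffAt.comp (t, x) (h.contDiffAt_param j hx))

theorem contDiffAt_nrm (h : A.Adapted t) (j : A.κ) {x : ℝ × ℝ} (hx : x ∈ A.K j) :
    ContDiffAt ℝ ∞ (A.nrm j) (t, x) :=
  (((h.contDiffAt_cross j hx).norm ℝ ((h.isChart j).immersion x (h.subset j hx))).inv
    (norm_ne_zero_iff.2 ((h.isChart j).immersion x (h.subset j hx)))).smul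
    (h.contDiffAt_cross j hx)

theorem nrm_eq (h : A.Adapted t) (j : A.κ) {x : ℝ × ℝ} (hx : x ∈ A.K j) :
    A.nrm j (t, x) = (S t).normal (A.Φ j (t, x)) :=
  ((h.isChart j).normal_eq (h.subset j hx)).symm

theorem mem_carrier (h : A.Adapted t) (j : A.κ) {x : ℝ × ℝ} (hx : x ∈ A.K j) :
    A.Φ j (t, x) ∈ (S t).carrier :=
  (h.isChart j).mem_carrier (h.subset j hx)

theorem exists_param (h : A.Adapted t) {p : E3} (hp : p ∈ (S t).carrier) :
    ∃ j, ∃ x ∈ A.K j, A.Φ j (t, x) = p := by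
  have h1 := (h.sum p hp).self_of_nhds
  obtain ⟨j, -, hj⟩ := Finset.exists_ne_zero_of_sum_ne_zero (by rw [h1]; exact one_ne_zero)
  exact ⟨j, h.supp j ⟨hp, subset_tsupport _ hj⟩⟩

/-- This makes surface integrals accessible to parameter dependence: the sets `A.K j` are
independent of `t`, and all dependence is in the integrands. -/
theorem integral_area (h : A.Adapted t) {F : Type*} [NormedAddCommGroup F] [NormedSpace ℝ F]
    {f : E3 → F} (hf : ∀ j, ContinuousOn (fun x => f (A.Φ j (t, x))) (A.K j)) :
    Integrable f (S t).areaMeasure ∧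
      ∫ p, f p ∂(S t).areaMeasure =
        ∑ j, ∫ x in A.K j, A.dens j (t, x) • f (A.Φ j (t, x)) := by
  have h0 (j : A.κ) (p : E3) (hp : p ∈ (S t).carrier)
      (hpK : p ∉ (fun x => A.Φ j (t, x)) '' A.K j) : A.ρ j p • f p = 0 := by
    rw [image_eq_zero_of_notMem_tsupport fun h' => hpK (h.supp j ⟨hp, h'⟩), zero_smul]
  have hint (j : A.κ) : Integrable (fun p => A.ρ j p • f p) (S t).areaMeasure := by
    refine OrientedSurface.integrable_area_of_chart (h.isChart j) (A.isCompact j) (h.subset j)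
      (h0 j) (ContinuousOn.smul ?_ (hf j))
    exact (A.smooth j).continuous.comp_continuousOn
      ((h.isChart j).continuousOn.mono ((h.subset j).trans Set.inter_subset_left))
  have hsum : Set.EqOn (fun p => ∑ j, A.ρ j p • f p) f (S t).carrier := fun p hp => by
    dsimp only
    rw [← Finset.sum_smul, (h.sum p hp).self_of_nhds, one_smul]
  have hm := (S t).isCompact.measurableSet
  constructor
  · rw [← (S t).areaMeasure_restrict_carrier]
    exact (integrable_finsetSum _ fun j _ => hint j).integrableOn.congr_fun hsum hm
  · rw [← (S t).areaMeasure_restrict_carrier, ← setIntegral_congr_fun hm hsum,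
      (S t).areaMeasure_restrict_carrier, integral_finsetSum _ fun j _ => hint j]
    refine Finset.sum_congr rfl fun j _ => ?_
    rw [OrientedSurface.integral_area_of_chart (h.isChart j) (h.subset j) (h0 j)]
    refine setIntegral_congr_fun (A.isCompact j).measurableSet fun x _ => ?_
    simp only [dens, smul_smul]

theorem isFiniteMeasure (h : A.Adapted t) : IsFiniteMeasure (S t).areaMeasure := by
  have := (h.integral_area (f := fun _ => (1 : ℝ)) fun j => continuousOn_const).1
  rwa [integrable_const_iff_isFiniteMeasure one_ne_zero] at this

/-- Stokes' theorem. -/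
theorem stokes (h : A.Adapted t) {D : Set E3} (hD : IsOpen D) (hSD : (S t).carrier ⊆ D)
    {G : E3 → E3} (hG : ContDiffOn ℝ ∞ G D) :
    Integrable (fun p => (inner ℝ (G p) ((S t).boundaryTangent p) : ℝ)) (S t).boundaryMeasure ∧
    ∫ p, inner ℝ (curlVec (fderiv ℝ G p)) ((S t).normal p) ∂(S t).areaMeasure =
      ∫ p, inner ℝ (G p) ((S t).boundaryTangent p) ∂(S t).boundaryMeasure := by
  have key (j : A.κ) := OrientedSurface.stokes_of_chart (h.isChart j) (A.isCompact j) (h.subset j)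
    hD hSD (G := fun p => A.ρ j p • G p) ((A.smooth j).contDiffOn.smul hG)
    ((Set.inter_subset_inter_right _ (tsupport_smul_subset_left _ _)).trans (h.supp j))
  have hm := (S t).isCompact.measurableSet
  have hGd (p : E3) (hp : p ∈ (S t).carrier) : DifferentiableAt ℝ G p :=
    (hG.contDiffAt (hD.mem_nhds (hSD hp))).differentiableAt (by simp)
  -- Here it matters that the partition sums to one near `p`, not only at `p`: the terms from
  -- derivatives of the `ρ j` cancel.
  have hsum1 : Set.EqOn (fun p => ∑ j, (inner ℝ (curlVec (fderiv ℝ (fun p => A.ρ j p • G p) p))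
      ((S t).normal p) : ℝ)) (fun p => inner ℝ (curlVec (fderiv ℝ G p)) ((S t).normal p))
      (S t).carrier := fun p hp => by
    dsimp only
    rw [← sum_inner, ← curlVec_sum, ← fderiv_fun_sum]
    · have : (fun p => ∑ j, A.ρ j p • G p) =ᶠ[𝓝 p] G := by
        filter_upwards [h.sum p hp] with q hq
        rw [← Finset.sum_smul, hq, one_smul]
      rw [this.fderiv_eq]
    · intro j _
      exact ((A.smooth j).differentiable (by simp) p).smul (hGd p hp)
  have hsum2 : Set.EqOn (fun p => ∑ j, (inner ℝ (A.ρ j p • G p) ((S t).boundaryTangent p) : ℝ))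
      (fun p => inner ℝ (G p) ((S t).boundaryTangent p)) (S t).carrier := fun p hp => by
    dsimp only
    rw [← sum_inner, ← Finset.sum_smul, (h.sum p hp).self_of_nhds, one_smul]
  constructor
  · rw [← (S t).boundaryMeasure_restrict_carrier]
    exact (integrable_finsetSum _ fun j _ => (key j).2.1).integrableOn.congr_fun hsum2 hm
  · rw [← (S t).areaMeasure_restrict_carrier, ← setIntegral_congr_fun hm hsum1,
      (S t).areaMeasure_restrict_carrier, integral_finsetSum _ fun j _ => (key j).1,
      ← (S t).boundaryMeasure_restrict_carrier, ← setIntegral_congr_fun hm hsum2,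
      (S t).boundaryMeasure_restrict_carrier, integral_finsetSum _ fun j _ => (key j).2.1]
    exact Finset.sum_congr rfl fun j _ => (key j).2.2

end Adapted

end FamilyPartition

/-! ### The Coulomb field -/

theorem contDiffAt_coulomb {x : E3} (hx : x ≠ 0) : ContDiffAt ℝ ∞ OrientedSurface.coulomb x :=
  (((contDiffAt_norm ℝ hx).pow 3).inv (pow_ne_zero 3 (norm_ne_zero_iff.2 hx))).smul contDiffAt_id

/-- The derivative of the Coulomb field. -/
noncomputable def coulombDeriv (x v : E3) : E3 :=
  (‖x‖ ^ 3)⁻¹ • v - (3 * inner ℝ x v / ‖x‖ ^ 5) • x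

/-- Compare the chain rule for the square of the norm with the known derivative of the squared norm.
-/
theorem fderiv_norm_apply {x : E3} (hx : x ≠ 0) (v : E3) :
    fderiv ℝ (fun y : E3 => ‖y‖) x v = inner ℝ x v / ‖x‖ := by
  have h1 : HasFDerivAt (fun y : E3 => ‖y‖) (fderiv ℝ (fun y : E3 => ‖y‖) x) x :=
    ((contDiffAt_norm ℝ hx (n := 1)).differentiableAt one_ne_zero).hasFDerivAt
  have h2 := (h1.pow 2).unique (hasStrictFDerivAt_norm_sq x).hasFDerivAt
  have h3 := DFunLike.congr_fun h2 v
  simp at h3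
  rw [eq_div_iff (norm_ne_zero_iff.2 hx)]
  linarith

theorem fderiv_coulomb_apply {x : E3} (hx : x ≠ 0) (v : E3) :
    fderiv ℝ OrientedSurface.coulomb x v = coulombDeriv x v := by
  have hx' : ‖x‖ ≠ 0 := norm_ne_zero_iff.2 hx
  have h1 : HasFDerivAt (fun y : E3 => ‖y‖) (fderiv ℝ (fun y : E3 => ‖y‖) x) x :=
    ((contDiffAt_norm ℝ hx (n := 1)).differentiableAt one_ne_zero).hasFDerivAt
  have h2 : HasDerivAt (fun s : ℝ => (s ^ 3)⁻¹) (-(3 * ‖x‖ ^ 2) / (‖x‖ ^ 3) ^ 2) ‖x‖ := by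
    simpa using (hasDerivAt_pow 3 ‖x‖).fun_inv (pow_ne_zero 3 hx')
  have h3 : HasFDerivAt OrientedSurface.coulomb _ x :=
    (h2.comp_hasFDerivAt x h1).smul (hasFDerivAt_id x)
  rw [h3.fderiv]
  simp only [add_apply, smul_apply,
    ContinuousLinearMap.smulRight_apply, fderiv_norm_apply hx, coulombDeriv]
  simp only [id_eq, ContinuousLinearMap.coe_id', smul_eq_mul, Function.comp_apply]
  rw [sub_eq_add_neg, ← neg_smul]
  congr 2
  field_simp

/-- The constant is `1 + 3`, one summand for each term, with Cauchy-Schwarz in the second. -/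
theorem norm_coulombDeriv_le (x v : E3) : ‖coulombDeriv x v‖ ≤ 4 * (‖x‖ ^ 3)⁻¹ * ‖v‖ := by
  by_cases hx : x = 0
  · simp [hx, coulombDeriv]
  have hx' : 0 < ‖x‖ := norm_pos_iff.2 hx
  have h1 : ‖(‖x‖ ^ 3)⁻¹ • v‖ = (‖x‖ ^ 3)⁻¹ * ‖v‖ := by
    rw [norm_smul, Real.norm_of_nonneg (by positivity)]
  have h2 : ‖(3 * inner ℝ x v / ‖x‖ ^ 5) • x‖ ≤ 3 * (‖x‖ ^ 3)⁻¹ * ‖v‖ := by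
    rw [norm_smul, norm_div, norm_mul, norm_pow, norm_norm, Real.norm_of_nonneg zero_le_three]
    calc
      _ ≤ 3 * (‖x‖ * ‖v‖) / ‖x‖ ^ 5 * ‖x‖ := by
        gcongr
        exact norm_inner_le_norm x v
      _ = _ := by field_simp
  calc
    _ ≤ _ := norm_sub_le _ _
    _ ≤ _ := by rw [h1]; linarith

/-- For constant `e`, the curl of `F × e` is the derivative of `F` along `e` minus `e` times the
divergence of `F`. The Coulomb field has zero divergence and a symmetric derivative, so `e` and `n`
may be interchanged. -/
theorem inner_curlVec_coulomb {r p : E3} (hp : r ≠ p) (e n : E3) :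
    (inner ℝ (curlVec (fderiv ℝ (fun q => cross (OrientedSurface.coulomb (r - q)) e) p)) n : ℝ) =
      inner ℝ e ((3 * inner ℝ (r - p) n / ‖r - p‖ ^ 5) • (r - p) - (‖r - p‖ ^ 3)⁻¹ • n) := by
  have hx : r - p ≠ 0 := sub_ne_zero.2 hp
  have hx' : ‖r - p‖ ≠ 0 := norm_ne_zero_iff.2 hx
  set l : E3 →L[ℝ] E3 := LinearMap.toContinuousLinearMap
    { toFun := fun a => cross a e
      map_add' := fun a b => by
        apply E3.ext_coord <;> simp [cross_zero_coord, cross_one_coord, cross_two_coord] <;> ring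
      map_smul' := fun c a => by
        apply E3.ext_coord <;> simp [cross_zero_coord, cross_one_coord, cross_two_coord] <;> ring }
    with hl
  have h1 : HasFDerivAt (fun q => l (OrientedSurface.coulomb (r - q))) _ p :=
    l.hasFDerivAt.comp p ((((contDiffAt_coulomb hx).differentiableAt (by simp)).hasFDerivAt).comp p
      ((hasFDerivAt_id p).const_sub r))
  have h2 (v : E3) : fderiv ℝ (fun q => cross (OrientedSurface.coulomb (r - q)) e) p v =
      cross (-coulombDeriv (r - p) v) e := by
    have : (fun q => cross (OrientedSurface.coulomb (r - q)) e) =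
      fun q => l (OrientedSurface.coulomb (r - q)) := rfl
    rw [this, h1.fderiv]
    simp only [ContinuousLinearMap.comp_apply, neg_apply,
      ContinuousLinearMap.coe_id', id_eq]
    rw [map_neg (fderiv ℝ OrientedSurface.coulomb (r - p)), fderiv_coulomb_apply hx]
    rfl
  set x := r - p
  -- With this common power of the norm, the claim becomes polynomial in the coordinates and `(‖x‖ ^
  -- 5)⁻¹`.
  have h3 : (‖x‖ ^ 3)⁻¹ = (‖x‖ ^ 5)⁻¹ * (x 0 * x 0 + x 1 * x 1 + x 2 * x 2) := by
    rw [← E3.inner_eq, real_inner_self_eq_norm_sq]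
    field_simp
  rw [E3.inner_eq, E3.inner_eq e]
  simp only [curlVec, h2, coulombDeriv, cross_zero_coord, cross_one_coord, cross_two_coord,
    E3.inner_eq, h3, div_eq_mul_inv]
  simp
  ring

/-- The field of a double layer is the Biot-Savart field of the boundary. -/
theorem doubleLayerField_eq_biotSavart {k : ℕ} {P : Set (EuclideanSpace ℝ (Fin k))}
    (hP : IsOpen P) {S : EuclideanSpace ℝ (Fin k) → OrientedSurface} (hS : IsSmoothFamily P S)
    {t : EuclideanSpace ℝ (Fin k)} (ht : t ∈ P) {r : E3} (hr : r ∉ (S t).carrier) :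
    (S t).doubleLayerField r = (S t).biotSavart r := by
  obtain ⟨A⟩ := hS.nonempty_partition hP ht
  have hA := A.adapted_self
  have hne (p : E3) (hp : p ∈ (S t).carrier) : r ≠ p := fun h => hr (h ▸ hp)
  have hm := (S t).isCompact.measurableSet
  set D : Set E3 := {r}ᶜ
  have hD : IsOpen D := isOpen_compl_singleton
  have hSD : (S t).carrier ⊆ D := fun p hp => (hne p hp).symm
  have hF (e : E3) : ContDiffOn ℝ ∞ (fun q => cross (OrientedSurface.coulomb (r - q)) e) D := by
    intro q hq
    refine ContDiffAt.contDiffWithinAt ?_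
    have hq : r - q ≠ 0 := sub_ne_zero.2 fun h => hq h.symm
    exact contDiff_cross.contDiffAt.comp q (((contDiffAt_coulomb hq).comp q
      (contDiffAt_const.sub contDiffAt_id)).prodMk contDiffAt_const)
  have hst (e : E3) := hA.stokes hD hSD (hF e)
  have hτ (e p : E3) : (inner ℝ (cross (OrientedSurface.coulomb (r - p)) e)
      ((S t).boundaryTangent p) : ℝ) =
      inner ℝ e ((‖r - p‖ ^ 3)⁻¹ • cross ((S t).boundaryTangent p) (r - p)) := by
    simp only [E3.inner_eq, OrientedSurface.coulomb, cross_zero_coord, cross_one_coord,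
      cross_two_coord, PiLp.smul_apply, smul_eq_mul]
    ring
  simp only [hτ] at hst
  have hint1 : Integrable (fun p => (3 * inner ℝ (r - p) ((S t).normal p) / ‖r - p‖ ^ 5) • (r - p)
      - (‖r - p‖ ^ 3)⁻¹ • (S t).normal p) (S t).areaMeasure := by
    refine (hA.integral_area fun j => ?_).1
    have h1 : ContinuousOn (fun x => r - A.Φ j (t, x)) (A.K j) :=
      continuousOn_const.sub ((hA.isChart j).continuousOn.mono
        ((hA.subset j).trans Set.inter_subset_left))
    have h2 : ContinuousOn (fun x => (S t).normal (A.Φ j (t, x))) (A.K j) :=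
      (hA.isChart j).continuousOn_normal.mono (hA.subset j)
    have h3 (m : ℕ) (x : ℝ × ℝ) (hx : x ∈ A.K j) : ‖r - A.Φ j (t, x)‖ ^ m ≠ 0 :=
      pow_ne_zero m (norm_ne_zero_iff.2 (sub_ne_zero.2 (hne _ (hA.mem_carrier j hx))))
    exact (((continuousOn_const.mul (h1.inner h2)).div (h1.norm.pow 5) (h3 5)).smul h1).sub
      (((h1.norm.pow 3).inv₀ (h3 3)).smul h2)
  -- Stokes with the three basis vectors gives integrability of each component; the vector integrand
  -- is reassembled from them.
  have hint2 : Integrable (fun p => (‖r - p‖ ^ 3)⁻¹ • cross ((S t).boundaryTangent p) (r - p))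
      (S t).boundaryMeasure := by
    have h1 (i : Fin 3) := ((hst (EuclideanSpace.single i 1)).1.smul_const
      (EuclideanSpace.single i (1 : ℝ)))
    refine (((h1 0).add (h1 1)).add (h1 2)).congr (Filter.Eventually.of_forall fun p => ?_)
    apply E3.ext_coord <;> simp [E3.inner_eq]
  refine ext_inner_left ℝ fun e => ?_
  rw [OrientedSurface.doubleLayerField, OrientedSurface.biotSavart, ← integral_inner hint1,
    ← integral_inner hint2, ← (hst e).2, ← (S t).areaMeasure_restrict_carrier]
  exact setIntegral_congr_fun hm fun p hp => (inner_curlVec_coulomb (hne p hp) e _).symm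

theorem OrientedSurface.norm_normal (S : OrientedSurface) {p : E3} (hp : p ∈ S.carrier) :
    ‖S.normal p‖ = 1 := by
  obtain ⟨W, φ, hφ, x, hx, rfl⟩ := S.exists_chart p hp
  exact hφ.norm_normal hx

/-! ### Openness of the domains, smoothness of the dipole field and its derivative in the thickness.
-/

section Family

variable {k : ℕ} {P : Set (EuclideanSpace ℝ (Fin k))}
  {S : EuclideanSpace ℝ (Fin k) → OrientedSurface}

/-- The triples `(t, h, r)` with `r` not on the positive sheet. -/
def offPlus (P : Set (EuclideanSpace ℝ (Fin k)))
    (S : EuclideanSpace ℝ (Fin k) → OrientedSurface) :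
    Set (EuclideanSpace ℝ (Fin k) × ℝ × E3) :=
  {y | y.1 ∈ P ∧ ∀ p ∈ (S y.1).carrier, y.2.2 ≠ p + (y.2.1 / 2) • (S y.1).normal p}

/-- Reversal of the thickness. -/
def flipThickness (y : EuclideanSpace ℝ (Fin k) × ℝ × E3) : EuclideanSpace ℝ (Fin k) × ℝ × E3 :=
  (y.1, -y.2.1, y.2.2)

theorem contDiff_flipThickness : ContDiff ℝ ∞ (flipThickness (k := k)) :=
  contDiff_fst.prodMk (contDiff_snd.fst.neg.prodMk contDiff_snd.snd)

theorem offSheets_eq : offSheets P S = offPlus P S ∩ flipThickness ⁻¹' offPlus P S := by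
  ext y
  simp only [offSheets, offPlus, flipThickness, Set.mem_ofPred_eq, Set.mem_inter_iff,
    Set.mem_preimage, neg_div, neg_smul, ← sub_eq_add_neg]
  constructor
  · rintro ⟨h1, h2⟩
    exact ⟨⟨h1, fun p hp => (h2 p hp).1⟩, h1, fun p hp => (h2 p hp).2⟩
  · rintro ⟨⟨h1, h2⟩, -, h3⟩
    exact ⟨h1, fun p hp => ⟨h2 p hp, h3 p hp⟩⟩

namespace FamilyPartition

variable {t₀ : EuclideanSpace ℝ (Fin k)}

/-- The vector from a point of the positive sheet to `r`, in a chart. -/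
noncomputable def displacement (A : FamilyPartition P S t₀) (j : A.κ)
    (z : (EuclideanSpace ℝ (Fin k) × ℝ × E3) × (ℝ × ℝ)) : E3 :=
  z.1.2.2 - (A.Φ j (z.1.1, z.2) + (z.1.2.1 / 2) • A.nrm j (z.1.1, z.2))

namespace Adapted

variable {A : FamilyPartition P S t₀} {y : EuclideanSpace ℝ (Fin k) × ℝ × E3}

theorem contDiffAt_displacement (h : A.Adapted y.1) (j : A.κ) {x : ℝ × ℝ} (hx : x ∈ A.K j) :
    ContDiffAt ℝ ∞ (A.displacement j) (y, x) := by
  have h0 : ContDiff ℝ ∞ fun z : (EuclideanSpace ℝ (Fin k) × ℝ × E3) × (ℝ × ℝ) => (z.1.1, z.2) :=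
    contDiff_fst.fst.prodMk contDiff_snd
  have h1 : ContDiffAt ℝ ∞ (fun z : (EuclideanSpace ℝ (Fin k) × ℝ × E3) × (ℝ × ℝ) =>
      A.Φ j (z.1.1, z.2)) (y, x) :=
    ContDiffAt.comp (y, x) (g := A.Φ j) (h.contDiffAt_param j hx) h0.contDiffAt
  have h2 : ContDiffAt ℝ ∞ (fun z : (EuclideanSpace ℝ (Fin k) × ℝ × E3) × (ℝ × ℝ) =>
      A.nrm j (z.1.1, z.2)) (y, x) :=
    ContDiffAt.comp (y, x) (g := A.nrm j) (h.contDiffAt_nrm j hx) h0.contDiffAt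
  exact contDiff_fst.snd.snd.contDiffAt.sub
    (h1.add ((contDiff_fst.snd.fst.div_const 2).contDiffAt.smul h2))

theorem displacement_eq (h : A.Adapted y.1) (j : A.κ) {x : ℝ × ℝ} (hx : x ∈ A.K j) :
    A.displacement j (y, x) = y.2.2 - (A.Φ j (y.1, x) +
      (y.2.1 / 2) • (S y.1).normal (A.Φ j (y.1, x))) := by
  rw [displacement, h.nrm_eq j hx]

theorem displacement_ne_zero (h : A.Adapted y.1) (hy : y ∈ offPlus P S) (j : A.κ) {x : ℝ × ℝ}
    (hx : x ∈ A.K j) : A.displacement j (y, x) ≠ 0 := by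
  rw [h.displacement_eq j hx, sub_ne_zero]
  exact hy.2 _ (h.mem_carrier j hx)

end Adapted

end FamilyPartition

/-- The displacement is continuous and nonzero on the compact sets `A.K j`, hence stays nonzero for
nearby `(t, h, r)`; the adapted charts reach every point of the nearby surfaces. -/
theorem isOpen_offPlus (hP : IsOpen P) (hS : IsSmoothFamily P S) : IsOpen (offPlus P S) := by
  rw [isOpen_iff_mem_nhds]
  intro y hy
  obtain ⟨A⟩ := hS.nonempty_partition hP hy.1
  have hA := A.adapted_self
  have h1 (j : A.κ) : ∀ᶠ y' in 𝓝 y, ∀ x ∈ A.K j, A.displacement j (y', x) ≠ 0 := by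
    refine (A.isCompact j).eventually_forall_of_forall_eventually fun x hx => ?_
    exact (hA.contDiffAt_displacement j hx).continuousAt.eventually_ne
      (hA.displacement_ne_zero hy j hx)
  filter_upwards [Filter.eventually_all.2 h1,
    continuous_fst.continuousAt.eventually A.eventually_adapted] with y' h2 hA'
  refine ⟨hA'.mem, fun p hp => ?_⟩
  obtain ⟨j, x, hx, rfl⟩ := hA'.exists_param hp
  have := h2 j x hx
  rwa [hA'.displacement_eq j hx, sub_ne_zero] at this

theorem isOpen_offSheets (hP : IsOpen P) (hS : IsSmoothFamily P S) : IsOpen (offSheets P S) := by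
  rw [offSheets_eq]
  exact (isOpen_offPlus hP hS).inter
    ((isOpen_offPlus hP hS).preimage contDiff_flipThickness.continuous)

theorem mem_offSheets_zero {t : EuclideanSpace ℝ (Fin k)} {r : E3} :
    (t, (0 : ℝ), r) ∈ offSheets P S ↔ (t, r) ∈ offSurface P S := by
  simp only [offSheets, offSurface, Set.mem_ofPred_eq, zero_div, zero_smul, add_zero, sub_zero,
    and_self]
  exact and_congr_right fun _ => ⟨fun h hr => h r hr rfl, fun h p hp hrp => h (hrp ▸ hp)⟩

theorem contDiff_zeroThickness :
    ContDiff ℝ ∞ fun y : EuclideanSpace ℝ (Fin k) × E3 => (y.1, (0 : ℝ), y.2) :=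
  contDiff_fst.prodMk (contDiff_const.prodMk contDiff_snd)

theorem isOpen_offSurface (hP : IsOpen P) (hS : IsSmoothFamily P S) :
    IsOpen (offSurface P S) := by
  have : offSurface P S = (fun y => (y.1, (0 : ℝ), y.2)) ⁻¹' offSheets P S := by
    ext y
    exact mem_offSheets_zero.symm
  rw [this]
  exact (isOpen_offSheets hP hS).preimage contDiff_zeroThickness.continuous

theorem contDiffOn_fieldPlus (hP : IsOpen P) (hS : IsSmoothFamily P S) :
    ContDiffOn ℝ ∞ (fun y : EuclideanSpace ℝ (Fin k) × ℝ × E3 =>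
      (S y.1).fieldPlus 1 y.2.1 y.2.2) (offPlus P S) := by
  intro y hy
  apply ContDiffAt.contDiffWithinAt
  obtain ⟨A⟩ := hS.nonempty_partition hP hy.1
  have hA := A.adapted_self
  have h0 : ContDiff ℝ ∞ fun z : (EuclideanSpace ℝ (Fin k) × ℝ × E3) × (ℝ × ℝ) => (z.1.1, z.2) :=
    contDiff_fst.fst.prodMk contDiff_snd
  have hsm : ContDiffAt ℝ ∞ (fun y' : EuclideanSpace ℝ (Fin k) × ℝ × E3 => ∑ j, ∫ x in A.K j,
      A.dens j (y'.1, x) • OrientedSurface.coulomb (A.displacement j (y', x))) y := by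
    refine ContDiffAt.sum fun j _ => ?_
    refine contDiffAt_integral_compact (f := fun z : (EuclideanSpace ℝ (Fin k) × ℝ × E3) ×
      (ℝ × ℝ) => A.dens j (z.1.1, z.2) • OrientedSurface.coulomb (A.displacement j z))
      (A.isCompact j) fun x hx => ?_
    have h1 : ContDiffAt ℝ ∞ (fun z : (EuclideanSpace ℝ (Fin k) × ℝ × E3) × (ℝ × ℝ) =>
        A.dens j (z.1.1, z.2)) (y, x) :=
      ContDiffAt.comp (y, x) (g := A.dens j) (hA.contDiffAt_dens j hx) h0.contDiffAt
    exact h1.smul ((contDiffAt_coulomb (hA.displacement_ne_zero hy j hx)).comp (y, x)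
      (hA.contDiffAt_displacement j hx))
  refine hsm.congr_of_eventuallyEq ?_
  filter_upwards [(isOpen_offPlus hP hS).mem_nhds hy,
    continuous_fst.continuousAt.eventually A.eventually_adapted] with y' hy' hA'
  have hc (j : A.κ) : ContinuousOn (fun x => OrientedSurface.coulomb (A.displacement j (y', x)))
      (A.K j) := fun x hx => ContinuousAt.continuousWithinAt (by
    have h1 : ContinuousAt (fun x : ℝ × ℝ => A.displacement j (y', x)) x :=
      ContinuousAt.comp (g := A.displacement j)
        (hA'.contDiffAt_displacement j hx).continuousAt (by fun_prop)
    exact ContinuousAt.comp (g := OrientedSurface.coulomb)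
      (contDiffAt_coulomb (hA'.displacement_ne_zero hy' j hx)).continuousAt h1)
  have hform := (hA'.integral_area (f := fun p => (1 : ℝ) • OrientedSurface.coulomb
    (y'.2.2 - (p + (y'.2.1 / 2) • (S y'.1).normal p))) fun j => (hc j).congr fun x hx => by
      simp only [hA'.displacement_eq j hx, one_smul]).2
  rw [OrientedSurface.fieldPlus, hform]
  refine Finset.sum_congr rfl fun j _ => ?_
  refine setIntegral_congr_fun (A.isCompact j).measurableSet fun x hx => ?_
  simp only [hA'.displacement_eq j hx, one_smul]

theorem dipoleField_eq (t : EuclideanSpace ℝ (Fin k)) (h : ℝ) (r : E3) :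
    (S t).dipoleField 1 h r = (S t).fieldPlus 1 h r - (S t).fieldPlus 1 (-h) r := by
  rw [OrientedSurface.dipoleField, sub_eq_add_neg, OrientedSurface.fieldMinus,
    OrientedSurface.fieldPlus, OrientedSurface.fieldPlus, ← integral_neg]
  simp only [neg_div, neg_smul, ← sub_eq_add_neg]

theorem contDiffOn_dipoleField (hP : IsOpen P) (hS : IsSmoothFamily P S) :
    ContDiffOn ℝ ∞ (fun y : EuclideanSpace ℝ (Fin k) × ℝ × E3 =>
      (S y.1).dipoleField 1 y.2.1 y.2.2) (offSheets P S) := by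
  have h1 := contDiffOn_fieldPlus hP hS
  have h2 := h1.comp contDiff_flipThickness.contDiffOn (Set.mapsTo_preimage flipThickness _)
  rw [offSheets_eq]
  simp only [dipoleField_eq]
  exact (h1.mono Set.inter_subset_left).sub (h2.mono Set.inter_subset_right)

/-- Differentiation under the integral sign; the sheet moves with velocity `n / 2` in `h`, whence
the factor `-1 / 2`. -/
theorem hasDerivAt_fieldPlus (hP : IsOpen P) (hS : IsSmoothFamily P S)
    {t : EuclideanSpace ℝ (Fin k)} (ht : t ∈ P) {r : E3} (hr : r ∉ (S t).carrier) :
    HasDerivAt (fun h => (S t).fieldPlus 1 h r)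
      (∫ p, -(1 / 2 : ℝ) • coulombDeriv (r - p) ((S t).normal p) ∂(S t).areaMeasure) 0 := by
  obtain ⟨A⟩ := hS.nonempty_partition hP ht
  have hA := A.adapted_self
  have hfin := hA.isFiniteMeasure
  obtain ⟨δ, hδ, hδr⟩ := Metric.mem_nhds_iff.1
    ((S t).isCompact.isClosed.isOpen_compl.mem_nhds hr)
  have hrp (p : E3) (hp : p ∈ (S t).carrier) : δ ≤ ‖r - p‖ := by
    by_contra! h
    exact hδr (by rwa [Metric.mem_ball', dist_eq_norm] : p ∈ Metric.ball r δ) hp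
  have hlow (p : E3) (hp : p ∈ (S t).carrier) (h : ℝ) (hh : h ∈ Metric.ball (0 : ℝ) δ) :
      δ / 2 ≤ ‖r - (p + (h / 2) • (S t).normal p)‖ := by
    have h1 : ‖(h / 2) • (S t).normal p‖ ≤ δ / 2 := by
      rw [norm_smul, (S t).norm_normal hp, mul_one, norm_div, Real.norm_two]
      rw [mem_ball_zero_iff] at hh
      linarith
    have h2 := norm_sub_norm_le (r - p) ((h / 2) • (S t).normal p)
    rw [sub_sub] at h2
    linarith [hrp p hp]
  have hae : ∀ᵐ p ∂(S t).areaMeasure, p ∈ (S t).carrier := by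
    rw [← (S t).areaMeasure_restrict_carrier]
    exact ae_restrict_mem (S t).isCompact.measurableSet
  have hΦ (j : A.κ) : ContinuousOn (fun x => A.Φ j (t, x)) (A.K j) :=
    (hA.isChart j).continuousOn.mono ((hA.subset j).trans Set.inter_subset_left)
  have hn (j : A.κ) : ContinuousOn (fun x => (S t).normal (A.Φ j (t, x))) (A.K j) :=
    (hA.isChart j).continuousOn_normal.mono (hA.subset j)
  have hint (h : ℝ) (hh : h ∈ Metric.ball (0 : ℝ) δ) : Integrable (fun p => (1 : ℝ) •
      OrientedSurface.coulomb (r - (p + (h / 2) • (S t).normal p))) (S t).areaMeasure := by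
    refine (hA.integral_area fun j => ?_).1
    have h1 : ContinuousOn (fun x => r - (A.Φ j (t, x) +
        (h / 2) • (S t).normal (A.Φ j (t, x)))) (A.K j) :=
      continuousOn_const.sub ((hΦ j).add (show ContinuousOn (fun x => (h / 2) • (S t).normal (A.Φ j (t, x))) (A.K j) from
        (hn j).const_smul (h / 2)))
    have h2 (x : ℝ × ℝ) (hx : x ∈ A.K j) : ‖r - (A.Φ j (t, x) +
        (h / 2) • (S t).normal (A.Φ j (t, x)))‖ ^ 3 ≠ 0 :=
      pow_ne_zero 3 (by linarith [hlow _ (hA.mem_carrier j hx) h hh])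
    simp only [one_smul]
    exact ((h1.norm.pow 3).inv₀ h2).smul h1
  have hint' : Integrable (fun p => -(1 / 2 : ℝ) • coulombDeriv
      (r - (p + ((0 : ℝ) / 2) • (S t).normal p)) ((S t).normal p)) (S t).areaMeasure := by
    refine (hA.integral_area fun j => ?_).1
    have h1 : ContinuousOn (fun x => r - (A.Φ j (t, x) +
        ((0 : ℝ) / 2) • (S t).normal (A.Φ j (t, x)))) (A.K j) :=
      continuousOn_const.sub ((hΦ j).add (show ContinuousOn (fun x => ((0 : ℝ) / 2) •
        (S t).normal (A.Φ j (t, x))) (A.K j) from (hn j).const_smul ((0 : ℝ) / 2)))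
    have h2 (m : ℕ) (x : ℝ × ℝ) (hx : x ∈ A.K j) : ‖r - (A.Φ j (t, x) +
        ((0 : ℝ) / 2) • (S t).normal (A.Φ j (t, x)))‖ ^ m ≠ 0 :=
      pow_ne_zero m (by linarith [hlow _ (hA.mem_carrier j hx) 0 (Metric.mem_ball_self hδ)])
    have h3 : ContinuousOn (fun x => coulombDeriv (r - (A.Φ j (t, x) + ((0 : ℝ) / 2) •
        (S t).normal (A.Φ j (t, x)))) ((S t).normal (A.Φ j (t, x)))) (A.K j) :=
      (((h1.norm.pow 3).inv₀ (h2 3)).smul (hn j)).sub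
        (((continuousOn_const.mul (h1.inner (hn j))).div (h1.norm.pow 5) (h2 5)).smul h1)
    exact h3.const_smul (-(1 / 2 : ℝ))
  -- The constant bound combines the factor `1 / 2` with `norm_coulombDeriv_le` at distance at least
  -- `δ / 2`. It is integrable because the area is finite.
  have key := (hasDerivAt_integral_of_dominated_loc_of_deriv_le (μ := (S t).areaMeasure)
    (F := fun (h : ℝ) p => (1 : ℝ) • OrientedSurface.coulomb (r - (p + (h / 2) • (S t).normal p)))
    (F' := fun h p => -(1 / 2 : ℝ) • coulombDeriv (r - (p + (h / 2) • (S t).normal p))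
      ((S t).normal p)) (bound := fun _ => 1 / 2 * (4 * ((δ / 2) ^ 3)⁻¹))
    (Metric.ball_mem_nhds (0 : ℝ) hδ) (Filter.eventually_of_mem (Metric.ball_mem_nhds (0 : ℝ) hδ)
      fun h hh => (hint h hh).aestronglyMeasurable) (hint 0 (Metric.mem_ball_self hδ))
    hint'.aestronglyMeasurable ?_ (integrable_const _) ?_).2
  · simp only [zero_div, zero_smul, add_zero] at key
    exact key
  · filter_upwards [hae] with p hp h hh
    have h1 := hlow p hp h hh
    rw [norm_smul, norm_neg, norm_div, norm_one, Real.norm_two]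
    refine mul_le_mul_of_nonneg_left ?_ (by norm_num)
    refine (norm_coulombDeriv_le _ _).trans ?_
    rw [(S t).norm_normal hp, mul_one]
    gcongr
  · filter_upwards [hae] with p hp h hh
    have h1 : r - (p + (h / 2) • (S t).normal p) ≠ 0 :=
      norm_pos_iff.1 ((half_pos hδ).trans_le (hlow p hp h hh))
    have h2 : HasDerivAt (fun h : ℝ => r - (p + (h / 2) • (S t).normal p))
        (-((1 / 2 : ℝ) • (S t).normal p)) h :=
      ((((hasDerivAt_id h).div_const 2).smul_const _).const_add p).const_sub r
    have h3 := ((contDiffAt_coulomb h1).differentiableAt (by simp)).hasFDerivAt.comp_hasDerivAt h h2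
    rw [map_neg, map_smul, fderiv_coulomb_apply h1, ← neg_smul] at h3
    simp only [one_smul]
    exact h3

theorem hasDerivAt_dipoleField (hP : IsOpen P) (hS : IsSmoothFamily P S)
    {t : EuclideanSpace ℝ (Fin k)} (ht : t ∈ P) {r : E3} (hr : r ∉ (S t).carrier) :
    HasDerivAt (fun h => (S t).dipoleField 1 h r) ((S t).biotSavart r) 0 := by
  have h1 := hasDerivAt_fieldPlus hP hS ht hr
  have h2 : HasDerivAt (fun h => (S t).fieldPlus 1 (-h) r) _ 0 :=
    HasDerivAt.scomp (0 : ℝ) (g₁ := fun h => (S t).fieldPlus 1 h r) (by rw [neg_zero]; exact h1)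
      (hasDerivAt_neg (0 : ℝ))
  have h3 := h1.sub h2
  simp only [dipoleField_eq]
  refine h3.congr_deriv ?_
  rw [← doubleLayerField_eq_biotSavart hP hS ht hr, OrientedSurface.doubleLayerField,
    integral_smul, neg_one_smul, sub_neg_eq_add, ← add_smul, ← integral_smul]
  congr 1 with p : 1
  rw [coulombDeriv, show -(1 / 2 : ℝ) + -(1 / 2) = -1 by norm_num, neg_one_smul, neg_sub]

end Family

/-! ### Hadamard's lemma -/

section Hadamard

variable {E F G : Type*} [NormedAddCommGroup E] [NormedSpace ℝ E] [NormedAddCommGroup F]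
  [NormedSpace ℝ F] [NormedAddCommGroup G] [NormedSpace ℝ G] [CompleteSpace G]

set_option linter.unusedSectionVars false

/-- Scaling of the middle coordinate. -/
def scaleMiddle (s : ℝ) (y : E × ℝ × F) : E × ℝ × F := (y.1, s * y.2.1, y.2.2)

theorem contDiff_scaleMiddle :
    ContDiff ℝ ∞ fun z : (E × ℝ × F) × ℝ => scaleMiddle z.2 z.1 :=
  contDiff_fst.fst.prodMk ((contDiff_snd.mul contDiff_fst.snd.fst).prodMk contDiff_fst.snd.snd)

/-- The largest part of `U` which is star-shaped with respect to the middle coordinate. -/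
def starMiddle (U : Set (E × ℝ × F)) : Set (E × ℝ × F) :=
  {y | ∀ s ∈ Set.Icc (0 : ℝ) 1, scaleMiddle s y ∈ U}

theorem isOpen_starMiddle {U : Set (E × ℝ × F)} (hU : IsOpen U) : IsOpen (starMiddle U) := by
  rw [isOpen_iff_mem_nhds]
  intro y hy
  refine isCompact_Icc.eventually_forall_of_forall_eventually fun s hs => ?_
  exact contDiff_scaleMiddle.continuous.continuousAt.eventually (hU.mem_nhds (hy s hs))

theorem starMiddle_subset (U : Set (E × ℝ × F)) : starMiddle U ⊆ U := fun y hy => by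
  simpa [scaleMiddle] using hy 1 ⟨zero_le_one, le_rfl⟩

theorem scaleMiddle_mem_starMiddle {U : Set (E × ℝ × F)} {y : E × ℝ × F} (hy : y ∈ starMiddle U)
    {s : ℝ} (hs : s ∈ Set.Icc (0 : ℝ) 1) : scaleMiddle s y ∈ starMiddle U := fun s' hs' => by
  have := hy (s' * s) ⟨mul_nonneg hs'.1 hs.1, mul_le_one₀ hs'.2 hs.1 hs.2⟩
  simpa [scaleMiddle, mul_assoc] using this

/-- A smooth function vanishing where the middle coordinate is zero is divisible by it. -/
theorem exists_eq_middle_smul {U : Set (E × ℝ × F)} (hU : IsOpen U) {f : E × ℝ × F → G}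
    (hf : ContDiffOn ℝ ∞ f (starMiddle U)) (hf0 : ∀ y ∈ starMiddle U, y.2.1 = 0 → f y = 0) :
    ∃ g : E × ℝ × F → G, ContDiffOn ℝ ∞ g (starMiddle U) ∧
      (∀ y ∈ starMiddle U, f y = y.2.1 • g y) ∧
      ∀ y ∈ starMiddle U, y.2.1 = 0 → g y = fderiv ℝ f y (0, 1, 0) := by
  have hV := isOpen_starMiddle hU
  have hfd : ContDiffOn ℝ ∞ (fun y => fderiv ℝ f y (0, 1, 0)) (starMiddle U) :=
    (hf.fderiv_of_isOpen hV (m := ∞) (by simp)).clm_apply contDiffOn_const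
  -- The quotient is the mean of the middle derivative along the segment from middle coordinate `0`
  -- to `y`; star-shapedness keeps that segment in the domain.
  refine ⟨fun y => ∫ s in Set.Icc (0 : ℝ) 1, fderiv ℝ f (scaleMiddle s y) (0, 1, 0), ?_, ?_, ?_⟩
  · intro y hy
    apply ContDiffAt.contDiffWithinAt
    refine contDiffAt_integral_compact
      (f := fun z : (E × ℝ × F) × ℝ => fderiv ℝ f (scaleMiddle z.2 z.1) (0, 1, 0))
      isCompact_Icc fun s hs => ?_
    exact ContDiffAt.comp (y, s) (g := fun y => fderiv ℝ f y (0, 1, 0))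
      (hfd.contDiffAt (hV.mem_nhds (scaleMiddle_mem_starMiddle hy hs)))
      contDiff_scaleMiddle.contDiffAt
  · intro y hy
    have hscale (s : ℝ) : HasDerivAt (fun s => scaleMiddle s y) (0, y.2.1, 0) s := by
      have := (hasDerivAt_const s y.1).prodMk
        (((hasDerivAt_id s).mul_const y.2.1).prodMk (hasDerivAt_const s y.2.2))
      simpa [scaleMiddle] using this
    have hcont : ContinuousOn (fun s => fderiv ℝ f (scaleMiddle s y) (0, 1, 0)) (Set.Icc 0 1) :=
      hfd.continuousOn.comp
        (contDiff_scaleMiddle.continuous.comp (by fun_prop : Continuous fun s : ℝ => (y, s))).continuousOn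
        fun s hs => scaleMiddle_mem_starMiddle hy hs
    have hderiv (s : ℝ) (hs : s ∈ Set.uIcc (0 : ℝ) 1) : HasDerivAt (fun s => f (scaleMiddle s y))
        (y.2.1 • fderiv ℝ f (scaleMiddle s y) (0, 1, 0)) s := by
      rw [Set.uIcc_of_le zero_le_one] at hs
      have h1 := ((hf.contDiffAt (hV.mem_nhds (scaleMiddle_mem_starMiddle hy
        hs))).differentiableAt (by simp)).hasFDerivAt.comp_hasDerivAt s (hscale s)
      have h2 : ((0, y.2.1, 0) : E × ℝ × F) = y.2.1 • (0, 1, 0) := by simp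
      rw [h2, map_smul] at h1
      exact h1
    have hftc := intervalIntegral.integral_eq_sub_of_hasDerivAt hderiv
      (ContinuousOn.intervalIntegrable (by
        rw [Set.uIcc_of_le zero_le_one]
        exact hcont.const_smul y.2.1))
    have hf00 : f (scaleMiddle 0 y) = 0 :=
      hf0 _ (scaleMiddle_mem_starMiddle hy ⟨le_rfl, zero_le_one⟩) (by simp [scaleMiddle])
    have hf1 : scaleMiddle 1 y = y := by simp [scaleMiddle]
    rw [hf00, hf1, sub_zero, intervalIntegral.integral_smul,
      intervalIntegral.integral_of_le zero_le_one, ← integral_Icc_eq_integral_Ioc] at hftc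
    exact hftc.symm
  · intro y _ hy0
    have h1 (s : ℝ) : scaleMiddle s y = y := by
      simp only [scaleMiddle, hy0, mul_zero]
      rw [← hy0]
    simp [h1]

theorem fderiv_middle_eq {f : E × ℝ × F → G} {t : E} {s : ℝ} {r : F} {v : G}
    (hf : DifferentiableAt ℝ f (t, s, r)) (hv : HasDerivAt (fun s => f (t, s, r)) v s) :
    fderiv ℝ f (t, s, r) (0, 1, 0) = v := by
  have h2 : HasDerivAt (fun s : ℝ => ((t, s, r) : E × ℝ × F)) (0, 1, 0) s :=
    (hasDerivAt_const s t).prodMk ((hasDerivAt_id s).prodMk (hasDerivAt_const s r))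
  exact (hf.hasFDerivAt.comp_hasDerivAt s h2).unique hv

/-- The second order Taylor expansion in the middle coordinate. -/
theorem exists_expansion_middle {U : Set (E × ℝ × F)} (hU : IsOpen U) {f B : E × ℝ × F → G}
    (hf : ContDiffOn ℝ ∞ f (starMiddle U)) (hB : ContDiffOn ℝ ∞ B (starMiddle U))
    (hf0 : ∀ y ∈ starMiddle U, y.2.1 = 0 → f y = 0)
    (hfB : ∀ y ∈ starMiddle U, y.2.1 = 0 → fderiv ℝ f y (0, 1, 0) = B y) :
    ∃ R : E × ℝ × F → G, ContDiffOn ℝ ∞ R (starMiddle U) ∧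
      ∀ y ∈ starMiddle U, f y = y.2.1 • B y + y.2.1 ^ 2 • R y := by
  obtain ⟨g, hg, hfg, hg0⟩ := exists_eq_middle_smul hU hf hf0
  -- Second use of the division lemma: `g` equals the middle derivative of `f` at middle coordinate
  -- zero, and so does `B`.
  obtain ⟨R, hR, hgR, -⟩ := exists_eq_middle_smul (f := fun y => g y - B y) hU (hg.sub hB)
    fun y hy hy0 => by rw [hg0 y hy hy0, hfB y hy hy0, sub_self]
  refine ⟨R, hR, fun y hy => ?_⟩
  have h3 : g y - B y = y.2.1 • R y := hgR y hy
  rw [hfg y hy, sub_eq_iff_eq_add'.1 h3, smul_add, smul_smul, sq]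

end Hadamard

/-! ### Smoothness of the Biot-Savart field and expansion in the thickness. -/

section Family

variable {k : ℕ} {P : Set (EuclideanSpace ℝ (Fin k))}
  {S : EuclideanSpace ℝ (Fin k) → OrientedSurface}

theorem fderiv_dipoleField (hP : IsOpen P) (hS : IsSmoothFamily P S)
    {t : EuclideanSpace ℝ (Fin k)} {r : E3} (h : (t, r) ∈ offSurface P S) :
    fderiv ℝ (fun y : EuclideanSpace ℝ (Fin k) × ℝ × E3 => (S y.1).dipoleField 1 y.2.1 y.2.2)
      (t, 0, r) (0, 1, 0) = (S t).biotSavart r := by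
  exact fderiv_middle_eq (((contDiffOn_dipoleField hP hS).contDiffAt
    ((isOpen_offSheets hP hS).mem_nhds (mem_offSheets_zero.2 h))).differentiableAt (by simp))
    (hasDerivAt_dipoleField hP hS h.1 h.2)

/-- No line integral has to be differentiated: off the surface the field is the `h`-derivative at `h
= 0` of the smooth dipole field. -/
theorem contDiffOn_biotSavart (hP : IsOpen P) (hS : IsSmoothFamily P S) :
    ContDiffOn ℝ ∞ (fun y : EuclideanSpace ℝ (Fin k) × E3 => (S y.1).biotSavart y.2)
      (offSurface P S) := by
  have h1 : ContDiffOn ℝ ∞ (fun y => fderiv ℝ (fun y : EuclideanSpace ℝ (Fin k) × ℝ × E3 =>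
      (S y.1).dipoleField 1 y.2.1 y.2.2) y (0, 1, 0)) (offSheets P S) :=
    ((contDiffOn_dipoleField hP hS).fderiv_of_isOpen (isOpen_offSheets hP hS) (m := ∞)
      (by simp)).clm_apply contDiffOn_const
  refine (h1.comp contDiff_zeroThickness.contDiffOn
    fun y hy => mem_offSheets_zero.2 hy).congr fun y hy => ?_
  exact (fderiv_dipoleField hP hS (t := y.1) (r := y.2) hy).symm

theorem mem_offSurface_of_mem_starMiddle {y : EuclideanSpace ℝ (Fin k) × ℝ × E3}
    (hy : y ∈ starMiddle (offSheets P S)) : (y.1, y.2.2) ∈ offSurface P S := by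
  rw [← mem_offSheets_zero]
  simpa [scaleMiddle] using hy 0 ⟨le_rfl, zero_le_one⟩

theorem mem_starMiddle_of_zero {y : EuclideanSpace ℝ (Fin k) × ℝ × E3}
    (hy : (y.1, y.2.2) ∈ offSurface P S) (hy0 : y.2.1 = 0) :
    y ∈ starMiddle (offSheets P S) := fun s _ => by
  rw [scaleMiddle, hy0, mul_zero]
  exact mem_offSheets_zero.2 hy

/-- The second order expansion of the field of a dipole sheet in its thickness. -/
theorem exists_dipoleField_expansion (hP : IsOpen P) (hS : IsSmoothFamily P S) :
    ∃ R : EuclideanSpace ℝ (Fin k) × ℝ × E3 → E3,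
      ContDiffOn ℝ ∞ R (starMiddle (offSheets P S)) ∧
      ∀ y ∈ starMiddle (offSheets P S), (S y.1).dipoleField 1 y.2.1 y.2.2 =
        y.2.1 • (S y.1).biotSavart y.2.2 + y.2.1 ^ 2 • R y := by
  refine exists_expansion_middle (isOpen_offSheets hP hS)
    ((contDiffOn_dipoleField hP hS).mono (starMiddle_subset _))
    (ContDiffOn.comp (f := fun y : EuclideanSpace ℝ (Fin k) × ℝ × E3 => (y.1, y.2.2))
      (g := fun y : EuclideanSpace ℝ (Fin k) × E3 => (S y.1).biotSavart y.2)
      (contDiffOn_biotSavart hP hS) (contDiff_fst.prodMk contDiff_snd.snd).contDiffOn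
      fun y hy => mem_offSurface_of_mem_starMiddle hy) ?_ ?_
  · intro y _ hy0
    rw [dipoleField_eq, hy0, neg_zero, sub_self]
  · rintro ⟨t, h, r⟩ hy hy0
    obtain rfl : h = 0 := hy0
    exact fderiv_dipoleField hP hS (mem_offSurface_of_mem_starMiddle hy)

end Family

/-! ### Morphisms of manifolds -/

namespace Mfd

theorem hom_ext {M N : Mfd} {f g : M ⟶ N} (h : ∀ x, fn f x = fn g x) : f = g :=
  ContMDiffMap.ext (f := f) (g := g) h

theorem contMDiff_fn {M N : Mfd} (f : M ⟶ N) :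
    ContMDiff 𝓘(ℝ, M.model) 𝓘(ℝ, N.model) ∞ (fn f) := f.2

/-- A morphism into a manifold whose values lie in an open subset. -/
noncomputable def lift {M N : Mfd} (f : M ⟶ N) (U : Opens N.carrier) (h : ∀ x, fn f x ∈ U) :
    M ⟶ N.ofOpens U :=
  (⟨fun x => ⟨fn f x, h x⟩, (ContMDiff.subtypeVal_comp_iff U fun x => ⟨fn f x, h x⟩).1
    (contMDiff_fn f)⟩ : C^∞⟮𝓘(ℝ, M.model), M.carrier; 𝓘(ℝ, N.model), U⟯)

theorem lift_incl {M N : Mfd} (f : M ⟶ N) (U : Opens N.carrier) (h : ∀ x, fn f x ∈ U) :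
    lift f U h ≫ N.incl U = f := rfl

instance mono_incl {N : Mfd} (U : Opens N.carrier) : Mono (N.incl U) :=
  ⟨fun _ _ h => hom_ext fun x => Subtype.ext (congrArg (fun k => fn k x) h)⟩

/-- The preimage of an open subset under a morphism. -/
def preim {M N : Mfd} (f : M ⟶ N) (U : Opens N.carrier) : Opens M.carrier :=
  ⟨fn f ⁻¹' U, U.2.preimage (contMDiff_fn f).continuous⟩

/-- The restriction of a morphism to the preimage of an open subset. -/
noncomputable def restrPreim {M N : Mfd} (f : M ⟶ N) (U : Opens N.carrier) :
    M.ofOpens (preim f U) ⟶ N.ofOpens U :=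
  lift (M.incl (preim f U) ≫ f) U fun x => x.2

theorem isPullback_preim {M N : Mfd} (f : M ⟶ N) (U : Opens N.carrier) :
    IsPullback (M.incl (preim f U)) (restrPreim f U) f (N.incl U) := by
  refine ⟨⟨rfl⟩, ⟨Limits.PullbackCone.IsLimit.mk _ (fun s => lift s.fst _ fun x => ?_)
    (fun s => rfl) (fun s => ?_) fun s m h _ => ?_⟩⟩
  · have h : fn f (fn s.fst x) = (fn s.snd x).1 := congrArg (fun k => fn k x) s.condition
    change fn f (fn s.fst x) ∈ U
    rw [h]
    exact (fn s.snd x).2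
  · rw [← cancel_mono (N.incl U)]
    exact s.condition
  · rw [← cancel_mono (M.incl (preim f U)), h]
    rfl

theorem range_tangentMap_incl {N : Mfd} (U : Opens N.carrier) (x : U) :
    (tangentMap (N.incl U) x).range = ⊤ := by
  classical
  -- A left inverse of the inclusion, arbitrary off `U` but smooth near `x`. The chain rule makes
  -- its derivative a right inverse of the derivative of the inclusion.
  set g : N.carrier → U := fun y => if h : y ∈ U then ⟨y, h⟩ else x with hg
  have hev : (Subtype.val ∘ g) =ᶠ[𝓝 x.1] id := by
    filter_upwards [U.2.mem_nhds x.2] with y hy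
    have hy' : y ∈ U := hy
    simp [hg, hy']
  have hgx : g x.1 = x := by simp [hg]
  have hgd : ContMDiffAt 𝓘(ℝ, N.model) 𝓘(ℝ, N.model) ∞ g x.1 := by
    rw [← ContMDiffAt.subtypeVal_comp_iff]
    exact contMDiffAt_id.congr_of_eventuallyEq hev
  have hval : MDifferentiableAt 𝓘(ℝ, N.model) 𝓘(ℝ, N.model) (Subtype.val : U → N.carrier) (g x.1) :=
    (contMDiff_subtype_val (n := ∞)).mdifferentiableAt (by simp)
  have h1 := mfderiv_comp x.1 hval (hgd.mdifferentiableAt (by simp))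
  rw [hev.mfderiv_eq, mfderiv_id, hgx] at h1
  rw [LinearMap.range_eq_top]
  intro v
  exact ⟨mfderiv 𝓘(ℝ, N.model) 𝓘(ℝ, N.model) g x.1 v, (DFunLike.congr_fun h1 v).symm⟩

theorem transversal_incl {M N : Mfd} (f : M ⟶ N) (U : Opens N.carrier) :
    Transversal f (N.incl U) := fun _ y _ =>
  eq_top_iff.2 ((range_tangentMap_incl U y).ge.trans le_sup_right)

/-- The one-point manifold. -/
noncomputable abbrev pt : Mfd := ofSpace (Fin 0 → ℝ)

/-- The constant morphism to the point. -/
noncomputable def toPt (M : Mfd) : M ⟶ pt :=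
  (⟨fun _ => 0, contMDiff_const⟩ :
    C^∞⟮𝓘(ℝ, M.model), M.carrier; 𝓘(ℝ, Fin 0 → ℝ), Fin 0 → ℝ⟯)

/-- The point is terminal. -/
noncomputable def isTerminalPt : Limits.IsTerminal pt :=
  Limits.IsTerminal.ofUniqueHom toPt fun _ _ => hom_ext fun _ =>
    Subsingleton.elim (α := Fin 0 → ℝ) _ _

/-- The morphism to a product with given components. -/
noncomputable def pair {M : Mfd} {F G : Type} [NormedAddCommGroup F] [NormedSpace ℝ F]
    [FiniteDimensional ℝ F] [NormedAddCommGroup G] [NormedSpace ℝ G] [FiniteDimensional ℝ G]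
    (f : M ⟶ ofSpace F) (g : M ⟶ ofSpace G) : M ⟶ ofSpace (F × G) :=
  (⟨fun x => (fn f x, fn g x), ContMDiff.prodMk_space (contMDiff_fn f) (contMDiff_fn g)⟩ :
    C^∞⟮𝓘(ℝ, M.model), M.carrier; 𝓘(ℝ, F × G), F × G⟯)

theorem isPullback_prod (F G : Type) [NormedAddCommGroup F] [NormedSpace ℝ F]
    [FiniteDimensional ℝ F] [NormedAddCommGroup G] [NormedSpace ℝ G] [FiniteDimensional ℝ G] :
    IsPullback (projFst F G) (projSnd F G) (toPt _) (toPt _) := by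
  refine ⟨⟨rfl⟩, ⟨Limits.PullbackCone.IsLimit.mk _ (fun s => pair s.fst s.snd)
    (fun s => rfl) (fun s => rfl) fun s m h h' => ?_⟩⟩
  refine hom_ext fun x => ?_
  exact Prod.ext (congrArg (fun k => fn k x) h) (congrArg (fun k => fn k x) h')

/-- The tangent space of the point is zero. Products are thus transversal pullbacks over the
terminal object, and a model preserves them. -/
theorem transversal_toPt (M N : Mfd) : Transversal (toPt M) (toPt N) := fun _ _ _ =>
  eq_top_iff.2 fun v _ => by
    have : v = 0 := Subsingleton.elim (α := Fin 0 → ℝ) _ _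
    rw [this]
    exact Submodule.zero_mem _

/-- A function which is smooth on an open set as a morphism. -/
noncomputable def ofContDiffOn {F G : Type} [NormedAddCommGroup F] [NormedSpace ℝ F]
    [FiniteDimensional ℝ F] [NormedAddCommGroup G] [NormedSpace ℝ G] [FiniteDimensional ℝ G]
    (U : Opens F) (f : F → G) (hf : ContDiffOn ℝ ∞ f U) :
    (ofSpace F).ofOpens U ⟶ ofSpace G :=
  (⟨fun x : U => f x.1, fun x => contMDiffAt_subtype_iff.2
    (hf.contDiffAt (U.2.mem_nhds x.2)).contMDiffAt⟩ : C^∞⟮𝓘(ℝ, F), U; 𝓘(ℝ, G), G⟯)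

end Mfd

/-! ### Elements of a model -/

section Elements

variable {C : Type w} [SmallCategory C] {J : GrothendieckTopology C}

theorem appl_comp (ι : Mfd ⥤ Sheaf J (Type w)) {M N L : Mfd} (f : M ⟶ N) (g : N ⟶ L) {c : C}
    (x : Elt ι M c) : appl ι (f ≫ g) x = appl ι g (appl ι f x) := by
  simp [appl]

theorem appl_restr (ι : Mfd ⥤ Sheaf J (Type w)) {M N : Mfd} (f : M ⟶ N) {c d : C} (g : d ⟶ c)
    (x : Elt ι M c) : appl ι f (restr ι g x) = restr ι g (appl ι f x) :=
  congrArg (fun k => k x) ((ι.map f).hom.naturality g.op)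

theorem restr_comp (ι : Mfd ⥤ Sheaf J (Type w)) {M : Mfd} {c d e : C} (f : d ⟶ c) (g : e ⟶ d)
    (x : Elt ι M c) : restr ι (g ≫ f) x = restr ι g (restr ι f x) := by
  simp [restr]

namespace WellAdaptedModel

variable (M : WellAdaptedModel J)

/-- Passing from sheaves to presheaves and evaluating at a stage both preserve pullbacks, so
elements of the pullback are compatible pairs of elements. -/
theorem isPullback_elt {N₁ N₂ N₃ N₄ : Mfd} {a : N₁ ⟶ N₂} {b : N₁ ⟶ N₃} {f : N₂ ⟶ N₄} {g : N₃ ⟶ N₄}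
    (ht : Mfd.Transversal f g) (h : IsPullback a b f g) (c : C) :
    IsPullback ((M.ι.map a).hom.app (op c)) ((M.ι.map b).hom.app (op c))
      ((M.ι.map f).hom.app (op c)) ((M.ι.map g).hom.app (op c)) :=
  (M.transversal a b f g ht h).map (sheafToPresheaf J (Type w) ⋙ (evaluation _ _).obj (op c))

theorem elt_ext {N₁ N₂ N₃ N₄ : Mfd} {a : N₁ ⟶ N₂} {b : N₁ ⟶ N₃} {f : N₂ ⟶ N₄} {g : N₃ ⟶ N₄}
    (ht : Mfd.Transversal f g) (h : IsPullback a b f g) {c : C} {x y : Elt M.ι N₁ c}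
    (hx : appl M.ι a x = appl M.ι a y) (hy : appl M.ι b x = appl M.ι b y) : x = y :=
  Limits.Types.ext_of_isPullback (M.isPullback_elt ht h c) hx hy

theorem exists_elt {N₁ N₂ N₃ N₄ : Mfd} {a : N₁ ⟶ N₂} {b : N₁ ⟶ N₃} {f : N₂ ⟶ N₄} {g : N₃ ⟶ N₄}
    (ht : Mfd.Transversal f g) (h : IsPullback a b f g) {c : C} (x : Elt M.ι N₂ c)
    (y : Elt M.ι N₃ c) (hxy : appl M.ι f x = appl M.ι g y) :
    ∃ z : Elt M.ι N₁ c, appl M.ι a z = x ∧ appl M.ι b z = y :=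
  Limits.Types.exists_of_isPullback (M.isPullback_elt ht h c) x y hxy

theorem subsingleton_pt (c : C) : Subsingleton (Elt M.ι Mfd.pt c) := by
  obtain ⟨h⟩ := M.terminal _ ⟨Mfd.isTerminalPt⟩
  have h' : Limits.IsTerminal ((M.ι.obj Mfd.pt).obj.obj (op c)) :=
    Limits.IsTerminal.isTerminalObj (sheafToPresheaf J (Type w) ⋙ (evaluation _ _).obj (op c)) _ h
  exact ((Limits.Types.isTerminalEquivUnique _) h').instSubsingleton

section Prod

variable {F G : Type} [NormedAddCommGroup F] [NormedSpace ℝ F] [FiniteDimensional ℝ F]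
  [NormedAddCommGroup G] [NormedSpace ℝ G] [FiniteDimensional ℝ G]

theorem prod_ext {c : C} {x y : Elt M.ι (Mfd.ofSpace (F × G)) c}
    (h1 : appl M.ι (projFst F G) x = appl M.ι (projFst F G) y)
    (h2 : appl M.ι (projSnd F G) x = appl M.ι (projSnd F G) y) : x = y :=
  M.elt_ext (Mfd.transversal_toPt _ _) (Mfd.isPullback_prod F G) h1 h2

theorem exists_prod {c : C} (x : Elt M.ι (Mfd.ofSpace F) c) (y : Elt M.ι (Mfd.ofSpace G) c) :
    ∃ z : Elt M.ι (Mfd.ofSpace (F × G)) c,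
      appl M.ι (projFst F G) z = x ∧ appl M.ι (projSnd F G) z = y :=
  M.exists_elt (Mfd.transversal_toPt _ _) (Mfd.isPullback_prod F G) x y
    ((M.subsingleton_pt c).elim _ _)

end Prod

theorem incl_injective {N : Mfd} (U : Opens N.carrier) {c : C} {x y : Elt M.ι (N.ofOpens U) c}
    (h : appl M.ι (N.incl U) x = appl M.ι (N.incl U) y) : x = y := by
  -- A monomorphism is one whose kernel pair is trivial. This pullback is transversal, so the model
  -- preserves it.
  have hp : IsPullback (𝟙 (N.ofOpens U)) (𝟙 (N.ofOpens U)) (N.incl U) (N.incl U) :=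
    IsKernelPair.id_of_mono _
  obtain ⟨z, hz1, hz2⟩ := M.exists_elt (Mfd.transversal_incl _ U) hp x y h
  rw [← hz1, ← hz2]

/-- The element `x` belongs to the open part `U`. -/
def InOpen {N : Mfd} (U : Opens N.carrier) {c : C} (x : Elt M.ι N c) : Prop :=
  ∃ y : Elt M.ι (N.ofOpens U) c, appl M.ι (N.incl U) y = x

theorem inOpen_preim {N L : Mfd} (f : N ⟶ L) (U : Opens L.carrier) {c : C} {x : Elt M.ι N c}
    (h : M.InOpen U (appl M.ι f x)) : M.InOpen (Mfd.preim f U) x := by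
  obtain ⟨y, hy⟩ := h
  obtain ⟨z, hz, -⟩ := M.exists_elt (Mfd.transversal_incl f U) (Mfd.isPullback_preim f U) x y hy.symm
  exact ⟨z, hz⟩

/-- Membership in an open part is local. -/
theorem inOpen_of_local {N : Mfd} (U : Opens N.carrier) {c : C} {x : Elt M.ι N c} {R : Sieve c}
    (hR : R ∈ J c) (h : ∀ (d : C) (f : d ⟶ c), R f → M.InOpen U (restr M.ι f x)) :
    M.InOpen U x := by
  choose y hy using h
  have hsheaf := (isSheaf_iff_isSheaf_of_type J _).1 (M.ι.obj (N.ofOpens U)).property R hR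
  have hsheaf' := (isSheaf_iff_isSheaf_of_type J _).1 (M.ι.obj N).property R hR
  -- The local lifts agree on overlaps because lifts along the inclusion are unique; the sheaf
  -- condition then glues them.
  have hcomp : Presieve.FamilyOfElements.Compatible
      (fun d (f : d ⟶ c) (hf : R f) => y d f hf :
        Presieve.FamilyOfElements (M.ι.obj (N.ofOpens U)).obj R.arrows) := by
    intro d₁ d₂ e g₁ g₂ f₁ f₂ h₁ h₂ hg
    change restr M.ι g₁ (y d₁ f₁ h₁) = restr M.ι g₂ (y d₂ f₂ h₂)
    apply M.incl_injective U
    rw [appl_restr, appl_restr, hy, hy, ← restr_comp, ← restr_comp, hg]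
  refine ⟨hsheaf.amalgamate _ hcomp, hsheaf'.isSeparatedFor.ext fun d f hf => ?_⟩
  change restr M.ι f (appl M.ι (N.incl U) _) = restr M.ι f x
  rw [← appl_restr, ← hy d f hf]
  exact congrArg _ (hsheaf.valid_glue hcomp f hf)

/-- The empty family is an open covering of an empty manifold, so its image must cover as well. -/
theorem bot_mem_of_isEmpty {N : Mfd} (hN : IsEmpty N.carrier) {c : C} (x : Elt M.ι N c) :
    ∃ R ∈ J c, ∀ (d : C) (f : d ⟶ c), ¬ R f := by
  obtain ⟨R, hR, h⟩ := M.covering N Empty (fun i => i.elim) (fun x => hN.elim x) c x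
  exact ⟨R, hR, fun d f hf => (h d f hf).choose.elim⟩

/-- An element at which a nilpotent coordinate is invertible lives at an empty stage. -/
theorem empty_of_nilpotent {N : Mfd} (f : N ⟶ Mfd.ofSpace ℝ) {c : C} {x : Elt M.ι N c}
    (hx : appl M.ι (f ≫ squareMap) x = appl M.ι (f ≫ zeroMap ℝ) x)
    (W : Opens N.carrier) (hW : ∀ y ∈ W, Mfd.fn f y ≠ (0 : ℝ)) (h : M.InOpen W x) :
    ∃ R ∈ J c, ∀ (d : C) (f : d ⟶ c), ¬ R f := by
  obtain ⟨y, rfl⟩ := h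
  let Z : Opens (Mfd.ofSpace ℝ).carrier := (⟨{0}ᶜ, isOpen_compl_singleton⟩ : Opens ℝ)
  have h1 (y : (N.ofOpens W).carrier) : Mfd.fn (N.incl W ≫ f ≫ squareMap) y ∈ Z :=
    pow_ne_zero 2 (hW y.1 y.2)
  -- On `W` the square of `f` avoids zero, yet at this element it coincides with the zero map. So
  -- the zero map appears to land in `{0}ᶜ`, whose preimage under it is empty.
  have h2 : M.InOpen Z (appl M.ι (f ≫ zeroMap ℝ) (appl M.ι (N.incl W) y)) := by
    refine ⟨appl M.ι (Mfd.lift _ Z h1) y, ?_⟩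
    rw [← hx, ← appl_comp, Mfd.lift_incl, appl_comp]
  obtain ⟨z, -⟩ := M.inOpen_preim _ Z h2
  exact M.bot_mem_of_isEmpty (N := N.ofOpens (Mfd.preim (f ≫ zeroMap ℝ) Z))
    ⟨fun p => p.2 rfl⟩ z

/-- An element with a coordinate of square zero belongs to every open neighbourhood of the zero set
of this coordinate. -/
theorem inOpen_of_nilpotent {N : Mfd} (f : N ⟶ Mfd.ofSpace ℝ) {c : C} {x : Elt M.ι N c}
    (hx : appl M.ι f x ∈ FirstOrder M.ι c)
    (U : Opens N.carrier) (hU : ∀ y, Mfd.fn f y = (0 : ℝ) → y ∈ U) : M.InOpen U x := by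
  let Z : Opens (Mfd.ofSpace ℝ).carrier := (⟨{0}ᶜ, isOpen_compl_singleton⟩ : Opens ℝ)
  -- `U` and the set where `f` is nonzero cover `N`. Membership in `U` may be checked locally, and
  -- over the second piece it is vacuous because the empty sieve covers.
  obtain ⟨R, hR, h⟩ := M.covering N Bool (fun b => if b then U else Mfd.preim f Z) (fun y => by
    by_cases hy : Mfd.fn f y = (0 : ℝ)
    · exact ⟨true, hU y hy⟩
    · exact ⟨false, hy⟩) c x
  refine M.inOpen_of_local U hR fun d g hg => ?_
  obtain ⟨b, y, hy⟩ := h d g hg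
  cases b with
  | true => exact ⟨y, hy⟩
  | false =>
    have hx' : appl M.ι (f ≫ squareMap) x = appl M.ι (f ≫ zeroMap ℝ) x := by
      rw [appl_comp, appl_comp]
      exact hx
    obtain ⟨R', hR', h'⟩ := M.empty_of_nilpotent f (x := restr M.ι g x)
      (by rw [appl_restr, hx', appl_restr]) (Mfd.preim f Z) (fun y hy => hy) ⟨y, hy⟩
    exact M.inOpen_of_local U hR' fun d' g' hg' => (h' d' g' hg').elim

end WellAdaptedModel

end Elements

/-! ### The dipole field at infinitesimal thickness -/

/-- The map `(t, h, r) ↦ (t, r)`. -/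
noncomputable def dropMiddle (k : ℕ) : Mfd.ofSpace (EuclideanSpace ℝ (Fin k) × ℝ × E3) ⟶
    Mfd.ofSpace (EuclideanSpace ℝ (Fin k) × E3) :=
  Mfd.ofContDiff (fun y => (y.1, y.2.2)) (contDiff_fst.prodMk (contDiff_snd.comp contDiff_snd))

/-- The map `(s, a, b) ↦ a + s • b`. -/
noncomputable def addSmulMap : Mfd.ofSpace (ℝ × E3 × E3) ⟶ Mfd.ofSpace E3 :=
  Mfd.ofContDiff (fun y => y.2.1 + y.1 • y.2.2)
    ((contDiff_fst.comp contDiff_snd).add (contDiff_fst.smul (contDiff_snd.comp contDiff_snd)))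

/-- The underlying function of a morphism to a normed space. -/
noncomputable def Mfd.value {N : Mfd} {F : Type} [NormedAddCommGroup F] [NormedSpace ℝ F]
    [FiniteDimensional ℝ F] (f : N ⟶ Mfd.ofSpace F) : N.carrier → F := Mfd.fn f

namespace WellAdaptedModel

variable {C : Type w} [SmallCategory C] {J : GrothendieckTopology C} (M : WellAdaptedModel J)

/-- A function with a first-order expansion `F = h B + h² R` satisfies `F = h B` where `h² = 0`. -/
theorem isSmul_of_expansion {N : Mfd} (h : N ⟶ Mfd.ofSpace ℝ) (B R F : N ⟶ Mfd.ofSpace E3)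
    (hF : ∀ x, Mfd.value F x = Mfd.value h x • Mfd.value B x + Mfd.value h x ^ 2 • Mfd.value R x)
    {c : C} (m : Elt M.ι N c) (hm : appl M.ι h m ∈ FirstOrder M.ι c) :
    IsSmul M.ι (appl M.ι h m) (appl M.ι B m) (appl M.ι F m) := by
  refine ⟨appl M.ι (Mfd.pair h B) m, ?_, ?_, ?_⟩
  · rw [← appl_comp]
    rfl
  · rw [← appl_comp]
    rfl
  -- `F` is `addSmulMap` at the triple `(h², h B, R)`, and `h B` is the same map at `(0, h B, R)`.
  -- The two triples agree at `m` since `h² = 0` there.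
  let q : N ⟶ Mfd.ofSpace (E3 × E3) := Mfd.pair (Mfd.pair h B ≫ smulMap) R
  let α : N ⟶ Mfd.ofSpace (ℝ × E3 × E3) := Mfd.pair (h ≫ squareMap) q
  let β : N ⟶ Mfd.ofSpace (ℝ × E3 × E3) := Mfd.pair (h ≫ zeroMap ℝ) q
  have hα : F = α ≫ addSmulMap := Mfd.hom_ext hF
  have hβ : Mfd.pair h B ≫ smulMap = β ≫ addSmulMap := Mfd.hom_ext fun x => by
    change Mfd.value h x • Mfd.value B x
      = Mfd.value h x • Mfd.value B x + (0 : ℝ) • Mfd.value R x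
    rw [zero_smul, add_zero]
  have hαβ : appl M.ι α m = appl M.ι β m := by
    apply M.prod_ext
    · rw [← appl_comp, ← appl_comp]
      change appl M.ι (h ≫ squareMap) m = appl M.ι (h ≫ zeroMap ℝ) m
      rw [appl_comp, appl_comp]
      exact hm
    · rw [← appl_comp, ← appl_comp]
      rfl
  rw [← appl_comp, hβ, hα, appl_comp, appl_comp, hαβ]

theorem hasCoords_unique {k : ℕ} {U : Opens (EuclideanSpace ℝ (Fin k) × ℝ × E3)} {c : C}
    {t : Elt M.ι (Mfd.ofSpace (EuclideanSpace ℝ (Fin k))) c} {h : Elt M.ι (Mfd.ofSpace ℝ) c}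
    {r : Elt M.ι (Mfd.ofSpace E3) c}
    {z z' : Elt M.ι ((Mfd.ofSpace (EuclideanSpace ℝ (Fin k) × ℝ × E3)).ofOpens U) c}
    (hz : HasCoords M.ι U t h r z) (hz' : HasCoords M.ι U t h r z') : z' = z := by
  obtain ⟨h1, h2, h3⟩ := hz
  obtain ⟨h1', h2', h3'⟩ := hz'
  apply M.incl_injective (N := Mfd.ofSpace (EuclideanSpace ℝ (Fin k) × ℝ × E3)) U
  apply M.prod_ext
  · rw [← appl_comp, ← appl_comp, h1, h1']
  · apply M.prod_ext
    · rw [← appl_comp, ← appl_comp, ← appl_comp, ← appl_comp]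
      exact h2'.trans h2.symm
    · rw [← appl_comp, ← appl_comp, ← appl_comp, ← appl_comp]
      exact h3'.trans h3.symm

end WellAdaptedModel

theorem theorem4p3 {k : ℕ} (P : Set (EuclideanSpace ℝ (Fin k))) (hP : IsOpen P)
    (S : EuclideanSpace ℝ (Fin k) → OrientedSurface) (hS : IsSmoothFamily P S) :
    (∀ t ∈ P, ∀ r : E3, r ∉ (S t).carrier → (S t).doubleLayerField r = (S t).biotSavart r) ∧
    ∃ (U : Opens (EuclideanSpace ℝ (Fin k) × ℝ × E3)) (V : Opens (EuclideanSpace ℝ (Fin k) × E3))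
      (Edp : (Mfd.ofSpace (EuclideanSpace ℝ (Fin k) × ℝ × E3)).ofOpens U ⟶ Mfd.ofSpace E3)
      (B : (Mfd.ofSpace (EuclideanSpace ℝ (Fin k) × E3)).ofOpens V ⟶ Mfd.ofSpace E3),
      (U : Set _) = offSheets P S ∧ (V : Set _) = offSurface P S ∧
      (∀ y : U, Mfd.fn Edp y = (S y.1.1).dipoleField 1 y.1.2.1 y.1.2.2) ∧
      (∀ y : V, Mfd.fn B y = (S y.1.1).biotSavart y.1.2) ∧
      ∀ (C : Type w) [SmallCategory C] (J : GrothendieckTopology C) (M : WellAdaptedModel J)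
        (c : C) (t : Elt M.ι (Mfd.ofSpace (EuclideanSpace ℝ (Fin k))) c)
        (h : Elt M.ι (Mfd.ofSpace ℝ) c) (r : Elt M.ι (Mfd.ofSpace E3) c)
        (v : Elt M.ι ((Mfd.ofSpace (EuclideanSpace ℝ (Fin k) × E3)).ofOpens V) c),
        h ∈ FirstOrder M.ι c →
        appl M.ι (Mfd.incl _ V ≫ projFst _ _) v = t →
        appl M.ι (Mfd.incl _ V ≫ projSnd _ _) v = r →
        ∃ z : Elt M.ι ((Mfd.ofSpace (EuclideanSpace ℝ (Fin k) × ℝ × E3)).ofOpens U) c,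
          HasCoords M.ι U t h r z ∧ (∀ z', HasCoords M.ι U t h r z' → z' = z) ∧
          IsSmul M.ι h (appl M.ι B v) (appl M.ι Edp z) := by
  refine ⟨fun t ht r hr => doubleLayerField_eq_biotSavart hP hS ht hr, ?_⟩
  obtain ⟨R, hR, hexp⟩ := exists_dipoleField_expansion hP hS
  let U : Opens (EuclideanSpace ℝ (Fin k) × ℝ × E3) := ⟨offSheets P S, isOpen_offSheets hP hS⟩
  let V : Opens (EuclideanSpace ℝ (Fin k) × E3) := ⟨offSurface P S, isOpen_offSurface hP hS⟩
  let U' : Opens (EuclideanSpace ℝ (Fin k) × ℝ × E3) :=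
    ⟨starMiddle (offSheets P S), isOpen_starMiddle (isOpen_offSheets hP hS)⟩
  let Edp := Mfd.ofContDiffOn U _ (contDiffOn_dipoleField hP hS)
  let B := Mfd.ofContDiffOn V _ (contDiffOn_biotSavart hP hS)
  refine ⟨U, V, Edp, B, rfl, rfl, fun _ => rfl, fun _ => rfl, ?_⟩
  intro C _ J M c t h r v hh ht hr
  let A := Mfd.ofSpace (EuclideanSpace ℝ (Fin k) × ℝ × E3)
  obtain ⟨hr', hhr1, hhr2⟩ := M.exists_prod h r
  obtain ⟨a, ha1, ha2⟩ := M.exists_prod t hr'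
  have hav : appl M.ι (dropMiddle k) a = appl M.ι (Mfd.incl (Mfd.ofSpace _) V) v := by
    apply M.prod_ext
    · rw [← appl_comp, ← appl_comp, ht, ← ha1]
      rfl
    · rw [← appl_comp, ← appl_comp, hr, ← hhr2, ← ha2, ← appl_comp]
      rfl
  -- The triple `(t, h, r)` is placed over `V`, before anything is known about `h`.
  obtain ⟨n, hna, hnv⟩ := M.exists_elt (Mfd.transversal_incl (dropMiddle k) V)
    (Mfd.isPullback_preim (dropMiddle k) V) a v hav
  let N := A.ofOpens (Mfd.preim (dropMiddle k) V)
  let coordh : N ⟶ Mfd.ofSpace ℝ := A.incl _ ≫ projSnd _ _ ≫ projFst _ _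
  have hnh : appl M.ι coordh n = h := by
    rw [appl_comp, hna, appl_comp, ha2, hhr1]
  -- Over `V`, points with `h = 0` lie in the star-shaped part `U'`, so nilpotency of `h` puts the
  -- element into `U'`, where the expansion holds.
  obtain ⟨m, hm⟩ := M.inOpen_of_nilpotent coordh (x := n) (hnh ▸ hh)
    (Mfd.preim (A.incl (Mfd.preim (dropMiddle k) V)) U')
    fun y hy => mem_starMiddle_of_zero y.2 hy
  let N₁ := N.ofOpens (Mfd.preim (A.incl (Mfd.preim (dropMiddle k) V)) U')
  let toA : N₁ ⟶ A := N.incl _ ≫ A.incl _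
  let j : N₁ ⟶ A.ofOpens U := Mfd.lift toA U fun x => starMiddle_subset _ x.2
  let j' : N₁ ⟶ A.ofOpens U' := Mfd.lift toA U' fun x => x.2
  have hma : appl M.ι toA m = a := by rw [appl_comp, hm, hna]
  have hz : HasCoords M.ι U t h r (appl M.ι j m) := by
    refine ⟨?_, ?_, ?_⟩
    · rw [← appl_comp, ← ha1, ← hma, ← appl_comp]
      rfl
    · rw [← appl_comp, ← hhr1, ← ha2, ← hma, ← appl_comp, ← appl_comp]
      rfl
    · rw [← appl_comp, ← hhr2, ← ha2, ← hma, ← appl_comp, ← appl_comp]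
      rfl
  refine ⟨_, hz, fun z' hz' => M.hasCoords_unique hz hz', ?_⟩
  have hmh : appl M.ι (N.incl _ ≫ coordh) m = h := by rw [appl_comp, hm, hnh]
  have hmB : appl M.ι (N.incl _ ≫ Mfd.restrPreim (dropMiddle k) V ≫ B) m = appl M.ι B v := by
    rw [appl_comp, hm, appl_comp, hnv]
  have key := M.isSmul_of_expansion (N.incl _ ≫ coordh)
    (N.incl _ ≫ Mfd.restrPreim (dropMiddle k) V ≫ B) (j' ≫ Mfd.ofContDiffOn U' R hR) (j ≫ Edp)
    (fun x => hexp x.1.1 x.2) m (hmh ▸ hh)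
  rwa [hmh, hmB, appl_comp] at key
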